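/- Let $0<2\alpha<1$ and write $M=(\xi,\eta,\zeta)$, $P=(x,y,z)$, $r^2=(\xi-x)^2+(\eta-y)^2+(\zeta-z)^2$, $r_1^2=(\xi+x)^2+(\eta-y)^2+(\zeta-z)^2$, and $$q_1(M;P)=\frac1{2\pi}\,r^{-2\alpha-1}F\Big(\alpha+\tfrac12,\alpha;2\alpha;1-\frac{r_1^2}{r^2}\Big),$$ where $F(a,b;c;t)$ is the Gauss hypergeometric function (the sum of the hypergeometric series for $|t|<1$, continued analytically to real $t\le -1$). Let $D$ be a bounded domain in the half-space $x>0$ of $\mathbb R^3$ whose boundary is $X\cup\gamma\cup\Gamma$, where $X$ is a simply connected open domain of the plane $x=0$, $\Gamma$ is a surface in the half-space $x>0$, and $\gamma=\overline X\setminus X=\overline\Gamma\setminus\Gamma$ is the common boundary of $X$ and $\Gamma$. Let $\nu$ be the outer unit normal of $D$ on $\Gamma$. Suppose that $\Gamma$ is a Lyapunov surface, i.e. $\Gamma$ has a tangent plane at each of its points; there is $d>0$ such that for every $p\in\Gamma$ each line parallel to $\nu(p)$ meets the part of $\Gamma$ inside the ball of radius $d$ about $p$ at most once; and there are $A>0$,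 $0<\lambda\le 1$ such that the angle between $\nu(p)$ and $\nu(p')$ is at most $A|p-p'|^{\lambda}$ for all $p,p'\in\Gamma$. Suppose also that $\Gamma$ forms a right angle with the plane $x=0$ as its points approach $\gamma$, i.e. the $x$-component of $\nu$ tends to $0$ at every point of $\gamma$. For a function $u$ of $M$ put $$B_\nu^\alpha[u]=\xi^{2\alpha}\Big(\cos(\nu,\xi)\frac{\partial u}{\partial\xi}+\cos(\nu,\eta)\frac{\partial u}{\partial\eta}+\cos(\nu,\zeta)\frac{\partial u}{\partial\zeta}\Big).$$ Then for every point $P=(x,y,z)$ with $x\ge 0$ the integral below over $\Gamma$ (with respect to surface area) converges absolutely, and $$\iint_\Gamma B_\nu^\alpha[q_1(M;P)]\,d\Gamma=\begin{cases}-1,& P\in D\cup X,\\ -\tfrac12,& P\in\Gamma\cup\gamma,\\ 0,& P\notin\overline D.\end{cases}$$ -/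

import Mathlib

open Set Filter Topology MeasureTheory Asymptotics

/-- Euclidean space `ℝ³`; the coordinates `(x, y, z)` of a point `P` are `P 0`, `P 1`, `P 2`. -/
abbrev E3 : Type := EuclideanSpace ℝ (Fin 3)

/-! ### The Gauss hypergeometric function and the fundamental solution -/

theorem eulerAux_differentiable (K : ℝ → ℂ) (hK : IntegrableOn K (Ioc 0 1)) (g : ℂ → ℂ)
    (hg : DifferentiableOn ℂ g {z | z.re < 1}) :
    DifferentiableOn ℂ (fun z => ∫ t in Ioc (0 : ℝ) 1, K t * g (t * z)) {z | z.re < 1} := by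
  have hO : IsOpen {z : ℂ | z.re < 1} := isOpen_lt Complex.continuous_re continuous_const
  have hmem : ∀ z : ℂ, z.re < 1 → ∀ t : ℝ, t ∈ Icc (0 : ℝ) 1 → ((t : ℂ) * z).re < 1 := by
    intro z hz t ht
    rw [Complex.re_ofReal_mul]
    rcases le_total z.re 0 with h | h <;> nlinarith [ht.1, ht.2]
  have hdg : ContinuousOn (deriv g) {z | z.re < 1} := (hg.deriv hO).continuousOn
  intro z0 hz0
  obtain ⟨ε, ε0, hε⟩ := Metric.nhds_basis_closedBall.mem_iff.1 (hO.mem_nhds hz0)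
  have hcomp : IsCompact ((fun q : ℝ × ℂ => (q.1 : ℂ) * q.2) ''
      (Icc (0 : ℝ) 1 ×ˢ Metric.closedBall z0 ε)) :=
    (isCompact_Icc.prod (isCompact_closedBall z0 ε)).image (by fun_prop)
  have hsub : ((fun q : ℝ × ℂ => (q.1 : ℂ) * q.2) ''
      (Icc (0 : ℝ) 1 ×ˢ Metric.closedBall z0 ε)) ⊆ {z | z.re < 1} := by
    rintro _ ⟨⟨t, z⟩, ⟨ht, hz⟩, rfl⟩
    exact hmem z (hε hz) t ht
  obtain ⟨C, hC⟩ := hcomp.exists_bound_of_continuousOn (hdg.mono hsub)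
  obtain ⟨C0, hC0⟩ := hcomp.exists_bound_of_continuousOn (hg.continuousOn.mono hsub)
  have hcont : ∀ h : ℂ → ℂ, ContinuousOn h {z | z.re < 1} → ∀ z : ℂ, z.re < 1 →
      AEStronglyMeasurable (fun t : ℝ => h (t * z)) (volume.restrict (Ioc (0 : ℝ) 1)) := by
    intro h hh z hz
    refine ContinuousOn.aestronglyMeasurable ?_ measurableSet_Ioc
    exact hh.comp (by fun_prop) (fun t ht => hmem z hz t (Ioc_subset_Icc_self ht))
  refine HasDerivAt.differentiableAt (f' := ∫ t in Ioc (0 : ℝ) 1, K t * (t * deriv g (t * z0))) ?_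
    |>.differentiableWithinAt
  refine (hasDerivAt_integral_of_dominated_loc_of_deriv_le
    (F := fun z (t : ℝ) => K t * g (t * z))
    (F' := fun z (t : ℝ) => K t * (t * deriv g (t * z)))
    (bound := fun t => ‖K t‖ * C)
    (Metric.closedBall_mem_nhds z0 ε0) ?_ ?_ ?_ ?_ ?_ ?_).2
  · filter_upwards [hO.mem_nhds hz0] with z hz
    exact hK.1.mul (hcont g hg.continuousOn z hz)
  · refine hK.mul_bdd (c := C0) (hcont g hg.continuousOn z0 hz0) ?_
    filter_upwards [ae_restrict_mem measurableSet_Ioc] with t ht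
    exact hC0 _ ⟨(t, z0), ⟨Ioc_subset_Icc_self ht, Metric.mem_closedBall_self ε0.le⟩, rfl⟩
  · exact hK.1.mul ((Complex.continuous_ofReal.aestronglyMeasurable).mul (hcont _ hdg z0 hz0))
  · filter_upwards [ae_restrict_mem measurableSet_Ioc] with t ht z hz
    have h1 := hC _ ⟨(t, z), ⟨Ioc_subset_Icc_self ht, hz⟩, rfl⟩
    simp only at h1
    rw [norm_mul, norm_mul]
    have ht' : ‖(t : ℂ)‖ ≤ 1 := by
      rw [Complex.norm_real, Real.norm_of_nonneg ht.1.le]; exact ht.2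
    gcongr
    calc _ ≤ 1 * ‖deriv g (t * z)‖ := by gcongr
      _ ≤ C := by simpa using h1
  · exact hK.norm.mul_const C
  · filter_upwards [ae_restrict_mem measurableSet_Ioc] with t ht z hz
    have h2 : HasDerivAt g (deriv g (t * z)) (t * z) :=
      (hg.differentiableAt (hO.mem_nhds (hmem z (hε hz) t (Ioc_subset_Icc_self ht)))).hasDerivAt
    have h3 : HasDerivAt (fun z : ℂ => (t : ℂ) * z) t z := by
      simpa using (hasDerivAt_id z).const_mul (t : ℂ)
    have := (h2.comp z h3).const_mul (K t)
    simpa [Function.comp_def, mul_comm] using this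

theorem eulerAux_coeff {b c : ℝ} (hb : 0 < b) (hbc : b < c) (n : ℕ) :
    Complex.betaIntegral ((b : ℂ) + n) ((c - b : ℝ) : ℂ) =
      Complex.betaIntegral b ((c - b : ℝ) : ℂ) *
        (((ascPochhammer ℝ n).eval b * ((ascPochhammer ℝ n).eval c)⁻¹ : ℝ) : ℂ) := by
  have hc : 0 < c := hb.trans hbc
  have hne : ∀ x : ℝ, 0 < x → ∀ k : ℕ, (x : ℂ) ≠ -k := by
    intro x hx k h
    have : x = -(k : ℝ) := by exact_mod_cast h
    have hk : (0 : ℝ) ≤ k := k.cast_nonneg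
    linarith
  have hcast : ∀ x : ℝ, (((ascPochhammer ℝ n).eval x : ℝ) : ℂ) = (ascPochhammer ℂ n).eval (x : ℂ) := by
    intro x
    rw [← ascPochhammer_map (algebraMap ℝ ℂ), Polynomial.eval_map_algebraMap,
      ← Complex.coe_algebraMap, Polynomial.aeval_algebraMap_apply_eq_algebraMap_eval]
  have hG : ∀ x : ℝ, 0 < x → Complex.Gamma (x : ℂ) ≠ 0 := fun x hx =>
    Complex.Gamma_ne_zero_of_re_pos (by simpa using hx)
  have hG' : ∀ x : ℝ, 0 < x → Complex.Gamma ((x : ℂ) + n) ≠ 0 := fun x hx =>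
    Complex.Gamma_ne_zero_of_re_pos (by simp; positivity)
  rw [Complex.betaIntegral_eq_Gamma_mul_div _ _ (by simp; positivity) (by simpa using hbc),
    Complex.betaIntegral_eq_Gamma_mul_div _ _ (by simpa using hb) (by simpa using hbc)]
  push_cast
  rw [hcast, hcast, ← Complex.Gamma_add_nat_div_Gamma_eq _ (hne b hb),
    ← Complex.Gamma_add_nat_div_Gamma_eq _ (hne c hc)]
  have e1 : (b : ℂ) + n + (c - b) = c + n := by ring
  have e2 : (b : ℂ) + (c - b) = c := by ring
  rw [e1, e2]
  have := hG b hb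
  have := hG c hc
  have := hG' c hc
  field_simp

/-- `f` is the analytic continuation of the Gauss series `F(a, b; c; ·)` from `(-1, 1)` to the
ray `(-∞, 1)`. -/
def IsGaussContinuation (a b c : ℝ) (f : ℝ → ℝ) : Prop :=
  AnalyticOnNhd ℝ f (Iio 1) ∧ ∀ t ∈ Ioo (-1 : ℝ) 1, f t = ordinaryHypergeometric a b c t

/-- The analytic continuation exists when `0 < b < c` (it is given by Euler's integral). -/
theorem exists_isGaussContinuation (a : ℝ) {b c : ℝ} (hb : 0 < b) (hbc : b < c) :
    ∃ f, IsGaussContinuation a b c f := by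
  set K : ℝ → ℂ := fun t => (t : ℂ) ^ ((b : ℂ) - 1) * (1 - (t : ℂ)) ^ (((c - b : ℝ) : ℂ) - 1) with hKdef
  set g : ℂ → ℂ := fun z => 1 / (1 - z) ^ (a : ℂ) with hgdef
  set B : ℂ := Complex.betaIntegral b ((c - b : ℝ) : ℂ) with hB
  have hbre : 0 < (b : ℂ).re := by simpa using hb
  have hcre : 0 < ((c - b : ℝ) : ℂ).re := by simpa using hbc
  have hK : IntegrableOn K (Ioc 0 1) :=
    (intervalIntegrable_iff_integrableOn_Ioc_of_le zero_le_one).1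
      (Complex.betaIntegral_convergent hbre hcre)
  have hB0 : B ≠ 0 := by
    rw [hB, Complex.betaIntegral_eq_Gamma_mul_div _ _ hbre hcre]
    refine div_ne_zero (mul_ne_zero ?_ ?_) ?_ <;> apply Complex.Gamma_ne_zero_of_re_pos
    · exact hbre
    · exact hcre
    · simpa using hb.trans hbc
  have hO : IsOpen {z : ℂ | z.re < 1} := isOpen_lt Complex.continuous_re continuous_const
  have hg : DifferentiableOn ℂ g {z | z.re < 1} := by
    intro z hz
    have hz' : (1 - z) ∈ Complex.slitPlane := Or.inl (by simpa using hz)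
    refine DifferentiableAt.differentiableWithinAt ?_
    refine (differentiableAt_const _).div ?_ ?_
    · exact ((differentiableAt_const _).sub differentiableAt_id).cpow_const hz'
    · rw [Ne, Complex.cpow_eq_zero_iff]
      exact fun h => Complex.slitPlane_ne_zero hz' h.1
  have hG := eulerAux_differentiable K hK g hg
  refine ⟨fun x => (B⁻¹ * ∫ t in Ioc (0 : ℝ) 1, K t * g (t * (x : ℂ))).re, ?_, ?_⟩
  · intro x hx
    have h1 := (hG.const_mul B⁻¹).analyticAt (hO.mem_nhds (show ((x : ℂ)).re < 1 by simpa using hx))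
    exact h1.re_ofReal
  · intro x hx
    set p : ℕ → ℂ := fun n => Ring.choose ((a : ℂ) + n - 1) n with hp
    have hps := Complex.one_div_one_sub_cpow_hasFPowerSeriesOnBall_zero (a : ℂ)
    have hxn : ‖(x : ℂ)‖ < 1 := by
      rw [Complex.norm_real, Real.norm_eq_abs, abs_lt]; exact hx
    have hser : ∀ w : ℂ, ‖w‖ < 1 → HasSum (fun n => p n * w ^ n) (g w) := by
      intro w hw
      have := hps.hasSum (y := w) (by simpa [← ofReal_norm, ENNReal.ofReal_lt_one] using hw)
      simpa [FormalMultilinearSeries.ofScalars_apply_eq, hp, hgdef, mul_comm] using this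
    have hsum : Summable fun n => ‖p n * (x : ℂ) ^ n‖ := (hser x hxn).summable.norm
    have hterm : ∀ n : ℕ, ∀ t ∈ Ioc (0 : ℝ) 1, K t * (p n * (t * (x : ℂ)) ^ n) =
        (p n * (x : ℂ) ^ n) * ((t : ℂ) ^ ((b : ℂ) + n - 1) *
          (1 - (t : ℂ)) ^ (((c - b : ℝ) : ℂ) - 1)) := by
      intro n t ht
      have ht0 : (t : ℂ) ≠ 0 := by exact_mod_cast ht.1.ne'
      rw [hKdef, show (b : ℂ) + n - 1 = (b - 1) + n by ring, Complex.cpow_add _ _ ht0,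
        Complex.cpow_natCast]
      simp only [mul_pow]
      ring
    have hint : ∀ n : ℕ, ∫ t in Ioc (0 : ℝ) 1, K t * (p n * (t * (x : ℂ)) ^ n) =
        (p n * (x : ℂ) ^ n) * Complex.betaIntegral ((b : ℂ) + n) ((c - b : ℝ) : ℂ) := by
      intro n
      rw [setIntegral_congr_fun measurableSet_Ioc (hterm n), integral_const_mul,
        Complex.betaIntegral, intervalIntegral.integral_of_le zero_le_one]
    have htn : ∀ t ∈ Ioc (0 : ℝ) 1, ∀ n : ℕ, ‖(t : ℂ) ^ n‖ ≤ 1 := by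
      intro t ht n
      rw [norm_pow, Complex.norm_real, Real.norm_of_nonneg ht.1.le]
      exact pow_le_one₀ ht.1.le ht.2
    have hI : ∀ n : ℕ, IntegrableOn (fun t : ℝ => K t * (p n * (t * (x : ℂ)) ^ n)) (Ioc 0 1) := by
      intro n
      refine hK.mul_bdd (c := ‖p n * (x : ℂ) ^ n‖)
        (Continuous.aestronglyMeasurable (by fun_prop)) ?_
      filter_upwards [ae_restrict_mem measurableSet_Ioc] with t ht
      rw [mul_pow, mul_left_comm, norm_mul]
      exact mul_le_of_le_one_left (norm_nonneg _) (htn t ht n)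
    have hS : Summable fun n => ∫ t in Ioc (0 : ℝ) 1, ‖K t * (p n * (t * (x : ℂ)) ^ n)‖ := by
      refine Summable.of_nonneg_of_le (fun n => integral_nonneg fun _ => norm_nonneg _) (fun n => ?_)
        (hsum.mul_left (∫ t in Ioc (0 : ℝ) 1, ‖K t‖))
      rw [← integral_mul_const]
      refine setIntegral_mono_on (hI n).norm (hK.norm.mul_const _) measurableSet_Ioc ?_
      intro t ht
      rw [norm_mul, mul_pow, mul_left_comm, norm_mul ((t : ℂ) ^ n)]
      gcongr
      exact mul_le_of_le_one_left (norm_nonneg _) (htn t ht n)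
    have hmain := hasSum_integral_of_summable_integral_norm hI hS
    have hval : ∫ t in Ioc (0 : ℝ) 1, ∑' n, K t * (p n * (t * (x : ℂ)) ^ n) =
        ∫ t in Ioc (0 : ℝ) 1, K t * g (t * (x : ℂ)) := by
      refine setIntegral_congr_fun measurableSet_Ioc fun t ht => ?_
      refine ((hser _ ?_).mul_left (K t)).tsum_eq
      rw [norm_mul]
      have := htn t ht 1
      rw [pow_one] at this
      exact (mul_le_of_le_one_left (norm_nonneg _) this).trans_lt hxn
    rw [hval] at hmain
    simp_rw [hint] at hmain
    have hpn : ∀ n : ℕ, p n = (((n.factorial : ℝ)⁻¹ * (ascPochhammer ℝ n).eval a : ℝ) : ℂ) := by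
      intro n
      have h1 := Ring.factorial_nsmul_multichoose_eq_ascPochhammer (a : ℂ) n
      have h2 : (((ascPochhammer ℝ n).eval a : ℝ) : ℂ) = (ascPochhammer ℂ n).eval (a : ℂ) := by
        rw [← ascPochhammer_map (algebraMap ℝ ℂ), Polynomial.eval_map_algebraMap,
          ← Complex.coe_algebraMap, Polynomial.aeval_algebraMap_apply_eq_algebraMap_eval]
      rw [Ring.multichoose_eq, Polynomial.ascPochhammer_smeval_eq_eval, nsmul_eq_mul, ← h2] at h1
      have h3 : (n.factorial : ℂ) ≠ 0 := by exact_mod_cast n.factorial_ne_zero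
      push_cast
      rw [← h1, hp]
      field_simp
    have hfin := (hmain.mul_left B⁻¹)
    have hcoef : ∀ n : ℕ, B⁻¹ * (p n * (x : ℂ) ^ n *
        Complex.betaIntegral ((b : ℂ) + n) ((c - b : ℝ) : ℂ)) =
        ((((n.factorial : ℝ)⁻¹ * (ascPochhammer ℝ n).eval a * (ascPochhammer ℝ n).eval b *
          ((ascPochhammer ℝ n).eval c)⁻¹) • x ^ n : ℝ) : ℂ) := by
      intro n
      rw [eulerAux_coeff hb hbc, hpn, ← hB]
      push_cast [smul_eq_mul]
      field_simp
    simp_rw [hcoef] at hfin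
    rw [ordinaryHypergeometric_eq_tsum]
    have h3 := (Complex.hasSum_re hfin).tsum_eq
    simp only [Complex.ofReal_re] at h3
    exact h3.symm

/-- The Gauss hypergeometric function `F(a, b; c; t)` for real `t < 1`: the sum of the
hypergeometric series for `|t| < 1`, and its analytic continuation for `t ≤ -1`. -/
noncomputable def gaussF (a b c : ℝ) : ℝ → ℝ :=
  Classical.epsilon (IsGaussContinuation a b c)

theorem gaussF_spec (a : ℝ) {b c : ℝ} (hb : 0 < b) (hbc : b < c) :
    IsGaussContinuation a b c (gaussF a b c) :=
  Classical.epsilon_spec (exists_isGaussContinuation a hb hbc)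

/-- The analytic continuation is unique. -/
theorem IsGaussContinuation.eqOn {a b c : ℝ} {f g : ℝ → ℝ} (hf : IsGaussContinuation a b c f)
    (hg : IsGaussContinuation a b c g) : EqOn f g (Iio 1) := by
  refine hf.1.eqOn_of_preconnected_of_eventuallyEq hg.1 isPreconnected_Iio
    (z₀ := 0) (by simp) ?_
  filter_upwards [Ioo_mem_nhds (show (-1 : ℝ) < 0 by norm_num) one_pos] with t ht
  rw [hf.2 t ht, hg.2 t ht]

/-- The square of the distance `r` between `M = (ξ, η, ζ)` and `P = (x, y, z)`. -/
def distSq (M P : E3) : ℝ := (M 0 - P 0) ^ 2 + (M 1 - P 1) ^ 2 + (M 2 - P 2) ^ 2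

/-- The square of the distance `r₁` between `M` and the mirror image of `P` in the plane `x = 0`. -/
def distSqRefl (M P : E3) : ℝ := (M 0 + P 0) ^ 2 + (M 1 - P 1) ^ 2 + (M 2 - P 2) ^ 2

/-- The fundamental solution
`q₁(M; P) = (1 / 2π) r ^ (-2α - 1) F(α + 1/2, α; 2α; 1 - r₁² / r²)`. -/
noncomputable def q1 (α : ℝ) (M P : E3) : ℝ :=
  1 / (2 * Real.pi) * Real.sqrt (distSq M P) ^ (-2 * α - 1) *
    gaussF (α + 1 / 2) α (2 * α) (1 - distSqRefl M P / distSq M P)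

/-- The conormal derivative `B_ν^α[u] = ξ ^ (2α) ∑ᵢ cos(ν, eᵢ) ∂ᵢ u` of `u` at the point `M`, whose
first coordinate is `ξ`; `ν` is a unit vector field, so `cos(ν, eᵢ) = νᵢ`. -/
noncomputable def conormalDeriv (α : ℝ) (ν : E3 → E3) (u : E3 → ℝ) (M : E3) : ℝ :=
  M 0 ^ (2 * α) * ∑ i : Fin 3, ν M i * fderiv ℝ u M (EuclideanSpace.single i 1)

/-- The function `M ↦ B_ν^α[q₁(M; P)]`, the conormal derivative being taken with respect to `M`. -/
noncomputable def doubleLayerKernel (α : ℝ) (ν : E3 → E3) (P M : E3) : ℝ :=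
  conormalDeriv α ν (fun N => q1 α N P) M

/-! ### The surface and the domain -/

/-- The half-space `x > 0`. -/
def halfSpace : Set E3 := {P | 0 < P 0}

/-- The plane `x = 0`, that is, the plane `yOz`. -/
def planeYZ : Set E3 := {P | P 0 = 0}

/-- `S` is a Lyapunov surface with unit normal field `n`: a two-dimensional topological manifold
that has a tangent plane at each point, such that, for a radius `d` that is the same for all
points, a line parallel to the normal at `p` meets the part of `S` within distance `d` of `p` at
most once, and such that the angle between the normals at `p` and `q` is at most `A |p - q| ^ l`
for some constants `A > 0` and `0 < l ≤ 1`. -/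
structure IsLyapunovSurface (S : Set E3) (n : E3 → E3) : Prop where
  surface : Nonempty (ChartedSpace (EuclideanSpace ℝ (Fin 2)) S)
  unit : ∀ p ∈ S, ‖n p‖ = 1
  tangent : ∀ p ∈ S, (fun q => inner ℝ (q - p) (n p)) =o[𝓝[S] p] (fun q => q - p)
  line : ∃ d > 0, ∀ p ∈ S, ∀ q ∈ S ∩ Metric.ball p d, ∀ q' ∈ S ∩ Metric.ball p d,
    (∃ c : ℝ, q' - q = c • n p) → q' = q
  holder : ∃ A > 0, ∃ l : ℝ, 0 < l ∧ l ≤ 1 ∧ ∀ p ∈ S, ∀ q ∈ S,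
    InnerProductGeometry.angle (n p) (n q) ≤ A * dist p q ^ l

/-- The vectors `ν p`, `p ∈ S`, point out of the domain `D`, of whose boundary `S` is a part. -/
def PointsOutward (D S : Set E3) (ν : E3 → E3) : Prop :=
  ∀ p ∈ S, ∀ᶠ t : ℝ in 𝓝[>] 0, p - t • ν p ∈ D ∧ p + t • ν p ∉ closure D

/-- `D` is a bounded domain in the half-space `x > 0`, bounded by the simply connected plane
domain `X` of the plane `x = 0` and by the surface `Γ` in the half-space `x > 0`;
`γ` is the common boundary of `X` and `Γ`. -/
structure IsBoundedBy (D X Γ γ : Set E3) : Prop where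
  isOpen : IsOpen D
  isConnected : IsConnected D
  isBounded : Bornology.IsBounded D
  subset : D ⊆ halfSpace
  plane_subset : X ⊆ planeYZ
  plane_isOpen : ∃ U : Set E3, IsOpen U ∧ X = U ∩ planeYZ
  plane_simplyConnected : IsSimplyConnected X
  surface_subset : Γ ⊆ halfSpace
  edge_plane : γ = closure X \ X
  edge_surface : γ = closure Γ \ Γ
  frontier_eq : frontier D = X ∪ γ ∪ Γ

/-- The surface `Γ` with unit normal field `ν` forms a right angle with the plane `x = 0` as its
points approach the edge `γ`: the `x`-component of the normal tends to zero. -/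
def MeetsPlaneOrthogonally (Γ γ : Set E3) (ν : E3 → E3) : Prop :=
  ∀ p ∈ γ, Tendsto (fun q => ν q 0) (𝓝[Γ] p) (𝓝 0)

/-- The area measure `dΓ` of the surface `Γ`: the two-dimensional Hausdorff measure, normalized so
that it is Lebesgue measure on planes, restricted to `Γ`. -/
noncomputable def surfaceMeasure (Γ : Set E3) : Measure E3 :=
  (Measure.euclideanHausdorffMeasure 2 : Measure E3).restrict Γ

/-!
The kernel `B_ν^α[q₁(·; P)]` is the normal component `⟪V, ν⟫` of the field `V = ξ ^ (2α) ∇ q₁(·; P)`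
(`fluxField`, `doubleLayerKernel_eq`), and `V` is divergence-free off the pole `P`, because `q₁` solves
the singular elliptic equation `div (ξ ^ (2α) ∇ u) = 0` (`divergence_fluxField`). The integral is
therefore the flux of `V` through `Γ`, and everything but the pole contributes nothing to it: there is
no flux through the plane part of the boundary, where `V` is `O(ξ ^ (2α))`. Cutting the pole off with a
smooth function on the scale `δ` and rescaling by `δ` about `P` gives the flux as an integral over the
blow-up of `D` at `P` of an explicit homogeneous density in a spherical shell (`flux_eq_of_blowup`).
The blow-up is the whole space for `P ∈ D`, the half-space `x > 0` for `P ∈ X`, the half-space behind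
the tangent plane for `P ∈ Γ`, and, since the surface meets the plane `x = 0` at a right angle, a
quarter-space for `P ∈ γ`; the values `-1`, `-1`, `-1/2`, `-1/2` follow by symmetry from the integral
over the whole shell (`integral_shellDensity`).

* The kernel. Euler's integral for the hypergeometric function (`gaussF_eq_integral`) represents `q₁`
  as a superposition of powers of `r² (1 - t) + r₁² t`. The equation for `q₁` comes from integrating a
  total derivative in `t`. A Möbius substitution in the integral exchanges the roles of `r` and `r₁` and
  exhibits the singularity at the pole: `|V| = O(r ^ (-2))`, and
  `|⟪V, ν⟫| = O(|⟪M - P, ν⟫| r ^ (-3) + r ^ (-1))` (`abs_inner_fluxField_le_of_norm`). For `P` off the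
  plane, `V` is asymptotic to the Newtonian field of a unit mass by Legendre's duplication formula; for
  `P` on the plane, `V` is itself homogeneous.

* The surface. All that is used of the domain is collected in `HasHolderBoundary`: the normal is Hölder
  continuous with exponent `l`, and lines transversal to the surface cross from `D` to the outside of
  `closure D`. Hence lines cross the surface at most once at a suitable scale, which yields
  `|⟪M - P, ν M⟫| ≤ C |M - P| ^ (1 + l)`, the description of the blow-up at points of `closure Γ`, and
  the comparison of the area of `Γ` with the area of its projections to planes. With the integrability
  of `|M - P| ^ s`, `s > -2`, on `Γ`, the kernel is integrable.

* The Gauss–Green formula (`HasHolderBoundary.gauss_green`) for functions supported away from the plane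
  is proved up to a small relative error for nonnegative functions supported in small balls, by Fubini
  on the lines parallel to the normal at the centre, and then summed over a partition of unity.
-/

/-! ### Domains with a Hölder continuous normal in the half-space -/

/-- `D` is a bounded open subset of the half-space whose boundary inside the half-space is `Γ`, and
`ν` is an outer unit normal on `Γ`, Hölder continuous with constant `A` and exponent `l`. That `ν`
is the outer normal is encoded by `crossing`: a ray leaving a point of `Γ` in a direction on the
side of `ν` starts outside of `closure D`, and the opposite ray starts in `D`. -/
structure HasHolderBoundary (D Γ : Set E3) (ν : E3 → E3) (A l : ℝ) : Prop where
  isOpen : IsOpen D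
  isBounded : Bornology.IsBounded D
  subset : D ⊆ halfSpace
  eq_frontier : Γ = frontier D ∩ halfSpace
  unit : ∀ p ∈ Γ, ‖ν p‖ = 1
  const_pos : 0 < A
  exp_pos : 0 < l
  exp_le : l ≤ 1
  holder : ∀ p ∈ Γ, ∀ q ∈ Γ, ‖ν p - ν q‖ ≤ A * dist p q ^ l
  crossing : ∀ p ∈ Γ, ∀ e : E3, 0 < inner ℝ (ν p) e →
    ∀ᶠ t : ℝ in 𝓝[>] 0, p - t • e ∈ D ∧ p + t • e ∉ closure D

theorem isOpen_halfSpace : IsOpen halfSpace :=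
  isOpen_lt continuous_const (by fun_prop)

theorem convex_halfSpace : Convex ℝ halfSpace := by
  intro p hp q hq a b ha hb hab
  simp only [halfSpace, mem_ofPred_eq, PiLp.add_apply, PiLp.smul_apply, smul_eq_mul] at *
  rcases ha.eq_or_lt with rfl | ha
  · have : b = 1 := by linarith
    subst this; linarith
  · have := mul_pos ha hp
    have := mul_nonneg hb hq.le
    linarith

theorem convex_cone (p n : E3) {c : ℝ} (hc : 0 ≤ c) :
    Convex ℝ {q : E3 | c * ‖q - p‖ < inner ℝ (q - p) n} := by
  intro q hq q' hq' a b ha hb hab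
  simp only [mem_ofPred_eq] at *
  have e : a • q + b • q' - p = a • (q - p) + b • (q' - p) := by
    rw [smul_sub, smul_sub]
    have : p = a • p + b • p := by rw [← add_smul, hab, one_smul]
    nth_rewrite 1 [this]; abel
  rw [e, inner_add_left, real_inner_smul_left, real_inner_smul_left]
  have h1 : ‖a • (q - p) + b • (q' - p)‖ ≤ a * ‖q - p‖ + b * ‖q' - p‖ := by
    refine (norm_add_le _ _).trans_eq ?_
    rw [norm_smul, norm_smul, Real.norm_of_nonneg ha, Real.norm_of_nonneg hb]
  have h2 := mul_le_mul_of_nonneg_left h1 hc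
  rcases ha.eq_or_lt with rfl | ha
  · have : b = 1 := by linarith
    subst this; nlinarith
  · have := mul_lt_mul_of_pos_left hq ha
    have := mul_le_mul_of_nonneg_left hq'.le hb
    nlinarith

/-- A truncated cone with apex `p` around the normal misses the surface, hence lies on one side. -/
theorem exists_cone_disjoint {S : Set E3} {p n e : E3}
    (ht : (fun q => inner ℝ (q - p) n) =o[𝓝[S] p] (fun q => q - p)) (he : 0 < inner ℝ n e) :
    ∃ c > 0, c < 1 ∧ c * ‖e‖ < inner ℝ n e ∧
      ∀ᶠ δ in 𝓝[>] 0, ∀ q ∈ S ∩ Metric.ball p δ, |inner ℝ (q - p) n| ≤ c * ‖q - p‖ := by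
  have he0 : 0 < ‖e‖ := norm_pos_iff.2 (by rintro rfl; simp at he)
  refine ⟨min 1 (inner ℝ n e / ‖e‖) / 2, by positivity, ?_, ?_, ?_⟩
  · linarith [min_le_left 1 (inner ℝ n e / ‖e‖)]
  · calc _ ≤ (inner ℝ n e / ‖e‖) / 2 * ‖e‖ := by gcongr; exact min_le_right _ _
      _ = inner ℝ n e / 2 := by field_simp
      _ < _ := by linarith
  · have h1 := ht.def (c := min 1 (inner ℝ n e / ‖e‖) / 2) (by positivity)
    rw [eventually_nhdsWithin_iff, Metric.eventually_nhds_iff_ball] at h1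
    obtain ⟨ε, ε0, hε⟩ := h1
    filter_upwards [Ioo_mem_nhdsGT ε0] with δ hδ q hq
    exact hε q (Metric.ball_subset_ball hδ.2.le hq.2) hq.1

/-- A preconnected set that meets `D` and its complement meets the frontier of `D`. -/
theorem IsPreconnected.exists_mem_frontier {X : Type*} [TopologicalSpace X] {K D : Set X}
    (hK : IsPreconnected K) {p q : X} (hp : p ∈ K ∩ D) (hq : q ∈ K \ D) : ∃ z ∈ K, z ∈ frontier D := by
  by_contra! h
  have h1 : ∀ z ∈ K, z ∈ D → z ∈ interior D := fun z hz hzD => by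
    by_contra hzi
    exact h z hz ⟨subset_closure hzD, hzi⟩
  have h2 : ∀ z ∈ K, z ∉ D → z ∈ (closure D)ᶜ := fun z hz hzD hzc =>
    h z hz ⟨hzc, fun h' => hzD (interior_subset h')⟩
  obtain ⟨z, -, hz, hz'⟩ := hK _ _ isOpen_interior isClosed_closure.isOpen_compl
    (fun z hz => (em (z ∈ D)).imp (h1 z hz) (h2 z hz)) ⟨p, hp.1, h1 p hp.1 hp.2⟩
    ⟨q, hq.1, h2 q hq.1 hq.2⟩
  exact hz' (interior_subset_closure hz)

theorem norm_sub_le_angle {u v : E3} (hu : ‖u‖ = 1) (hv : ‖v‖ = 1) :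
    ‖u - v‖ ≤ InnerProductGeometry.angle u v := by
  have h0 := InnerProductGeometry.angle_nonneg u v
  have h1 := Real.one_sub_sq_div_two_le_cos (x := InnerProductGeometry.angle u v)
  rw [InnerProductGeometry.cos_angle, hu, hv] at h1
  have h2 := norm_sub_sq_real u v
  rw [hu, hv] at h2
  refine abs_le_of_sq_le_sq' (by linarith) h0 |>.2

/-- The regularity of the boundary that the argument uses. The `crossing` property holds because the
tangent plane leaves, on either side of it, a truncated cone that misses the frontier of `D`; such a
cone contains the beginning of the normal ray, whose position relative to `D` is given, and that of
every other ray on the same side. -/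
theorem IsBoundedBy.hasHolderBoundary {D X Γ γ : Set E3} {ν : E3 → E3} (hD : IsBoundedBy D X Γ γ)
    (hΓ : IsLyapunovSurface Γ ν) (hν : PointsOutward D Γ ν) :
    ∃ A l, HasHolderBoundary D Γ ν A l := by
  obtain ⟨A, hA, l, hl, hl1, hAl⟩ := hΓ.holder
  have hplane : IsClosed planeYZ := isClosed_eq (by fun_prop) continuous_const
  have hfr : Γ = frontier D ∩ halfSpace := by
    have hX : Disjoint planeYZ halfSpace :=
      Set.disjoint_left.2 fun p (hp : p 0 = 0) (hp' : 0 < p 0) => hp'.ne' hp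
    have hγ : γ ⊆ planeYZ := by
      rw [hD.edge_plane]
      exact sdiff_subset.trans (closure_minimal hD.plane_subset hplane)
    ext p
    rw [hD.frontier_eq]
    constructor
    · exact fun hp => ⟨Or.inr hp, hD.surface_subset hp⟩
    · rintro ⟨(hp | hp) | hp, hp'⟩
      · exact (Set.disjoint_left.1 hX (hD.plane_subset hp) hp').elim
      · exact (Set.disjoint_left.1 hX (hγ hp) hp').elim
      · exact hp
  refine ⟨A, l, hD.isOpen, hD.isBounded, hD.subset, hfr, hΓ.unit, hA, hl, hl1, fun p hp q hq =>
    (norm_sub_le_angle (hΓ.unit p hp) (hΓ.unit q hq)).trans (hAl p hp q hq), fun p hp e he => ?_⟩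
  have hn := hΓ.unit p hp
  obtain ⟨c, c0, c1, hce, hδ⟩ := exists_cone_disjoint (hΓ.tangent p hp) he
  obtain ⟨ε, ε0, hε⟩ := Metric.isOpen_iff.1 isOpen_halfSpace p (hD.surface_subset hp)
  obtain ⟨δ, hδ, δ0, hδε⟩ := (hδ.and (Ioo_mem_nhdsGT ε0)).exists
  have hball : Metric.ball p δ ⊆ halfSpace := (Metric.ball_subset_ball hδε.le).trans hε
  -- the two halves of the truncated double cone
  set K : E3 → Set E3 := fun n => {q : E3 | c * ‖q - p‖ < inner ℝ (q - p) n} ∩ Metric.ball p δ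
  have hK : ∀ n, IsPreconnected (K n) := fun n =>
    ((convex_cone p n c0.le).inter (convex_ball p δ)).isPreconnected
  have hmiss : ∀ n, n = ν p ∨ n = -ν p → ∀ q ∈ K n, q ∉ frontier D := by
    rintro n hn q ⟨hq, hqb⟩ hqf
    have h1 := hδ q ⟨hfr ▸ ⟨hqf, hball hqb⟩, hqb⟩
    have h2 : |inner ℝ (q - p) n| = |inner ℝ (q - p) (ν p)| := by
      rcases hn with rfl | rfl
      · rfl
      · rw [inner_neg_right, abs_neg]
    have h3 := le_abs_self (inner ℝ (q - p) n)
    simp only [mem_ofPred_eq] at hq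
    linarith
  have hmem : ∀ v : E3, ∀ n : E3, c * ‖v‖ < inner ℝ v n → ∀ᶠ t : ℝ in 𝓝[>] 0, p + t • v ∈ K n := by
    intro v n hv
    have h1 : ∀ᶠ t : ℝ in 𝓝[>] 0, p + t • v ∈ Metric.ball p δ := by
      have : Tendsto (fun t : ℝ => p + t • v) (𝓝[>] 0) (𝓝 p) := by
        have : Continuous fun t : ℝ => p + t • v := by fun_prop
        simpa using (this.tendsto 0).mono_left nhdsWithin_le_nhds
      exact this (Metric.ball_mem_nhds p δ0)
    filter_upwards [h1, self_mem_nhdsWithin] with t ht (ht0 : 0 < t)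
    refine ⟨?_, ht⟩
    simp only [mem_ofPred_eq, add_sub_cancel_left, norm_smul, Real.norm_of_nonneg ht0.le,
      real_inner_smul_left]
    have := mul_lt_mul_of_pos_left hv ht0
    linarith
  have hnn : inner ℝ (ν p) (ν p) = (1 : ℝ) := by rw [real_inner_self_eq_norm_sq, hn]; norm_num
  have hup : ∀ q ∈ K (ν p), q ∉ closure D := by
    intro q hq hqc
    have hqD : q ∈ D := by
      by_contra h
      exact hmiss _ (Or.inl rfl) q hq ⟨hqc, fun h' => h (interior_subset h')⟩
    obtain ⟨t, ht, ht'⟩ := ((hν p hp).and (hmem (ν p) (ν p) (by rw [hn, hnn]; linarith))).exists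
    obtain ⟨z, hz, hz'⟩ := (hK (ν p)).exists_mem_frontier ⟨hq, hqD⟩
      ⟨ht', fun h => ht.2 (subset_closure h)⟩
    exact hmiss _ (Or.inl rfl) z hz hz'
  have hdown : ∀ q ∈ K (-ν p), q ∈ D := by
    intro q hq
    by_contra hqD
    obtain ⟨t, ht, ht'⟩ := ((hν p hp).and (hmem (-ν p) (-ν p)
      (by rw [norm_neg, hn, inner_neg_neg, hnn]; linarith))).exists
    rw [smul_neg, ← sub_eq_add_neg] at ht'
    obtain ⟨z, hz, hz'⟩ := (hK (-ν p)).exists_mem_frontier ⟨ht', ht.1⟩ ⟨hq, hqD⟩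
    exact hmiss _ (Or.inr rfl) z hz hz'
  filter_upwards [hmem e (ν p) (by rwa [real_inner_comm]),
    hmem (-e) (-ν p) (by rwa [norm_neg, inner_neg_neg, real_inner_comm])] with t h1 h2
  rw [smul_neg, ← sub_eq_add_neg] at h2
  exact ⟨hdown _ h2, hup _ h1⟩

namespace HasHolderBoundary

variable {D Γ : Set E3} {ν : E3 → E3} {A l : ℝ}

theorem subset_halfSpace (h : HasHolderBoundary D Γ ν A l) : Γ ⊆ halfSpace :=
  h.eq_frontier ▸ inter_subset_right

theorem mem_of_mem_closure (h : HasHolderBoundary D Γ ν A l) {p : E3} (hp : p ∈ closure D)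
    (hpD : p ∉ D) (hpΩ : p ∈ halfSpace) : p ∈ Γ :=
  h.eq_frontier ▸ ⟨⟨hp, fun h' => hpD (interior_subset h')⟩, hpΩ⟩

theorem notMem (h : HasHolderBoundary D Γ ν A l) {p : E3} (hp : p ∈ Γ) : p ∉ D := by
  rw [h.eq_frontier, h.isOpen.frontier_eq] at hp
  exact hp.1.2

theorem subset_closure (h : HasHolderBoundary D Γ ν A l) : Γ ⊆ closure D :=
  h.eq_frontier ▸ inter_subset_left.trans frontier_subset_closure

theorem eventually_ray_mem (h : HasHolderBoundary D Γ ν A l) {p : E3} (hp : p ∈ D) (e : E3) :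
    ∀ᶠ t : ℝ in 𝓝[>] 0, p - t • e ∈ D := by
  have : Tendsto (fun t : ℝ => p - t • e) (𝓝[>] 0) (𝓝 p) := by
    have : Continuous fun t : ℝ => p - t • e := by fun_prop
    simpa using (this.tendsto 0).mono_left nhdsWithin_le_nhds
  exact this (h.isOpen.mem_nhds hp)

/-- Along a line whose direction is on the side of the outer normal throughout a convex set, the
line leaves `D` only once inside that set: here, once outside it stays outside. -/
theorem ray_notMem_closure (h : HasHolderBoundary D Γ ν A l) {C : Set E3} (hC : Convex ℝ C)
    (hCΩ : C ⊆ halfSpace) {e : E3} (he : ∀ p ∈ Γ ∩ C, 0 < inner ℝ (ν p) e) {p : E3}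
    (hp : p ∈ Γ ∩ C) {t : ℝ} (ht : 0 < t) (hq : p + t • e ∈ C) : p + t • e ∉ closure D := by
  intro hcl
  obtain ⟨η, ⟨hη, hη0, hηt⟩⟩ := ((h.crossing p hp.1 e (he p hp)).and (Ioo_mem_nhdsGT ht)).exists
  have hg : Continuous fun s : ℝ => p + s • e := by fun_prop
  obtain ⟨T, ⟨⟨hT1, hT2⟩, hTc⟩, hTl⟩ := (isCompact_Icc.inter_right
    (isClosed_closure.preimage hg) : IsCompact (Icc η t ∩ (fun s : ℝ => p + s • e) ⁻¹' closure D)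
    ).exists_isLeast ⟨t, ⟨hηt.le, le_rfl⟩, hcl⟩
  have hηT : η < T := hT1.lt_of_ne (by rintro rfl; exact hη.2 hTc)
  have hTC : p + T • e ∈ C := by
    have := hC hp.2 hq (a := 1 - T / t) (b := T / t)
      (by rw [sub_nonneg, div_le_one ht]; exact hT2) (div_nonneg (by linarith) ht.le) (by ring)
    convert this using 1
    rw [smul_add, smul_smul, div_mul_cancel₀ _ ht.ne', sub_smul, one_smul]
    abel
  -- just before the first return to `closure D` the line would be in `D`
  have key : ∀ᶠ s : ℝ in 𝓝[>] 0, p + T • e - s • e ∈ D := by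
    by_cases hD : p + T • e ∈ D
    · exact h.eventually_ray_mem hD e
    · have hΓ := h.mem_of_mem_closure hTc hD (hCΩ hTC)
      exact (h.crossing _ hΓ e (he _ ⟨hΓ, hTC⟩)).mono fun _ hs => hs.1
  obtain ⟨s, hs, hs0, hs1⟩ := (key.and (Ioo_mem_nhdsGT (sub_pos.2 hηT))).exists
  have e1 : p + T • e - s • e = p + (T - s) • e := by rw [sub_smul]; abel
  rw [e1] at hs
  have := hTl ⟨⟨by linarith, by linarith⟩, _root_.subset_closure hs⟩
  linarith

/-- Along such a line, backwards from a point of `D ∪ Γ` one stays in `D`. -/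
theorem ray_mem (h : HasHolderBoundary D Γ ν A l) {C : Set E3} (hC : Convex ℝ C)
    (hCΩ : C ⊆ halfSpace) {e : E3} (he : ∀ p ∈ Γ ∩ C, 0 < inner ℝ (ν p) e) {p : E3}
    (hp : p ∈ D ∪ Γ) (hpC : p ∈ C) {t : ℝ} (ht : 0 < t) (hq : p - t • e ∈ C) : p - t • e ∈ D := by
  by_contra hqD
  have hstart : ∀ᶠ s : ℝ in 𝓝[>] 0, p - s • e ∈ D := by
    rcases hp with hp | hp
    · exact h.eventually_ray_mem hp e
    · exact (h.crossing p hp e (he p ⟨hp, hpC⟩)).mono fun _ hs => hs.1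
  obtain ⟨η, ⟨hη, hη0, hηt⟩⟩ := (hstart.and (Ioo_mem_nhdsGT ht)).exists
  have hg : Continuous fun s : ℝ => p - s • e := by fun_prop
  obtain ⟨T, ⟨⟨hT1, hT2⟩, hTc⟩, hTl⟩ := (isCompact_Icc.inter_right
    (h.isOpen.isClosed_compl.preimage hg) :
      IsCompact (Icc η t ∩ (fun s : ℝ => p - s • e) ⁻¹' Dᶜ)
    ).exists_isLeast ⟨t, ⟨hηt.le, le_rfl⟩, hqD⟩
  have hηT : η < T := hT1.lt_of_ne (by rintro rfl; exact hTc hη)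
  have hTC : p - T • e ∈ C := by
    have := hC hpC hq (a := 1 - T / t) (b := T / t)
      (by rw [sub_nonneg, div_le_one ht]; exact hT2) (div_nonneg (by linarith) ht.le) (by ring)
    convert this using 1
    rw [smul_sub, smul_smul, div_mul_cancel₀ _ ht.ne', sub_smul, one_smul]
    abel
  have hbefore : ∀ᶠ s : ℝ in 𝓝[>] 0, p - T • e + s • e ∈ D := by
    filter_upwards [Ioo_mem_nhdsGT (sub_pos.2 hηT)] with s hs
    have e1 : p - T • e + s • e = p - (T - s) • e := by rw [sub_smul]; abel
    rw [e1]
    by_contra hsD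
    have := hTl ⟨⟨by linarith [hs.2], by linarith [hs.1]⟩, hsD⟩
    linarith [hs.1]
  have hcl : p - T • e ∈ closure D := by
    have : Tendsto (fun s : ℝ => p - T • e + s • e) (𝓝[>] 0) (𝓝 (p - T • e)) := by
      have : Continuous fun s : ℝ => p - T • e + s • e := by fun_prop
      simpa using (this.tendsto 0).mono_left nhdsWithin_le_nhds
    exact mem_closure_of_tendsto this hbefore
  have hΓ := h.mem_of_mem_closure hcl hTc (hCΩ hTC)
  obtain ⟨s, hs, hs'⟩ := ((h.crossing _ hΓ e (he _ ⟨hΓ, hTC⟩)).and hbefore).exists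
  exact hs.2 (_root_.subset_closure hs')

theorem inner_lower (h : HasHolderBoundary D Γ ν A l) {p q : E3} (hp : p ∈ Γ) (hq : q ∈ Γ) (v : E3) :
    inner ℝ (ν p) v - A * dist p q ^ l * ‖v‖ ≤ inner ℝ (ν q) v := by
  have h1 := real_inner_le_norm (ν p - ν q) v
  rw [inner_sub_left] at h1
  have h2 := mul_le_mul_of_nonneg_right (h.holder p hp q hq) (norm_nonneg v)
  linarith

/-- The deviation of the surface from its tangent plane, with a bound valid at all distances. If `q`
were above the tangent plane at `p` by more, the direction `q - p` would be on the side of all the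
normals in a ball containing `p` and `q`, and the segment from `p` to `q` would leave `closure D`. -/
theorem abs_inner_le (h : HasHolderBoundary D Γ ν A l) {p q : E3} (hp : p ∈ Γ) (hq : q ∈ Γ) :
    |inner ℝ (q - p) (ν p)| ≤ A * 2 ^ l * ‖q - p‖ ^ (1 + l) := by
  rcases eq_or_ne q p with rfl | hne
  · simpa using mul_nonneg (mul_nonneg h.const_pos.le (by positivity)) (by positivity)
  have hρ : 0 < ‖q - p‖ := norm_pos_iff.2 (sub_ne_zero.2 hne)
  set C : Set E3 := halfSpace ∩ Metric.ball p (2 * ‖q - p‖)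
  have hC : Convex ℝ C := convex_halfSpace.inter (convex_ball _ _)
  have hpC : p ∈ C := ⟨h.subset_halfSpace hp, Metric.mem_ball_self (by positivity)⟩
  have hqC : q ∈ C := ⟨h.subset_halfSpace hq, by rw [Metric.mem_ball, dist_eq_norm]; linarith⟩
  have hpos : ∀ v : E3, ‖v‖ = ‖q - p‖ → A * 2 ^ l * ‖q - p‖ ^ (1 + l) < inner ℝ v (ν p) →
      ∀ m ∈ Γ ∩ C, 0 < inner ℝ (ν m) v := by
    intro v hv hlt m hm
    have h1 := h.inner_lower hp hm.1 v
    have h2 : dist p m ^ l ≤ (2 * ‖q - p‖) ^ l := by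
      rw [dist_comm]
      exact Real.rpow_le_rpow dist_nonneg (Metric.mem_ball.1 hm.2.2).le h.exp_pos.le
    have h3 : A * dist p m ^ l * ‖v‖ ≤ A * 2 ^ l * ‖q - p‖ ^ (1 + l) := by
      calc _ ≤ A * (2 * ‖q - p‖) ^ l * ‖v‖ := by
            have := h.const_pos
            gcongr
        _ = _ := by
            rw [hv, Real.mul_rpow (by norm_num) hρ.le, Real.rpow_add hρ, Real.rpow_one]; ring
    rw [real_inner_comm] at hlt
    linarith
  by_contra! hlt
  rcases lt_abs.1 hlt with hlt | hlt
  · have := h.ray_notMem_closure hC inter_subset_left (hpos (q - p) rfl hlt) ⟨hp, hpC⟩ one_pos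
      (by simpa using hqC)
    exact this (by simpa using h.subset_closure hq)
  · rw [← inner_neg_left] at hlt
    have := h.ray_mem hC inter_subset_left (hpos _ (norm_neg _) hlt) (Or.inr hp) hpC one_pos
      (by simpa using hqC)
    exact h.notMem hq (by simpa using this)

/-- The previous estimate passes to the limit at points of the edge. -/
theorem abs_inner_le_of_mem_closure (h : HasHolderBoundary D Γ ν A l) {P q : E3}
    (hP : P ∈ closure Γ) (hq : q ∈ Γ) :
    |inner ℝ (q - P) (ν q)| ≤ A * 2 ^ l * ‖q - P‖ ^ (1 + l) := by
  have hcl : IsClosed {P : E3 | |inner ℝ (q - P) (ν q)| ≤ A * 2 ^ l * ‖q - P‖ ^ (1 + l)} := by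
    have := h.exp_pos
    refine isClosed_le (by fun_prop) (continuous_const.mul ?_)
    exact (by fun_prop : Continuous fun P : E3 => ‖q - P‖).rpow_const fun _ => Or.inr (by linarith)
  refine closure_minimal (fun P hP => ?_) hcl hP
  have := h.abs_inner_le hq hP
  simp only [mem_ofPred_eq]
  rwa [← norm_neg, neg_sub, ← abs_neg, ← inner_neg_left, neg_sub] at this

/-- The normal field extends to every point of the closure of the surface. -/
theorem exists_limit_normal (h : HasHolderBoundary D Γ ν A l) {P : E3} (hP : P ∈ closure Γ) :
    ∃ n : E3, ‖n‖ = 1 ∧ ∀ q ∈ Γ, ‖ν q - n‖ ≤ A * dist q P ^ l := by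
  obtain ⟨p, hp, hpP⟩ := mem_closure_iff_seq_limit.1 hP
  obtain ⟨n, hn, φ, hφ, hlim⟩ := (isCompact_sphere (0 : E3) 1).tendsto_subseq
    (x := fun k => ν (p k)) fun k => by simp [h.unit _ (hp k)]
  refine ⟨n, by simpa using hn, fun q hq => ?_⟩
  have h1 : Tendsto (fun k => ‖ν q - ν (p (φ k))‖) atTop (𝓝 ‖ν q - n‖) :=
    (tendsto_const_nhds.sub hlim).norm
  have h2 : Tendsto (fun k => A * dist q (p (φ k)) ^ l) atTop (𝓝 (A * dist q P ^ l)) :=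
    ((tendsto_const_nhds.dist (hpP.comp hφ.tendsto_atTop)).rpow_const
      (Or.inr h.exp_pos.le)).const_mul A
  exact le_of_tendsto_of_tendsto' h1 h2 fun k => h.holder q hq _ (hp _)

theorem tendsto_normal (h : HasHolderBoundary D Γ ν A l) {P n : E3}
    (hn : ∀ q ∈ Γ, ‖ν q - n‖ ≤ A * dist q P ^ l) : Tendsto ν (𝓝[Γ] P) (𝓝 n) := by
  rw [tendsto_iff_norm_sub_tendsto_zero]
  have h1 : Tendsto (fun q => A * dist q P ^ l) (𝓝[Γ] P) (𝓝 0) := by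
    have : Continuous fun q : E3 => A * dist q P ^ l :=
      continuous_const.mul ((by fun_prop : Continuous fun q : E3 => dist q P).rpow_const
        fun _ => Or.inr h.exp_pos.le)
    have h2 := (this.tendsto P).mono_left (nhdsWithin_le_nhds (s := Γ))
    simpa [h.exp_pos.ne'] using h2
  exact squeeze_zero' (.of_forall fun _ => norm_nonneg _)
    (eventually_mem_nhdsWithin.mono fun q hq => hn q hq) h1

theorem continuousOn_normal (h : HasHolderBoundary D Γ ν A l) : ContinuousOn ν Γ := fun p hp =>
  h.tendsto_normal (P := p) fun q hq => h.holder q hq p hp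

/-- All normals near `P` make a positive angle with all directions near a direction that makes a
positive angle with the limit normal. -/
theorem exists_ball_inner_pos (h : HasHolderBoundary D Γ ν A l) {P n : E3} (hn1 : ‖n‖ = 1)
    (hn : ∀ q ∈ Γ, ‖ν q - n‖ ≤ A * dist q P ^ l) {y : E3} (hy : 0 < inner ℝ n y) :
    ∃ r > 0, ∃ ε > 0, ∀ q ∈ Γ ∩ Metric.ball P r, ∀ e : E3, ‖e - y‖ < ε → 0 < inner ℝ (ν q) e := by
  have h0 : Tendsto (fun r : ℝ => A * r ^ l * (‖y‖ + 1)) (𝓝[>] 0) (𝓝 0) := by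
    have : Continuous fun r : ℝ => A * r ^ l * (‖y‖ + 1) :=
      (continuous_const.mul (continuous_id.rpow_const fun _ => Or.inr h.exp_pos.le)).mul
        continuous_const
    have h2 := (this.tendsto 0).mono_left (nhdsWithin_le_nhds (s := Ioi 0))
    simpa [h.exp_pos.ne'] using h2
  obtain ⟨r, hr, hr0⟩ := ((h0.eventually_lt_const (by positivity : 0 < inner ℝ n y / 4)).and
    self_mem_nhdsWithin).exists
  refine ⟨r, hr0, min 1 (inner ℝ n y / 4), by positivity, fun q hq e he => ?_⟩
  obtain ⟨he1, he2⟩ := lt_min_iff.1 he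
  have hq1 : ‖ν q - n‖ ≤ A * r ^ l := (hn q hq.1).trans (by
    have := h.const_pos
    have := h.exp_pos
    have := (Metric.mem_ball.1 hq.2).le
    gcongr)
  have hnorm : ‖e‖ ≤ ‖y‖ + 1 := by
    have := norm_add_le (e - y) y
    rw [sub_add_cancel] at this
    linarith
  have h1 := abs_real_inner_le_norm (ν q - n) e
  have h2 := abs_real_inner_le_norm n (e - y)
  have h3 : ‖ν q - n‖ * ‖e‖ ≤ A * r ^ l * (‖y‖ + 1) := by
    have := (norm_nonneg (ν q - n)).trans hq1
    gcongr
  rw [inner_sub_left] at h1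
  rw [inner_sub_right, hn1, one_mul] at h2
  have h4 := neg_le_of_abs_le h1
  have h5 := neg_le_of_abs_le h2
  linarith

theorem exists_mem_ball {P : E3} (hP : P ∈ closure Γ) {r : ℝ} (hr : 0 < r) : ∃ p ∈ Γ, ‖p - P‖ < r := by
  obtain ⟨p, hp, hd⟩ := Metric.mem_closure_iff.1 hP r hr
  exact ⟨p, hp, by rwa [dist_comm, dist_eq_norm] at hd⟩

/-- Near a point of `closure Γ`, the domain is asymptotic to a half-space within `x > 0`: directions
above the limit tangent plane leave `closure D`. -/
theorem blowup_notMem (h : HasHolderBoundary D Γ ν A l) {P n : E3} (hP : P ∈ closure Γ)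
    (hn1 : ‖n‖ = 1) (hn : ∀ q ∈ Γ, ‖ν q - n‖ ≤ A * dist q P ^ l) {y : E3} (hy : 0 < inner ℝ n y) :
    ∀ᶠ t : ℝ in 𝓝[>] 0, P + t • y ∈ halfSpace → P + t • y ∉ closure D := by
  obtain ⟨r, r0, ε, ε0, hpos⟩ := h.exists_ball_inner_pos hn1 hn hy
  have hy0 : 0 < ‖y‖ := norm_pos_iff.2 (by rintro rfl; simp at hy)
  filter_upwards [Ioo_mem_nhdsGT (div_pos r0 hy0)] with t ⟨ht0, ht⟩ hΩ
  rw [lt_div_iff₀ hy0] at ht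
  obtain ⟨p, hp, hpP⟩ := exists_mem_ball hP (r := min r (t * ε)) (by positivity)
  obtain ⟨h1, h2⟩ := lt_min_iff.1 hpP
  set e : E3 := t⁻¹ • (P + t • y - p) with he
  have hpe : p + t • e = P + t • y := by rw [he, smul_inv_smul₀ ht0.ne']; abel
  have hey : ‖e - y‖ < ε := by
    have : e - y = -(t⁻¹ • (p - P)) := by
      rw [he, smul_sub, smul_add, inv_smul_smul₀ ht0.ne', smul_sub]; abel
    rw [this, norm_neg, norm_smul, norm_inv, Real.norm_of_nonneg ht0.le, inv_mul_lt_iff₀ ht0]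
    exact h2
  rw [← hpe] at hΩ ⊢
  refine h.ray_notMem_closure (C := halfSpace ∩ Metric.ball P r)
    (convex_halfSpace.inter (convex_ball _ _)) inter_subset_left
    (fun q hq => hpos q ⟨hq.1, hq.2.2⟩ e hey) ⟨hp, h.subset_halfSpace hp, ?_⟩ ht0 ⟨hΩ, ?_⟩
  · rwa [Metric.mem_ball, dist_eq_norm]
  · rwa [hpe, Metric.mem_ball, dist_eq_norm, add_sub_cancel_left, norm_smul,
      Real.norm_of_nonneg ht0.le]

/-- The blow-up on the inner side of the limit tangent plane. -/
theorem blowup_mem (h : HasHolderBoundary D Γ ν A l) {P n : E3} (hP : P ∈ closure Γ)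
    (hn1 : ‖n‖ = 1) (hn : ∀ q ∈ Γ, ‖ν q - n‖ ≤ A * dist q P ^ l) {y : E3} (hy : inner ℝ n y < 0) :
    ∀ᶠ t : ℝ in 𝓝[>] 0, P + t • y ∈ halfSpace → P + t • y ∈ D := by
  obtain ⟨r, r0, ε, ε0, hpos⟩ := h.exists_ball_inner_pos hn1 hn (y := -y) (by simpa using hy)
  have hy0 : 0 < ‖y‖ := norm_pos_iff.2 (by rintro rfl; simp at hy)
  filter_upwards [Ioo_mem_nhdsGT (div_pos r0 hy0)] with t ⟨ht0, ht⟩ hΩ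
  rw [lt_div_iff₀ hy0] at ht
  obtain ⟨p, hp, hpP⟩ := exists_mem_ball hP (r := min r (t * ε)) (by positivity)
  obtain ⟨h1, h2⟩ := lt_min_iff.1 hpP
  set e : E3 := t⁻¹ • (p - (P + t • y)) with he
  have hpe : p - t • e = P + t • y := by rw [he, smul_inv_smul₀ ht0.ne']; abel
  have hey : ‖e - -y‖ < ε := by
    have : e - -y = t⁻¹ • (p - P) := by
      rw [he, smul_sub, smul_add, inv_smul_smul₀ ht0.ne', smul_sub]; abel
    rw [this, norm_smul, norm_inv, Real.norm_of_nonneg ht0.le, inv_mul_lt_iff₀ ht0]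
    exact h2
  rw [← hpe] at hΩ ⊢
  refine h.ray_mem (C := halfSpace ∩ Metric.ball P r)
    (convex_halfSpace.inter (convex_ball _ _)) inter_subset_left
    (fun q hq => hpos q ⟨hq.1, hq.2.2⟩ e hey) (Or.inr hp) ⟨h.subset_halfSpace hp, ?_⟩ ht0 ⟨hΩ, ?_⟩
  · rwa [Metric.mem_ball, dist_eq_norm]
  · rwa [hpe, Metric.mem_ball, dist_eq_norm, add_sub_cancel_left, norm_smul,
      Real.norm_of_nonneg ht0.le]

/-- At a boundary point away from the surface, the domain fills a half-ball. -/
theorem exists_halfBall_subset (h : HasHolderBoundary D Γ ν A l) {P : E3} (hP : P ∈ closure D)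
    (hPΓ : P ∉ closure Γ) : ∃ r > 0, halfSpace ∩ Metric.ball P r ⊆ D := by
  obtain ⟨r, r0, hr⟩ := Metric.isOpen_iff.1 isClosed_closure.isOpen_compl P hPΓ
  refine ⟨r, r0, fun q hq => ?_⟩
  obtain ⟨p, hpB, hpD⟩ := mem_closure_iff.1 hP _ Metric.isOpen_ball (Metric.mem_ball_self r0)
  by_contra hqD
  obtain ⟨z, hz, hz'⟩ := (convex_halfSpace.inter (convex_ball P r)).isPreconnected
    |>.exists_mem_frontier ⟨⟨h.subset hpD, hpB⟩, hpD⟩ ⟨hq, hqD⟩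
  exact hr hz.2 (_root_.subset_closure (h.eq_frontier ▸ ⟨hz', hz.1⟩))

end HasHolderBoundary

/-! ### Hausdorff measure and projections to planes -/

/-- The plane orthogonal to `n`, as a linear subspace. -/
noncomputable abbrev perp (n : E3) : Submodule ℝ E3 := (ℝ ∙ n)ᗮ

/-- The orthogonal projection to the plane orthogonal to `n`. -/
noncomputable abbrev projPerp (n : E3) : E3 →L[ℝ] perp n := (perp n).orthogonalProjectionOnto

theorem finrank_perp {n : E3} (hn : ‖n‖ = 1) : Module.finrank ℝ (perp n) = 2 := by
  have h0 : n ≠ 0 := by rintro rfl; simp at hn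
  have h := (ℝ ∙ n).finrank_add_finrank_orthogonal
  rw [finrank_span_singleton h0, finrank_euclideanSpace_fin] at h
  exact Nat.add_left_cancel (n := 1) h

theorem norm_sq_eq_projPerp {n : E3} (hn : ‖n‖ = 1) (v : E3) :
    ‖v‖ ^ 2 = inner ℝ v n ^ 2 + ‖projPerp n v‖ ^ 2 := by
  have h := Submodule.norm_sq_eq_add_norm_sq_projection v (ℝ ∙ n)
  have h1 : ‖(ℝ ∙ n).orthogonalProjectionOnto v‖ = |inner ℝ v n| := by
    rw [Submodule.coe_norm, Submodule.coe_orthogonalProjectionOnto_apply,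
      Submodule.starProjection_unit_singleton ℝ hn, norm_smul, hn, mul_one, real_inner_comm]
    rfl
  rw [h, h1, sq_abs]

theorem volume_perp {n : E3} (hn : ‖n‖ = 1) :
    (Measure.euclideanHausdorffMeasure 2 : Measure (perp n)) = volume := by
  rw [← finrank_perp hn, InnerProductSpace.euclideanHausdorffMeasure_eq_volume]

/-- The bound for `μHE[d]` is that for `μH[d]`, from which it differs by a constant factor that depends
only on `d`. -/
theorem LipschitzOnWith.euclideanHausdorffMeasure_image_le {X Y : Type*} [MetricSpace X]
    [MeasurableSpace X] [BorelSpace X] [MetricSpace Y] [MeasurableSpace Y] [BorelSpace Y]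
    {K : NNReal} {f : X → Y} {s : Set X} (h : LipschitzOnWith K f s) (d : ℕ) :
    (Measure.euclideanHausdorffMeasure d : Measure Y) (f '' s) ≤
      (K : ENNReal) ^ d * (Measure.euclideanHausdorffMeasure d : Measure X) s := by
  simp only [Measure.euclideanHausdorffMeasure_def, Measure.smul_apply, ENNReal.smul_def,
    smul_eq_mul]
  have := h.hausdorffMeasure_image_le (d := d) (by positivity)
  rw [ENNReal.rpow_natCast] at this
  calc _ ≤ _ := mul_le_mul_right this _
    _ = _ := by ring

/-- A surface of slope bounded by `c` over the plane orthogonal to `n` has at most `(1 - c²)⁻¹` times the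
area of its projection: the inverse of the projection is Lipschitz on it. -/
theorem map_projPerp_le {S : Set E3} {n : E3} (hn : ‖n‖ = 1) {c : ℝ} (hc : c ^ 2 < 1)
    (hS : ∀ q ∈ S, ∀ q' ∈ S, |inner ℝ (q - q') n| ≤ c * ‖q - q'‖) :
    ((Measure.euclideanHausdorffMeasure 2 : Measure E3).restrict S).map (projPerp n) ≤
      ENNReal.ofReal (1 - c ^ 2)⁻¹ • volume := by
  have hc' : 0 < 1 - c ^ 2 := by linarith
  have hexp : ∀ q ∈ S, ∀ q' ∈ S, ‖q - q'‖ ≤ √(1 - c ^ 2)⁻¹ * ‖projPerp n q - projPerp n q'‖ := by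
    intro q hq q' hq'
    have h1 := norm_sq_eq_projPerp hn (q - q')
    have h2 : inner ℝ (q - q') n ^ 2 ≤ c ^ 2 * ‖q - q'‖ ^ 2 := by
      rw [← sq_abs, ← mul_pow]
      exact pow_le_pow_left₀ (abs_nonneg _) (hS q hq q' hq') 2
    rw [map_sub] at h1
    refine abs_le_of_sq_le_sq' ?_ (by positivity) |>.2
    rw [mul_pow, Real.sq_sqrt (by positivity), inv_mul_eq_div, le_div_iff₀ hc']
    linarith
  refine Measure.le_iff.2 fun B hB => ?_
  rw [Measure.map_apply (projPerp n).measurable hB,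
    Measure.restrict_apply ((projPerp n).measurable hB), Measure.smul_apply, smul_eq_mul]
  have hinj : InjOn (projPerp n) S := fun q hq q' hq' h => by
    have := hexp q hq q' hq'
    rw [h, sub_self, norm_zero, mul_zero] at this
    exact sub_eq_zero.1 (norm_le_zero_iff.1 this)
  set g := Function.invFunOn (projPerp n) S
  have hg : ∀ q ∈ S, g (projPerp n q) = q := fun q hq =>
    hinj.leftInvOn_invFunOn hq
  have hL : LipschitzOnWith (√(1 - c ^ 2)⁻¹).toNNReal g (projPerp n '' S ∩ B) := by
    refine LipschitzOnWith.of_dist_le_mul ?_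
    rintro _ ⟨⟨q, hq, rfl⟩, -⟩ _ ⟨⟨q', hq', rfl⟩, -⟩
    rw [hg q hq, hg q' hq', dist_eq_norm, dist_eq_norm, Real.coe_toNNReal _ (Real.sqrt_nonneg _)]
    exact hexp q hq q' hq'
  have hsub : (projPerp n) ⁻¹' B ∩ S ⊆ g '' (projPerp n '' S ∩ B) := by
    rintro q ⟨hqB, hq⟩
    exact ⟨_, ⟨mem_image_of_mem _ hq, hqB⟩, hg q hq⟩
  calc _ ≤ _ := measure_mono hsub
    _ ≤ _ := hL.euclideanHausdorffMeasure_image_le 2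
    _ ≤ ENNReal.ofReal (1 - c ^ 2)⁻¹ * volume B := by
      rw [volume_perp hn, ← ENNReal.ofReal, ← ENNReal.ofReal_pow (Real.sqrt_nonneg _),
        Real.sq_sqrt (by positivity)]
      gcongr
      exact inter_subset_right

/-- The projection does not increase the area. -/
theorem restrict_le_map_projPerp {S : Set E3} {n : E3} (hn : ‖n‖ = 1) {N : Set (perp n)}
    (hNS : N ⊆ projPerp n '' S) :
    volume.restrict N ≤
      ((Measure.euclideanHausdorffMeasure 2 : Measure E3).restrict S).map (projPerp n) := by
  refine Measure.le_iff.2 fun B hB => ?_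
  rw [Measure.map_apply (projPerp n).measurable hB,
    Measure.restrict_apply ((projPerp n).measurable hB), Measure.restrict_apply hB,
    ← volume_perp hn]
  have hL : LipschitzOnWith 1 (projPerp n) (projPerp n ⁻¹' B ∩ S) :=
    ((perp n).lipschitzWith_orthogonalProjectionOnto).lipschitzOnWith
  have hsub : B ∩ N ⊆ projPerp n '' (projPerp n ⁻¹' B ∩ S) := by
    rintro w ⟨hwB, hwN⟩
    obtain ⟨q, hq, rfl⟩ := hNS hwN
    exact ⟨q, ⟨hwB, hq⟩, rfl⟩
  refine (measure_mono hsub).trans ((hL.euclideanHausdorffMeasure_image_le 2).trans_eq ?_)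
  simp

theorem integrableOn_norm_sub_rpow_perp {n : E3} (hn : ‖n‖ = 1) {s : ℝ} (hs : -2 < s) (w : perp n)
    (R : ℝ) : IntegrableOn (fun v : perp n => ‖v - w‖ ^ s) (Metric.ball w R) := by
  have h2 := finrank_perp hn
  have : Nontrivial (perp n) := Module.nontrivial_of_finrank_pos (R := ℝ) (by rw [h2]; norm_num)
  have h0 : IntegrableOn (fun v : perp n => ‖v‖ ^ s) (Metric.ball 0 R) := by
    rw [integrableOn_fun_norm_addHaar volume (f := fun y : ℝ => y ^ s), h2]
    rcases le_or_gt R 0 with hR | hR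
    · simp [Ioo_eq_empty (not_lt.2 hR)]
    have h3 : IntervalIntegrable (fun y : ℝ => y ^ (1 + s)) volume 0 R :=
      intervalIntegral.intervalIntegrable_rpow' (by linarith)
    rw [intervalIntegrable_iff_integrableOn_Ioo_of_le hR.le] at h3
    refine h3.congr_fun (fun y hy => ?_) measurableSet_Ioo
    simp only [smul_eq_mul]
    rw [Real.rpow_add hy.1, Real.rpow_one]
    norm_num
  have h1 := (measurePreserving_sub_right volume w).integrableOn_comp_preimage
    (MeasurableEquiv.subRight w).measurableEmbedding (f := fun v : perp n => ‖v‖ ^ s)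
    (s := Metric.ball 0 R)
  have h4 : (fun x : perp n => x - w) ⁻¹' Metric.ball 0 R = Metric.ball w R := by
    ext v; simp [dist_eq_norm]
  rw [h4] at h1
  exact h1.2 h0

namespace HasHolderBoundary

variable {D Γ : Set E3} {ν : E3 → E3} {A l : ℝ}

theorem measurableSet (h : HasHolderBoundary D Γ ν A l) : MeasurableSet Γ := by
  rw [h.eq_frontier]
  exact isClosed_frontier.measurableSet.inter isOpen_halfSpace.measurableSet

theorem isBounded_surface (h : HasHolderBoundary D Γ ν A l) : Bornology.IsBounded Γ :=
  h.isBounded.closure.subset h.subset_closure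

/-- At a scale that is the same for all points, the surface is a graph of small slope over the
tangent plane. -/
theorem exists_flat (h : HasHolderBoundary D Γ ν A l) {c : ℝ} (hc : 0 < c) :
    ∃ r > 0, ∀ p ∈ Γ, (∀ q ∈ Γ ∩ Metric.ball p r, ‖ν q - ν p‖ ≤ c) ∧
      ∀ q ∈ Γ ∩ Metric.ball p r, ∀ q' ∈ Γ ∩ Metric.ball p r,
      |inner ℝ (q - q') (ν p)| ≤ c * ‖q - q'‖ := by
  have hl := h.exp_pos
  have hA := h.const_pos
  have h0 : Tendsto (fun r : ℝ => A * 2 ^ l * (2 * r) ^ l + A * r ^ l) (𝓝[>] 0) (𝓝 0) := by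
    have : Continuous fun r : ℝ => A * 2 ^ l * (2 * r) ^ l + A * r ^ l :=
      (continuous_const.mul ((continuous_const.mul continuous_id).rpow_const
        fun _ => Or.inr hl.le)).add (continuous_const.mul (continuous_id.rpow_const
        fun _ => Or.inr hl.le))
    have h2 := (this.tendsto 0).mono_left (nhdsWithin_le_nhds (s := Ioi 0))
    simpa [hl.ne'] using h2
  obtain ⟨r, hr, hr0 : 0 < r⟩ := ((h0.eventually_lt_const hc).and self_mem_nhdsWithin).exists
  have hfirst : ∀ p ∈ Γ, ∀ q ∈ Γ ∩ Metric.ball p r, ‖ν q - ν p‖ ≤ A * r ^ l := by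
    intro p hp q hq
    refine (h.holder q hq.1 p hp).trans ?_
    have := (Metric.mem_ball.1 hq.2).le
    gcongr
  have hpos : 0 ≤ A * 2 ^ l * (2 * r) ^ l := by positivity
  refine ⟨r, hr0, fun p hp => ⟨fun q hq => (hfirst p hp q hq).trans (by linarith),
    fun q hq q' hq' => ?_⟩⟩
  have h1 := h.abs_inner_le hq'.1 hq.1
  have h2 : ‖q - q'‖ ≤ 2 * r := by
    have e1 := Metric.mem_ball.1 hq.2
    have e2 := Metric.mem_ball.1 hq'.2
    have := dist_triangle_right q q' p
    rw [dist_eq_norm] at this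
    linarith
  have h3 : ‖q - q'‖ ^ (1 + l) ≤ (2 * r) ^ l * ‖q - q'‖ := by
    rcases (norm_nonneg (q - q')).eq_or_lt with h0 | h0
    · rw [← h0, Real.zero_rpow (by positivity), mul_zero]
    · rw [Real.rpow_add h0, Real.rpow_one, mul_comm]
      gcongr
  have h4 := abs_real_inner_le_norm (q - q') (ν p - ν q')
  have h5 : ‖ν p - ν q'‖ ≤ A * r ^ l := by
    rw [norm_sub_rev]; exact hfirst p hp q' hq'
  calc |inner ℝ (q - q') (ν p)|
      = |inner ℝ (q - q') (ν q') + inner ℝ (q - q') (ν p - ν q')| := by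
        rw [← inner_add_right, add_sub_cancel]
    _ ≤ A * 2 ^ l * ((2 * r) ^ l * ‖q - q'‖) + ‖q - q'‖ * (A * r ^ l) := by
        refine (abs_add_le _ _).trans (add_le_add (h1.trans ?_) (h4.trans ?_)) <;> gcongr
    _ = (A * 2 ^ l * (2 * r) ^ l + A * r ^ l) * ‖q - q'‖ := by ring
    _ ≤ c * ‖q - q'‖ := by gcongr

/-- Powers of the distance of exponent above `-2` are integrable on the surface. -/
theorem integrable_norm_sub_rpow (h : HasHolderBoundary D Γ ν A l) {s : ℝ} (hs : -2 < s)
    (hs0 : s ≤ 0) (P : E3) : Integrable (fun M : E3 => ‖M - P‖ ^ s) (surfaceMeasure Γ) := by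
  obtain ⟨r, r0, hflat⟩ := h.exists_flat (c := 1 / 2) (by norm_num)
  obtain ⟨t, htΓ, htf, hcov⟩ := Metric.finite_approx_of_totallyBounded
    (h.isBounded_surface.isCompact_closure.totallyBounded.subset _root_.subset_closure) r r0
  suffices H : ∀ p ∈ Γ, IntegrableOn (fun M : E3 => ‖M - P‖ ^ s) (Γ ∩ Metric.ball p r)
      (Measure.euclideanHausdorffMeasure 2) by
    refine IntegrableOn.mono_set (t := ⋃ p ∈ t, Γ ∩ Metric.ball p r)
      ((integrableOn_finite_biUnion htf).2 fun p hp => H p (htΓ hp)) fun q hq => ?_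
    obtain ⟨p, hp, hqp⟩ := mem_iUnion₂.1 (hcov hq)
    exact mem_iUnion₂.2 ⟨p, hp, hq, hqp⟩
  intro p hp
  have hn := h.unit p hp
  set S := Γ ∩ Metric.ball p r
  have hSm : MeasurableSet S := h.measurableSet.inter measurableSet_ball
  set μ := (Measure.euclideanHausdorffMeasure 2 : Measure E3).restrict S
  set π := projPerp (ν p)
  have hle := map_projPerp_le hn (c := 1 / 2) (by norm_num) (hflat p hp).2
  obtain ⟨R, hR⟩ : ∃ R, ∀ q ∈ S, π q ∈ Metric.ball (π P) R := by
    refine ⟨r + dist p P, fun q hq => ?_⟩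
    rw [Metric.mem_ball]
    refine ((perp (ν p)).lipschitzWith_orthogonalProjectionOnto.dist_le_mul q P).trans_lt ?_
    have := dist_triangle q p P
    have := Metric.mem_ball.1 hq.2
    simp only [NNReal.coe_one, one_mul]
    linarith
  have hle' : μ.map π ≤ ENNReal.ofReal (1 - (1 / 2) ^ 2)⁻¹ •
      volume.restrict (Metric.ball (π P) R) := by
    refine Measure.le_iff.2 fun B hB => ?_
    have h1 := Measure.le_iff.1 hle (B ∩ Metric.ball (π P) R) (hB.inter measurableSet_ball)
    rw [Measure.smul_apply] at h1 ⊢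
    rw [Measure.restrict_apply hB]
    refine le_trans ?_ h1
    rw [Measure.map_apply π.measurable hB, Measure.map_apply π.measurable
      (hB.inter measurableSet_ball), Measure.restrict_apply' hSm, Measure.restrict_apply' hSm]
    exact measure_mono fun q hq => ⟨⟨hq.1, hR q hq.2⟩, hq.2⟩
  have hint : Integrable (fun v : perp (ν p) => ‖v - π P‖ ^ s) (μ.map π) :=
    ((integrableOn_norm_sub_rpow_perp hn hs (π P) R).integrable.smul_measure
      ENNReal.ofReal_ne_top).mono_measure hle'
  have hint' := hint.comp_measurable π.measurable
  have hnull : ∀ᵐ M ∂μ, π M ≠ π P := by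
    have : (μ.map π) {π P} = 0 := by
      have : Nontrivial (perp (ν p)) :=
        Module.nontrivial_of_finrank_pos (R := ℝ) (by rw [finrank_perp hn]; norm_num)
      have h1 := hle {π P}
      have h2 : (volume : Measure (perp (ν p))) {π P} = 0 := measure_singleton _
      rw [Measure.smul_apply, h2, smul_zero] at h1
      exact le_antisymm h1 bot_le
    rw [Measure.map_apply π.measurable (measurableSet_singleton _)] at this
    exact measure_eq_zero_iff_ae_notMem.1 this
  refine hint'.mono' ?_ ?_
  · exact Measurable.aestronglyMeasurable (by fun_prop)
  · filter_upwards [hnull] with M hM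
    have h0 : 0 < ‖π M - π P‖ := norm_pos_iff.2 (sub_ne_zero.2 hM)
    have h1 : ‖π M - π P‖ ≤ ‖M - P‖ := by
      rw [← map_sub]; exact (perp (ν p)).norm_orthogonalProjectionOnto_apply_le _
    rw [Real.norm_of_nonneg (by positivity)]
    exact Real.rpow_le_rpow_of_nonpos h0 h1 hs0

theorem isFiniteMeasure_surfaceMeasure (h : HasHolderBoundary D Γ ν A l) :
    IsFiniteMeasure (surfaceMeasure Γ) := by
  have := h.integrable_norm_sub_rpow (s := 0) (by norm_num) le_rfl 0
  simp only [Real.rpow_zero] at this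
  exact (integrable_const_iff_isFiniteMeasure one_ne_zero).1 this

theorem measure_singleton_surface (P : E3) : surfaceMeasure Γ {P} = 0 := by
  refine le_antisymm ((Measure.restrict_apply_le _ _).trans ?_) bot_le
  have := Measure.nullSingletonClass_hausdorff E3 (d := ((2 : ℕ) : ℝ)) (by norm_num)
  simp [Measure.euclideanHausdorffMeasure_def]

end HasHolderBoundary

/-! ### The Gauss–Green formula -/

/-- Fubini decomposition of space into lines parallel to `n`. -/
theorem measurePreserving_perp_line {n : E3} (hn : ‖n‖ = 1) :
    MeasurePreserving (fun z : ℝ × perp n => z.1 • n + (z.2 : E3)) := by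
  have h1 : MeasurePreserving (Prod.map (LinearIsometryEquiv.toSpanUnitSingleton (𝕜 := ℝ) n hn)
      (id : perp n → perp n)) :=
    (LinearIsometryEquiv.toSpanUnitSingleton (𝕜 := ℝ) n hn).measurePreserving.prod
      (MeasurePreserving.id _)
  have h2 := ((ℝ ∙ n).orthogonalDecomposition.symm.measurePreserving.comp
    (WithLp.volume_preserving_toLp _ _)).comp h1
  convert h2 using 1
  ext z
  simp

theorem measurableEmbedding_perp_line {n : E3} (hn : ‖n‖ = 1) :
    MeasurableEmbedding (fun z : ℝ × perp n => z.1 • n + (z.2 : E3)) := by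
  have h0 : n ≠ 0 := by rintro rfl; simp at hn
  refine (Continuous.measurableEmbedding (by fun_prop) ?_)
  intro z z' h
  have h1 := congrArg (projPerp n) h
  have h2 : projPerp n n = 0 :=
    Submodule.orthogonalProjectionOnto_orthogonal_apply_eq_zero (Submodule.mem_span_singleton_self n)
  simp only [map_add, map_smul, h2, smul_zero, zero_add] at h1
  rw [Submodule.orthogonalProjectionOnto_mem_subspace_eq_self,
    Submodule.orthogonalProjectionOnto_mem_subspace_eq_self] at h1
  simp only [h1, add_left_inj] at h
  exact Prod.ext (smul_left_injective ℝ h0 h) h1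

/-- The integral of a directional derivative over `D` is the rate of change of the integral over
translates of `D`. -/
theorem hasDerivAt_integral_translate {D : Set E3}
    (hDb : Bornology.IsBounded D) {f : E3 → ℝ} (hf : ContDiff ℝ 1 f) (hc : HasCompactSupport f)
    (e : E3) :
    HasDerivAt (fun t : ℝ => ∫ x in D, f (x + t • e)) (∫ x in D, fderiv ℝ f x e) 0 := by
  have hfin : IsFiniteMeasure (volume.restrict D) :=
    ⟨by rw [Measure.restrict_apply_univ]; exact hDb.measure_lt_top⟩
  have hf' : Continuous (fderiv ℝ f) := hf.continuous_fderiv one_ne_zero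
  obtain ⟨C, hC⟩ := hf'.bounded_above_of_compact_support (hc.fderiv ℝ)
  obtain ⟨C0, hC0⟩ := hf.continuous.bounded_above_of_compact_support hc
  have h := (hasDerivAt_integral_of_dominated_loc_of_deriv_le (μ := volume.restrict D) (𝕜 := ℝ)
    (F := fun t x => f (x + t • e)) (F' := fun t x => fderiv ℝ f (x + t • e) e) (x₀ := 0)
    (bound := fun _ => C * ‖e‖) (s := univ) univ_mem ?_ ?_ ?_ ?_ ?_ ?_).2
  · simpa using h
  · refine .of_forall fun t => Continuous.aestronglyMeasurable ?_
    exact hf.continuous.comp (by fun_prop)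
  · refine Integrable.of_bound (C := C0) ?_ (.of_forall fun x => hC0 _)
    exact (hf.continuous.comp (by fun_prop)).aestronglyMeasurable
  · refine Continuous.aestronglyMeasurable ?_
    exact (hf'.comp (by fun_prop)).clm_apply continuous_const
  · exact .of_forall fun x t _ => (ContinuousLinearMap.le_opNorm _ _).trans
      (mul_le_mul_of_nonneg_right (hC _) (norm_nonneg _))
  · exact integrable_const _
  · refine .of_forall fun x t _ => ?_
    have h1 : HasDerivAt (fun t : ℝ => x + t • e) e t := by
      simpa using ((hasDerivAt_id t).smul_const e).const_add x
    exact ((hf.differentiable one_ne_zero _).hasFDerivAt).comp_hasDerivAt t h1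

namespace HasHolderBoundary

variable {D Γ : Set E3} {ν : E3 → E3} {A l : ℝ}

/-- Translating `D` in a direction on the side of the outer normals enlarges it, as far as a
nonnegative test function sees it; hence the integral of the derivative is nonnegative. -/
theorem integral_fderiv_nonneg (h : HasHolderBoundary D Γ ν A l) {C : Set E3} (hCo : IsOpen C)
    (hC : Convex ℝ C) (hCΩ : C ⊆ halfSpace) {f : E3 → ℝ} (hf : ContDiff ℝ 1 f)
    (hc : HasCompactSupport f) (hs : tsupport f ⊆ C) (hf0 : ∀ x, 0 ≤ f x) {e : E3}
    (he : ∀ p ∈ Γ ∩ C, 0 < inner ℝ (ν p) e) : 0 ≤ ∫ x in D, fderiv ℝ f x e := by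
  have hd := hasDerivAt_integral_translate h.isBounded hf hc e
  have hD := h.isOpen.measurableSet
  obtain ⟨δ, δ0, hδ⟩ := hc.exists_thickening_subset_open hCo hs
  have hsmall : ∀ᶠ t : ℝ in 𝓝[>] 0, ‖t • e‖ < δ := by
    have : Tendsto (fun t : ℝ => ‖t • e‖) (𝓝[>] 0) (𝓝 0) := by
      have : Continuous fun t : ℝ => ‖t • e‖ := by fun_prop
      simpa using (this.tendsto 0).mono_left nhdsWithin_le_nhds
    exact this.eventually_lt_const δ0
  have hmono : ∀ᶠ t : ℝ in 𝓝[>] 0,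
      ∫ x in D, f (x + (0 : ℝ) • e) ≤ ∫ x in D, f (x + t • e) := by
    filter_upwards [hsmall, self_mem_nhdsWithin] with t ht (ht0 : 0 < t)
    have hpre : MeasurableSet ((fun x : E3 => x - t • e) ⁻¹' D) := by
      exact hD.preimage (by fun_prop)
    have e1 : ∫ x in D, f (x + t • e) = ∫ x in (fun x : E3 => x - t • e) ⁻¹' D, f x := by
      rw [← integral_indicator hD, ← integral_indicator hpre,
        ← integral_add_right_eq_self (((fun x : E3 => x - t • e) ⁻¹' D).indicator f) (t • e)]
      congr 1 with x
      by_cases hx : x ∈ D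
      · rw [indicator_of_mem hx,
          indicator_of_mem]
        exact mem_preimage.2 (by rwa [add_sub_cancel_right])
      · rw [indicator_of_notMem hx,
          indicator_of_notMem]
        exact fun h' => hx (by simpa only [add_sub_cancel_right] using mem_preimage.1 h')
    simp only [zero_smul, add_zero]
    rw [e1, ← integral_indicator hD, ← integral_indicator hpre]
    have hfi := hf.continuous.integrable_of_hasCompactSupport hc (μ := volume)
    refine integral_mono (hfi.indicator hD) (hfi.indicator hpre) fun x => ?_
    by_cases hx : x ∈ D
    · rw [indicator_of_mem hx]
      by_cases hfx : f x = 0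
      · rw [hfx]; exact indicator_nonneg (fun y _ => hf0 y) x
      · have hxs : x ∈ tsupport f := subset_tsupport f hfx
        rw [indicator_of_mem]
        refine h.ray_mem hC hCΩ he (Or.inl hx) (hs hxs) ht0 (hδ ?_)
        rw [Metric.mem_thickening_iff]
        exact ⟨x, hxs, by rwa [dist_eq_norm, sub_sub_cancel_left, norm_neg]⟩
    · rw [indicator_of_notMem hx]; exact indicator_nonneg (fun y _ => hf0 y) x
  refine ge_of_tendsto ((hasDerivWithinAt_iff_tendsto_slope' (s := Ioi 0) (by simp)).1
    hd.hasDerivWithinAt) ?_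
  filter_upwards [hmono, self_mem_nhdsWithin] with t ht (ht0 : 0 < t)
  rw [slope_def_field, sub_zero]
  exact div_nonneg (sub_nonneg.2 ht) ht0.le

/-- The integral of the derivative of `f` over the part in `D` of a line in the direction `n`. -/
noncomputable def _root_.lineIntegral (D : Set E3) (f : E3 → ℝ) (n : E3) (w : perp n) : ℝ :=
  ∫ t : ℝ, D.indicator (fun x => fderiv ℝ f x n) (t • n + (w : E3))

theorem _root_.hasCompactSupport_line {f : E3 → ℝ} (hc : HasCompactSupport f) {n : E3}
    (hn : ‖n‖ = 1) (w : perp n) : HasCompactSupport fun t : ℝ => f (t • n + (w : E3)) := by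
  refine hc.comp_isClosedEmbedding (g := fun t : ℝ => t • n + (w : E3)) ?_
  have : Isometry fun t : ℝ => t • n + (w : E3) := by
    refine Isometry.of_dist_eq fun s t => ?_
    rw [dist_eq_norm, add_sub_add_right_eq_sub, ← sub_smul, norm_smul, hn, mul_one]
    rfl
  exact this.isClosedEmbedding

theorem _root_.deriv_line {f : E3 → ℝ} (hf : ContDiff ℝ 1 f) (n w : E3) (t : ℝ) :
    deriv (fun t : ℝ => f (t • n + w)) t = fderiv ℝ f (t • n + w) n := by
  have h1 : HasDerivAt (fun t : ℝ => t • n + w) n t := by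
    simpa using ((hasDerivAt_id t).smul_const n).add_const w
  exact (((hf.differentiable one_ne_zero _).hasFDerivAt).comp_hasDerivAt t h1).deriv

/-- On a line that meets the surface the integral is the value of `f` at the crossing point. -/
theorem lineIntegral_eq (h : HasHolderBoundary D Γ ν A l) {C : Set E3}
    (hC : Convex ℝ C) (hCΩ : C ⊆ halfSpace) {f : E3 → ℝ} (hf : ContDiff ℝ 1 f)
    (hc : HasCompactSupport f) (hs : tsupport f ⊆ C) {n : E3} (hn : ‖n‖ = 1)
    (he : ∀ p ∈ Γ ∩ C, 0 < inner ℝ (ν p) n) {q : E3} (hq : q ∈ Γ ∩ C) :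
    lineIntegral D f n (projPerp n q) = f q := by
  set w := projPerp n q
  have hw : (inner ℝ n q : ℝ) • n + (w : E3) = q := by
    have := Submodule.starProjection_add_starProjection_orthogonal (K := ℝ ∙ n) q
    rw [Submodule.starProjection_unit_singleton ℝ hn] at this
    exact this
  set t0 : ℝ := inner ℝ n q
  have hline : ∀ t : ℝ, t • n + (w : E3) = q + (t - t0) • n := by
    intro t; rw [← hw, sub_smul]; abel
  have hgC := hasCompactSupport_line hc hn w
  have hg : ContDiff ℝ 1 fun t : ℝ => f (t • n + (w : E3)) := hf.comp (by fun_prop)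
  have key : ∀ t : ℝ, D.indicator (fun x => fderiv ℝ f x n) (t • n + (w : E3)) =
      (Iio t0).indicator (deriv fun t : ℝ => f (t • n + (w : E3))) t := by
    intro t
    by_cases hx : t • n + (w : E3) ∈ C
    · rcases lt_trichotomy t t0 with ht | ht | ht
      · have hD : t • n + (w : E3) ∈ D := by
          have e1 : t • n + (w : E3) = q - (t0 - t) • n := by
            rw [hline, sub_smul, sub_smul]; abel
          rw [e1] at hx ⊢
          exact h.ray_mem hC hCΩ he (Or.inr hq.1) hq.2 (sub_pos.2 ht) hx
        rw [indicator_of_mem hD, indicator_of_mem (by exact ht), deriv_line hf]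
      · rw [indicator_of_notMem, indicator_of_notMem (by simp [ht])]
        rw [hline, ht, sub_self, zero_smul, add_zero]
        exact h.notMem hq.1
      · rw [indicator_of_notMem, indicator_of_notMem (by simp [ht.le])]
        rw [hline] at hx ⊢
        exact fun hD => h.ray_notMem_closure hC hCΩ he hq (sub_pos.2 ht) hx
          (_root_.subset_closure hD)
    · have h0 : fderiv ℝ f (t • n + (w : E3)) = 0 := by
        by_contra h0
        exact hx (hs (tsupport_fderiv_subset ℝ (subset_tsupport _ h0)))
      simp only [indicator, deriv_line hf, h0, zero_apply, ite_self]
  rw [lineIntegral, integral_congr_ae (.of_forall key), integral_indicator measurableSet_Iio,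
    ← integral_Iic_eq_integral_Iio, HasCompactSupport.integral_Iic_deriv_eq hg hgC, hw]

/-- A line that misses the part of the surface in the support of `f` lies, within the support, on one
side of the frontier. -/
theorem lineIntegral_eq_zero (h : HasHolderBoundary D Γ ν A l) {C : Set E3}
    (hC : Convex ℝ C) (hCΩ : C ⊆ halfSpace) {f : E3 → ℝ} (hf : ContDiff ℝ 1 f)
    (hc : HasCompactSupport f) (hs : tsupport f ⊆ C) {n : E3} (hn : ‖n‖ = 1) {w : perp n}
    (hw : w ∉ projPerp n '' (Γ ∩ C)) : lineIntegral D f n w = 0 := by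
  have hn0 : projPerp n n = 0 :=
    Submodule.orthogonalProjectionOnto_orthogonal_apply_eq_zero (Submodule.mem_span_singleton_self n)
  have hproj : ∀ t : ℝ, projPerp n (t • n + (w : E3)) = w := by
    intro t
    rw [map_add, map_smul, hn0, smul_zero, zero_add,
      Submodule.orthogonalProjectionOnto_mem_subspace_eq_self]
  have hmiss : ∀ t : ℝ, t • n + (w : E3) ∈ C → t • n + (w : E3) ∉ frontier D := fun t ht hf =>
    hw ⟨_, ⟨h.eq_frontier ▸ ⟨hf, hCΩ ht⟩, ht⟩, hproj t⟩
  have hcl := hasCompactSupport_line hc hn w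
  have hg : ContDiff ℝ 1 fun t : ℝ => f (t • n + (w : E3)) := hf.comp (by fun_prop)
  have hzero : ∀ t : ℝ, t • n + (w : E3) ∉ C → fderiv ℝ f (t • n + (w : E3)) = 0 := by
    intro t ht
    by_contra h0
    exact ht (hs (tsupport_fderiv_subset ℝ (subset_tsupport _ h0)))
  -- the line does not meet the frontier inside `C`, so it lies on one side of it
  have hside : ∀ s t : ℝ, s • n + (w : E3) ∈ C → t • n + (w : E3) ∈ C →
      s • n + (w : E3) ∈ D → t • n + (w : E3) ∈ D := by
    intro s t hsC htC hsD
    by_contra htD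
    have hconv : Convex ℝ (C ∩ range fun t : ℝ => t • n + (w : E3)) := by
      refine hC.inter ?_
      rintro _ ⟨a, rfl⟩ _ ⟨b, rfl⟩ x y hx hy hxy
      refine ⟨x * a + y * b, ?_⟩
      have : (w : E3) = x • (w : E3) + y • (w : E3) := by rw [← add_smul, hxy, one_smul]
      simp only [smul_add, smul_smul, add_smul]
      nth_rewrite 1 [this]
      abel
    obtain ⟨z, ⟨hz, u, rfl⟩, hz'⟩ := hconv.isPreconnected.exists_mem_frontier
      ⟨⟨hsC, s, rfl⟩, hsD⟩ ⟨⟨htC, t, rfl⟩, htD⟩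
    exact hmiss u hz hz'
  rw [lineIntegral]
  by_cases hex : ∃ s : ℝ, s • n + (w : E3) ∈ C ∧ s • n + (w : E3) ∈ D
  · obtain ⟨s, hsC, hsD⟩ := hex
    have key : ∀ t : ℝ, D.indicator (fun x => fderiv ℝ f x n) (t • n + (w : E3)) =
        deriv (fun t : ℝ => f (t • n + (w : E3))) t := by
      intro t
      by_cases htC : t • n + (w : E3) ∈ C
      · rw [indicator_of_mem (hside s t hsC htC hsD), deriv_line hf]
      · simp only [indicator, deriv_line hf, hzero t htC, zero_apply, ite_self]
    rw [integral_congr_ae (.of_forall key)]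
    have hgi : Integrable (deriv fun t : ℝ => f (t • n + (w : E3))) :=
      (hg.continuous_deriv le_rfl).integrable_of_hasCompactSupport hcl.deriv
    exact integral_eq_zero_of_hasDerivAt_of_integrable
      (fun t => (hg.differentiable one_ne_zero t).hasDerivAt) hgi
      (hg.continuous.integrable_of_hasCompactSupport hcl)
  · push Not at hex
    have key : ∀ t : ℝ, D.indicator (fun x => fderiv ℝ f x n) (t • n + (w : E3)) = 0 := by
      intro t
      by_cases htC : t • n + (w : E3) ∈ C
      · rw [indicator_of_notMem (hex t htC)]
      · simp only [indicator, hzero t htC, zero_apply, ite_self]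
    rw [integral_congr_ae (.of_forall key), integral_zero]

theorem integrable_surface (h : HasHolderBoundary D Γ ν A l) {f : E3 → ℝ} (hf : ContinuousOn f Γ)
    {C : ℝ} (hC : ∀ p ∈ Γ, |f p| ≤ C) : Integrable f (surfaceMeasure Γ) := by
  have := h.isFiniteMeasure_surfaceMeasure
  refine Integrable.of_bound (C := C) (hf.aestronglyMeasurable h.measurableSet) ?_
  filter_upwards [ae_restrict_mem h.measurableSet] with p hp using hC p hp

theorem integrable_surface_of_hasCompactSupport (h : HasHolderBoundary D Γ ν A l) {f : E3 → ℝ}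
    (hf : Continuous f) (hc : HasCompactSupport f) : Integrable f (surfaceMeasure Γ) := by
  obtain ⟨C, hC⟩ := hf.bounded_above_of_compact_support hc
  exact h.integrable_surface hf.continuousOn fun p _ => hC p

theorem abs_inner_normal_le (h : HasHolderBoundary D Γ ν A l) {p : E3} (hp : p ∈ Γ) (e : E3) :
    |inner ℝ (ν p) e| ≤ ‖e‖ := by
  simpa [h.unit p hp] using abs_real_inner_le_norm (ν p) e

theorem integrable_surface_mul_inner (h : HasHolderBoundary D Γ ν A l) {f : E3 → ℝ}
    (hf : Continuous f) (hc : HasCompactSupport f) (e : E3) :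
    Integrable (fun p => f p * inner ℝ (ν p) e) (surfaceMeasure Γ) := by
  obtain ⟨C, hC⟩ := hf.bounded_above_of_compact_support hc
  refine h.integrable_surface (hf.continuousOn.mul (h.continuousOn_normal.inner continuousOn_const))
    (C := C * ‖e‖) fun p hp => ?_
  rw [abs_mul]
  exact mul_le_mul (hC p) (h.abs_inner_normal_le hp e) (abs_nonneg _)
    ((norm_nonneg _).trans (hC p))

/-- Where the surface is a graph of slope at most `c` over the plane orthogonal to `n`, the flux of
`f n` out of `D` is the integral of `f` over the projection of the surface, and the projection
changes areas by a factor between `1 - c ^ 2` and `1`. -/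
theorem normal_flux_bounds (h : HasHolderBoundary D Γ ν A l) {p : E3} {r : ℝ}
    (hball : Metric.ball p r ⊆ halfSpace) {n : E3} (hn : ‖n‖ = 1) {c : ℝ} (hc1 : c ^ 2 < 1)
    (hflat : ∀ q ∈ Γ ∩ Metric.ball p r, ∀ q' ∈ Γ ∩ Metric.ball p r,
      |inner ℝ (q - q') n| ≤ c * ‖q - q'‖)
    (he : ∀ q ∈ Γ ∩ Metric.ball p r, 0 < inner ℝ (ν q) n)
    {f : E3 → ℝ} (hf : ContDiff ℝ 1 f) (hs : tsupport f ⊆ Metric.ball p r) (hf0 : ∀ x, 0 ≤ f x) :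
    (1 - c ^ 2) * ∫ q, f q ∂surfaceMeasure Γ ≤ ∫ x in D, fderiv ℝ f x n ∧
      ∫ x in D, fderiv ℝ f x n ≤ ∫ q, f q ∂surfaceMeasure Γ := by
  have hcf : HasCompactSupport f :=
    Metric.isCompact_of_isClosed_isBounded (isClosed_tsupport f) (Metric.isBounded_ball.subset hs)
  have hC := convex_ball p r
  set S := Γ ∩ Metric.ball p r with hS
  have hSm : MeasurableSet S := h.measurableSet.inter measurableSet_ball
  set μ := (Measure.euclideanHausdorffMeasure 2 : Measure E3).restrict S with hμ
  set F := lineIntegral D f n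
  have hFS : ∀ q ∈ S, F (projPerp n q) = f q := fun q hq =>
    h.lineIntegral_eq hC hball hf hcf hs hn he hq
  have hF0 : ∀ w, w ∉ projPerp n '' S → F w = 0 := fun w hw =>
    h.lineIntegral_eq_zero hC hball hf hcf hs hn hw
  have hFnn : ∀ w, 0 ≤ F w := fun w => by
    by_cases hw : w ∈ projPerp n '' S
    · obtain ⟨q, hq, rfl⟩ := hw
      rw [hFS q hq]; exact hf0 q
    · rw [hF0 w hw]
  -- Fubini
  have hGi : Integrable (D.indicator fun x => fderiv ℝ f x n) := by
    have h1 : Continuous fun x => fderiv ℝ f x n :=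
      (hf.continuous_fderiv one_ne_zero).clm_apply continuous_const
    exact (h1.integrable_of_hasCompactSupport (hcf.fderiv_apply ℝ n)).indicator
      h.isOpen.measurableSet
  have hmp := measurePreserving_perp_line hn
  have hGi' := (hmp.integrable_comp_emb (measurableEmbedding_perp_line hn)).2 hGi
  have hFi : Integrable F := hGi'.integral_prod_right
  have hfub : ∫ x in D, fderiv ℝ f x n = ∫ w, F w := by
    rw [← integral_indicator h.isOpen.measurableSet,
      ← hmp.integral_comp (measurableEmbedding_perp_line hn)
        (D.indicator fun x => fderiv ℝ f x n)]
    exact integral_prod_symm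
      (fun z : ℝ × perp n => (D.indicator fun x => fderiv ℝ f x n) (z.1 • n + (z.2 : E3))) hGi'
  -- the surface integral as an integral over the plane
  have hle := map_projPerp_le hn hc1 hflat
  have hFi' : Integrable F (μ.map (projPerp n)) :=
    (hFi.smul_measure ENNReal.ofReal_ne_top).mono_measure hle
  have hsurf : ∫ q, f q ∂surfaceMeasure Γ = ∫ w, F w ∂(μ.map (projPerp n)) := by
    rw [integral_map (projPerp n).measurable.aemeasurable hFi'.aestronglyMeasurable,
      setIntegral_congr_fun hSm 
        (show EqOn (fun q => F (projPerp n q)) f S from fun q hq => hFS q hq), surfaceMeasure, hS]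
    refine setIntegral_eq_of_subset_of_forall_sdiff_eq_zero h.measurableSet inter_subset_left
      fun q hq => ?_
    exact image_eq_zero_of_notMem_tsupport fun hq' => hq.2 ⟨hq.1, hs hq'⟩
  have hc0 : 0 < 1 - c ^ 2 := by linarith
  rw [hfub, hsurf]
  constructor
  · have h1 := integral_mono_measure hle (.of_forall hFnn)
      (hFi.smul_measure ENNReal.ofReal_ne_top)
    rw [integral_smul_measure, ENNReal.toReal_ofReal (by positivity), smul_eq_mul,
      inv_mul_eq_div, le_div_iff₀ hc0] at h1
    linarith
  · -- `F` is only known to be measurable up to a null set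
    obtain ⟨Z, hZs, hZm, hZ0⟩ := exists_measurable_superset_of_null
      (ae_iff.1 hFi.aestronglyMeasurable.ae_eq_mk)
    set N' : Set (perp n) := {w | hFi.aestronglyMeasurable.mk F w ≠ 0} \ Z
    have hmk : ∀ w, w ∉ Z → F w = hFi.aestronglyMeasurable.mk F w := fun w hw => by
      by_contra hne
      exact hw (hZs hne)
    have hN'm : MeasurableSet N' :=
      ((hFi.aestronglyMeasurable.stronglyMeasurable_mk.measurable
        (measurableSet_singleton (0 : ℝ)).compl)).diff hZm
    have hN' : N' ⊆ projPerp n '' S := fun w hw => by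
      by_contra hne
      exact hw.1 ((hmk w hw.2).symm.trans (hF0 w hne))
    have h2 : ∫ w, F w = ∫ w in N', F w := by
      rw [← integral_indicator hN'm]
      refine integral_congr_ae ?_
      filter_upwards [measure_eq_zero_iff_ae_notMem.1 hZ0] with w hw
      by_cases hw0 : F w = 0
      · simp [indicator, hw0]
      · rw [indicator_of_mem]
        exact ⟨fun h0 => hw0 ((hmk w hw).trans h0), hw⟩
    rw [h2]
    exact integral_mono_measure (restrict_le_map_projPerp hn hN') (.of_forall hFnn) hFi'

/-- The Gauss–Green formula up to a small relative error, for nonnegative functions supported in a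
small ball about a point of the surface. -/
theorem exists_local_gauss_green (h : HasHolderBoundary D Γ ν A l) {p : E3} (hp : p ∈ Γ) (e : E3)
    {ε : ℝ} (hε : 0 < ε) : ∃ r > 0, Metric.ball p r ⊆ halfSpace ∧
      ∀ f : E3 → ℝ, ContDiff ℝ 1 f → tsupport f ⊆ Metric.ball p r → (∀ x, 0 ≤ f x) →
        |(∫ x in D, fderiv ℝ f x e) - ∫ q, f q * inner ℝ (ν q) e ∂surfaceMeasure Γ| ≤
          ε * ∫ q, f q ∂surfaceMeasure Γ := by
  have hn := h.unit p hp
  set n := ν p with hnp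
  set η := ε / 2 with hη
  have hη0 : 0 < η := by positivity
  -- `c` is small against both `ε` and `ε / ‖e‖`; it bounds the variation of the normal in the ball
  set c := η / (2 * (η + ‖e‖ + 1)) with hc
  have hden : 0 < 2 * (η + ‖e‖ + 1) := by positivity
  have hc0 : 0 < c := by positivity
  have hcden : c * (2 * (η + ‖e‖ + 1)) = η := div_mul_cancel₀ _ hden.ne'
  have hc2 : c ≤ 1 / 2 := by
    rw [hc, div_le_iff₀ hden]; nlinarith [norm_nonneg e]
  have hce : 2 * (c * ‖e‖) ≤ η := by nlinarith [norm_nonneg e]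
  have hcη : c * (η + ‖e‖) < η := by nlinarith [norm_nonneg e]
  obtain ⟨r1, hr1, hflat⟩ := h.exists_flat hc0
  obtain ⟨r2, hr2, hΩ⟩ := Metric.isOpen_iff.1 isOpen_halfSpace p (h.subset_halfSpace hp)
  set r := min r1 r2
  have hb1 : Metric.ball p r ⊆ Metric.ball p r1 := Metric.ball_subset_ball (min_le_left _ _)
  have hbΩ : Metric.ball p r ⊆ halfSpace := (Metric.ball_subset_ball (min_le_right _ _)).trans hΩ
  refine ⟨r, by positivity, hbΩ, fun f hf hs hf0 => ?_⟩
  have hcf : HasCompactSupport f :=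
    Metric.isCompact_of_isClosed_isBounded (isClosed_tsupport f) (Metric.isBounded_ball.subset hs)
  have hnear : ∀ q ∈ Γ ∩ Metric.ball p r, ‖ν q - n‖ ≤ c := fun q hq =>
    (hflat p hp).1 q ⟨hq.1, hb1 hq.2⟩
  have hnn : inner ℝ n n = (1 : ℝ) := by rw [real_inner_self_eq_norm_sq, hn]; norm_num
  -- directions close to the normal are on the side of all the normals in the ball
  have hside : ∀ v : E3, inner ℝ n v = (0 : ℝ) → ‖v‖ ≤ ‖e‖ →
      ∀ q ∈ Γ ∩ Metric.ball p r, 0 < inner ℝ (ν q) (η • n + v) := by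
    intro v hv hve q hq
    have h1 := neg_le_of_abs_le (abs_real_inner_le_norm (ν q - n) (η • n + v))
    have h2 : ‖η • n + v‖ ≤ η + ‖e‖ := by
      refine (norm_add_le _ _).trans (add_le_add ?_ hve)
      rw [norm_smul, hn, mul_one, Real.norm_of_nonneg hη0.le]
    have h3 : ‖ν q - n‖ * ‖η • n + v‖ ≤ c * (η + ‖e‖) :=
      mul_le_mul (hnear q hq) h2 (norm_nonneg _) hc0.le
    rw [inner_sub_left, inner_add_right n, real_inner_smul_right, hnn, hv] at h1
    linarith
  set a : ℝ := inner ℝ n e with ha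
  set τ : E3 := e - a • n with hτ
  have hnτ : inner ℝ n τ = (0 : ℝ) := by
    rw [hτ, inner_sub_right, real_inner_smul_right, hnn, mul_one, sub_self]
  have hae : |a| ≤ ‖e‖ := by simpa [hn] using abs_real_inner_le_norm n e
  have hτe : ‖τ‖ ≤ ‖e‖ := by
    have h1 : ‖e‖ ^ 2 = a ^ 2 + ‖τ‖ ^ 2 := by
      have h2 : e = a • n + τ := by rw [hτ]; abel
      have h3 := norm_add_sq_real (a • n) τ
      rw [← h2, real_inner_smul_left, hnτ, norm_smul, hn, mul_one, Real.norm_eq_abs, sq_abs] at h3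
      linarith
    exact abs_le_of_sq_le_sq' (by nlinarith) (norm_nonneg _) |>.2
  set T : E3 → ℝ := fun v => ∫ x in D, fderiv ℝ f x v with hT
  set I := ∫ q, f q ∂surfaceMeasure Γ with hI
  have hI0 : 0 ≤ I := integral_nonneg hf0
  have hint : ∀ v : E3, IntegrableOn (fun x => fderiv ℝ f x v) D := fun v =>
    (((hf.continuous_fderiv one_ne_zero).clm_apply continuous_const).integrable_of_hasCompactSupport
      (hcf.fderiv_apply ℝ v)).integrableOn
  have hTadd : ∀ (b : ℝ) (v : E3), T (b • n + v) = b * T n + T v := by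
    intro b v
    simp only [hT, map_add, map_smul, smul_eq_mul]
    rw [integral_add ((hint n).const_mul b) (hint v), integral_const_mul]
  have hTneg : ∀ v : E3, T (-v) = -T v := by
    intro v
    simp only [hT, map_neg]
    rw [integral_neg]
  have hpos : ∀ v : E3, inner ℝ n v = (0 : ℝ) → ‖v‖ ≤ ‖e‖ → 0 ≤ η * T n + T v := by
    intro v hv hve
    rw [← hTadd]
    exact h.integral_fderiv_nonneg Metric.isOpen_ball (convex_ball _ _) hbΩ hf hcf hs hf0
      (hside v hv hve)
  have hp1 := hpos τ hnτ hτe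
  have hp2 := hpos (-τ) (by rw [inner_neg_right, hnτ, neg_zero]) (by rwa [norm_neg])
  rw [hTneg] at hp2
  have hposn : ∀ q ∈ Γ ∩ Metric.ball p r, 0 < inner ℝ (ν q) n := by
    intro q hq
    have := hside 0 (inner_zero_right _) (by simp) q hq
    rw [add_zero, real_inner_smul_right] at this
    exact pos_of_mul_pos_right this hη0.le
  obtain ⟨hlow, hup⟩ := h.normal_flux_bounds hbΩ hn (by nlinarith : c ^ 2 < 1)
    (fun q hq q' hq' => (hflat p hp).2 q ⟨hq.1, hb1 hq.2⟩ q' ⟨hq'.1, hb1 hq'.2⟩) hposn hf hs hf0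
  change (1 - c ^ 2) * I ≤ T n at hlow
  change T n ≤ I at hup
  have hTe : T e = a * T n + T τ := by
    rw [← hTadd]; congr 1; rw [hτ]; abel
  have hsurf : |(∫ q, f q * inner ℝ (ν q) e ∂surfaceMeasure Γ) - a * I| ≤ c * ‖e‖ * I := by
    have hfi := h.integrable_surface_of_hasCompactSupport hf.continuous hcf
    rw [hI, ← integral_const_mul, ← integral_const_mul,
      ← integral_sub (h.integrable_surface_mul_inner hf.continuous hcf e) (hfi.const_mul a)]
    refine norm_integral_le_of_norm_le (f := fun q => f q * inner ℝ (ν q) e - a * f q)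
      (hfi.const_mul _) ?_
    filter_upwards [ae_restrict_mem h.measurableSet] with q hq
    by_cases hqb : q ∈ Metric.ball p r
    · have h1 := abs_real_inner_le_norm (ν q - n) e
      have h2 := mul_le_mul_of_nonneg_right (hnear q ⟨hq, hqb⟩) (norm_nonneg e)
      have e1 : f q * inner ℝ (ν q) e - a * f q = f q * inner ℝ (ν q - n) e := by
        rw [inner_sub_left]; ring
      rw [e1, norm_mul, Real.norm_of_nonneg (hf0 q), mul_comm, Real.norm_eq_abs]
      exact mul_le_mul_of_nonneg_right (h1.trans h2) (hf0 q)
    · rw [image_eq_zero_of_notMem_tsupport fun hq' => hqb (hs hq')]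
      simp
  change |T e - _| ≤ ε * I
  have h1 : |T e - a * I| ≤ (c * ‖e‖ + η) * I := by
    have e1 : T e - a * I = a * (T n - I) + T τ := by rw [hTe]; ring
    have h2 : |T τ| ≤ η * I := by
      have := mul_le_mul_of_nonneg_left hup hη0.le
      rw [abs_le]; constructor <;> linarith
    have h3 : |a * (T n - I)| ≤ ‖e‖ * (c * I) := by
      rw [abs_mul]
      refine mul_le_mul hae ?_ (abs_nonneg _) (norm_nonneg _)
      have h4 : c ^ 2 * I ≤ c * I := mul_le_mul_of_nonneg_right (by nlinarith) hI0
      rw [abs_le]; constructor <;> nlinarith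
    rw [e1]
    refine (abs_add_le _ _).trans ?_
    linarith
  have h2 := abs_sub_le (T e) (a * I) (∫ q, f q * inner ℝ (ν q) e ∂surfaceMeasure Γ)
  rw [abs_sub_comm (a * I)] at h2
  have h3 : (2 * (c * ‖e‖) + η) * I ≤ ε * I :=
    mul_le_mul_of_nonneg_right (by rw [hη] at hce ⊢; linarith) hI0
  linarith

open scoped Manifold ContDiff in
/-- **Gauss–Green formula** for compactly supported functions on the half-space. -/
theorem gauss_green (h : HasHolderBoundary D Γ ν A l) {f : E3 → ℝ} (hf : ContDiff ℝ 1 f)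
    (hc : HasCompactSupport f) (hs : tsupport f ⊆ halfSpace) (e : E3) :
    ∫ x in D, fderiv ℝ f x e = ∫ q, f q * inner ℝ (ν q) e ∂surfaceMeasure Γ := by
  have hfinm := h.isFiniteMeasure_surfaceMeasure
  obtain ⟨M, hM⟩ := hf.continuous.bounded_above_of_compact_support hc
  have hM0 : 0 ≤ M := (norm_nonneg _).trans (hM 0)
  set E : (E3 → ℝ) → ℝ := fun g =>
    (∫ x in D, fderiv ℝ g x e) - ∫ q, g q * inner ℝ (ν q) e ∂surfaceMeasure Γ with hE
  have hint : ∀ g : E3 → ℝ, ContDiff ℝ 1 g → HasCompactSupport g →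
      IntegrableOn (fun x => fderiv ℝ g x e) D := fun g hg hgc =>
    (((hg.continuous_fderiv one_ne_zero).clm_apply continuous_const).integrable_of_hasCompactSupport
      (hgc.fderiv_apply ℝ e)).integrableOn
  -- away from the surface both sides vanish: a ball that misses the frontier may be moved both ways
  have hlocal : ∀ ε : ℝ, 0 < ε → ∀ p ∈ halfSpace, ∃ r > 0, Metric.ball p r ⊆ halfSpace ∧
      ∀ g : E3 → ℝ, ContDiff ℝ 1 g → tsupport g ⊆ Metric.ball p r → (∀ x, 0 ≤ g x) →
        |E g| ≤ ε * ∫ q, g q ∂surfaceMeasure Γ := by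
    intro ε hε p hp
    by_cases hpΓ : p ∈ Γ
    · exact h.exists_local_gauss_green hpΓ e hε
    · have hpf : p ∈ (frontier D)ᶜ ∩ halfSpace :=
        ⟨fun hf => hpΓ (h.eq_frontier ▸ ⟨hf, hp⟩), hp⟩
      obtain ⟨r, r0, hr⟩ := Metric.isOpen_iff.1
        (isClosed_frontier.isOpen_compl.inter isOpen_halfSpace) p hpf
      have hb : Metric.ball p r ⊆ halfSpace := hr.trans inter_subset_right
      have hempty : ∀ q, q ∉ Γ ∩ Metric.ball p r := fun q hq => by
        have h1 := hq.1
        rw [h.eq_frontier] at h1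
        exact (hr hq.2).1 h1.1
      refine ⟨r, r0, hb, fun g hg hgs hg0 => ?_⟩
      have hgc : HasCompactSupport g := Metric.isCompact_of_isClosed_isBounded
        (isClosed_tsupport g) (Metric.isBounded_ball.subset hgs)
      have h1 : ∀ v : E3, 0 ≤ ∫ x in D, fderiv ℝ g x v := fun v =>
        h.integral_fderiv_nonneg Metric.isOpen_ball (convex_ball _ _) hb hg hgc hgs hg0
          fun q hq => (hempty q hq).elim
      have h2 := h1 (-e)
      simp only [map_neg, integral_neg] at h2
      have h3 : ∫ q, g q * inner ℝ (ν q) e ∂surfaceMeasure Γ = 0 := by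
        refine integral_eq_zero_of_ae ?_
        filter_upwards [ae_restrict_mem h.measurableSet] with q hq
        rw [image_eq_zero_of_notMem_tsupport fun hq' => hempty q ⟨hq, hgs hq'⟩]
        simp
      have h4 : E g = 0 := by
        simp only [hE]
        rw [h3]
        linarith [h1 e]
      rw [h4, abs_zero]
      exact mul_nonneg hε.le (integral_nonneg hg0)
  have hadd : ∀ g₁ g₂ : E3 → ℝ, ContDiff ℝ 1 g₁ → HasCompactSupport g₁ → ContDiff ℝ 1 g₂ →
      HasCompactSupport g₂ → E (fun x => g₁ x + g₂ x) = E g₁ + E g₂ := by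
    intro g₁ g₂ h1 c1 h2 c2
    simp only [hE]
    have e1 : ∀ x, fderiv ℝ (fun x => g₁ x + g₂ x) x e = fderiv ℝ g₁ x e + fderiv ℝ g₂ x e := by
      intro x
      rw [fderiv_fun_add (h1.differentiable one_ne_zero x) (h2.differentiable one_ne_zero x)]
      rfl
    simp only [e1, add_mul]
    rw [integral_add (hint g₁ h1 c1) (hint g₂ h2 c2),
      integral_add (h.integrable_surface_mul_inner h1.continuous c1 e)
        (h.integrable_surface_mul_inner h2.continuous c2 e)]
    ring
  have hmul : ∀ (b : ℝ) (g : E3 → ℝ), ContDiff ℝ 1 g → E (fun x => b * g x) = b * E g := by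
    intro b g h1
    simp only [hE]
    have e1 : ∀ x, fderiv ℝ (fun x => b * g x) x e = b * fderiv ℝ g x e := by
      intro x
      rw [fderiv_const_mul (h1.differentiable one_ne_zero x)]
      rfl
    simp only [e1, mul_assoc]
    rw [integral_const_mul, integral_const_mul]
    ring
  suffices hsmall : ∀ ε : ℝ, 0 < ε → |E f| ≤ ε * (3 * M * (surfaceMeasure Γ).real univ) by
    have h0 : |E f| ≤ 0 := by
      refine le_of_forall_pos_le_add fun δ hδ => ?_
      have hK : 0 ≤ 3 * M * (surfaceMeasure Γ).real univ := by positivity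
      refine (hsmall (δ / (3 * M * (surfaceMeasure Γ).real univ + 1)) (by positivity)).trans ?_
      rw [zero_add, div_mul_eq_mul_div, div_le_iff₀ (by positivity)]
      nlinarith
    exact sub_eq_zero.1 (abs_nonpos_iff.1 h0)
  intro ε hε
  -- the local errors add up, because they are bounded by integrals of the partition functions
  choose! r hr0 hrΩ hr using hlocal ε hε
  obtain ⟨ρ, hρ⟩ := SmoothPartitionOfUnity.exists_isSubordinate (I := 𝓘(ℝ, E3))
    (isClosed_tsupport f) (fun p : halfSpace => Metric.ball (p : E3) (r p))
    (fun _ => Metric.isOpen_ball) fun x hx =>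
      mem_iUnion.2 ⟨⟨x, hs hx⟩, Metric.mem_ball_self (hr0 x (hs hx))⟩
  have hρC : ∀ i, ContDiff ℝ 1 (ρ i) := fun i =>
    ((ρ i).contMDiff.contDiff).of_le (by exact_mod_cast le_top)
  have hρb : ∀ i : halfSpace, ∀ g : E3 → ℝ, tsupport (fun x => ρ i x * g x) ⊆
      Metric.ball (i : E3) (r i) := fun i g => (tsupport_mul_subset_left).trans (hρ i)
  have hρc : ∀ i : halfSpace, ∀ g : E3 → ℝ, HasCompactSupport (fun x => ρ i x * g x) := fun i g =>
    Metric.isCompact_of_isClosed_isBounded (isClosed_tsupport _)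
      (Metric.isBounded_ball.subset (hρb i g))
  have hfin := ρ.locallyFinite.finite_nonempty_inter_compact hc
  set J := hfin.toFinset with hJ
  have hsum : ∀ x ∈ tsupport f, ∑ i ∈ J, ρ i x = 1 := by
    intro x hx
    rw [← ρ.sum_eq_one hx]
    refine (finsum_eq_sum_of_support_subset _ fun i hi => ?_).symm
    rw [hJ, Finite.coe_toFinset]
    exact ⟨x, hi, hx⟩
  have hsum_le : ∀ x, ∑ i ∈ J, ρ i x ≤ 1 := fun x => by
    classical
    refine le_trans ?_ (ρ.sum_le_one x)
    have hx := ρ.locallyFinite.point_finite x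
    rw [finsum_eq_sum_of_support_subset (s := J ∪ hx.toFinset) _ fun i hi => by
      simp only [Finset.coe_union, Finite.coe_toFinset]; exact Or.inr hi]
    exact Finset.sum_le_sum_of_subset_of_nonneg Finset.subset_union_left
      fun i _ _ => ρ.nonneg i x
  have hfsum : f = fun x => ∑ i ∈ J, ρ i x * f x := by
    funext x
    rw [← Finset.sum_mul]
    by_cases hx : x ∈ tsupport f
    · rw [hsum x hx, one_mul]
    · rw [image_eq_zero_of_notMem_tsupport hx, mul_zero]
  have hEsum : E (fun x => ∑ i ∈ J, ρ i x * f x) = ∑ i ∈ J, E fun x => ρ i x * f x := by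
    have : ∀ K : Finset halfSpace, E (fun x => ∑ i ∈ K, ρ i x * f x) =
        ∑ i ∈ K, E fun x => ρ i x * f x := by
      classical
      intro K
      induction K using Finset.induction_on with
      | empty => simp [hE]
      | insert i K hi ih =>
        simp only [Finset.sum_insert hi]
        rw [hadd _ _ ((hρC i).mul hf) (hρc i f) (ContDiff.sum fun j _ => (hρC j).mul hf), ih]
        have : (fun x => ∑ j ∈ K, ρ j x * f x) = fun x => (∑ j ∈ K, ρ j x) * f x := by
          funext x; rw [Finset.sum_mul]
        rw [this]
        exact hc.mul_left
    exact this J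
  have hpiece : ∀ i : halfSpace,
      |E fun x => ρ i x * f x| ≤ ε * (3 * M * ∫ q, ρ i q ∂surfaceMeasure Γ) := by
    intro i
    have hc1 : HasCompactSupport (ρ i) := by simpa using hρc i fun _ => 1
    have hρ0 := ρ.nonneg i
    have hfM : ∀ x, 0 ≤ f x + M := fun x => by
      have := neg_le_of_abs_le (hM x); linarith
    -- `f` is a difference of two nonnegative functions
    have e1 : (fun x => ρ i x * f x) = fun x => ρ i x * (f x + M) + (-M) * ρ i x := by
      funext x; ring
    have hC2 : ContDiff ℝ 1 fun x => ρ i x * (f x + M) := (hρC i).mul (hf.add contDiff_const)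
    have h1 := hr i i.2 (fun x => ρ i x * (f x + M)) hC2 (hρb i _)
      fun x => mul_nonneg (hρ0 x) (hfM x)
    have h2 := hr i i.2 (ρ i) (hρC i) (by simpa using hρb i fun _ => 1) hρ0
    have hI := h.integrable_surface_of_hasCompactSupport (hρC i).continuous hc1
    have h3 : ∫ q, ρ i q * (f q + M) ∂surfaceMeasure Γ ≤
        2 * M * ∫ q, ρ i q ∂surfaceMeasure Γ := by
      rw [← integral_const_mul]
      refine integral_mono (h.integrable_surface_of_hasCompactSupport hC2.continuous (hρc i _))
        (hI.const_mul _) fun q => ?_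
      have := le_of_abs_le (hM q)
      simp only
      nlinarith [hρ0 q]
    rw [e1, hadd _ _ hC2 (hρc i _) (contDiff_const.mul (hρC i)) hc1.mul_left, hmul _ _ (hρC i)]
    refine (abs_add_le _ _).trans ?_
    rw [abs_mul, abs_neg, abs_of_nonneg hM0]
    have h4 := mul_le_mul_of_nonneg_left h2 hM0
    have h5 := mul_le_mul_of_nonneg_left h3 hε.le
    linarith
  have hsumI : ∑ i ∈ J, ∫ q, ρ i q ∂surfaceMeasure Γ ≤ (surfaceMeasure Γ).real univ := by
    rw [← integral_finsetSum]
    · have := integral_mono (μ := surfaceMeasure Γ) (f := fun q => ∑ i ∈ J, ρ i q) (g := fun _ => 1)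
        (integrable_finsetSum _ fun i _ => h.integrable_surface_of_hasCompactSupport
          (hρC i).continuous (by simpa using hρc i fun _ => 1)) (integrable_const _) hsum_le
      simpa using this
    · exact fun i _ => h.integrable_surface_of_hasCompactSupport
        (hρC i).continuous (by simpa using hρc i fun _ => 1)
  rw [hfsum, hEsum]
  calc _ ≤ ∑ i ∈ J, |E fun x => ρ i x * f x| := Finset.abs_sum_le_sum_abs _ _
    _ ≤ ∑ i ∈ J, ε * (3 * M * ∫ q, ρ i q ∂surfaceMeasure Γ) := Finset.sum_le_sum fun i _ => hpiece i
    _ = ε * (3 * M * ∑ i ∈ J, ∫ q, ρ i q ∂surfaceMeasure Γ) := by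
      rw [Finset.mul_sum, Finset.mul_sum]
    _ ≤ _ := by gcongr

end HasHolderBoundary

/-! ### Euler's integral -/

/-- Euler's integral for the continued Gauss function. The integral is an analytic continuation of
the Gauss series to `z < 1`, so it agrees with `gaussF` there. -/
theorem gaussF_eq_integral (a : ℝ) {b c : ℝ} (hb : 0 < b) (hbc : b < c) {z : ℝ} (hz : z < 1) :
    gaussF a b c z = (∫ t in Ioo (0 : ℝ) 1, t ^ (b - 1) * (1 - t) ^ (c - b - 1))⁻¹ *
      ∫ t in Ioo (0 : ℝ) 1, t ^ (b - 1) * (1 - t) ^ (c - b - 1) * (1 - t * z) ^ (-a) := by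
  set K : ℝ → ℂ := fun t => (t : ℂ) ^ ((b : ℂ) - 1) * (1 - (t : ℂ)) ^ (((c - b : ℝ) : ℂ) - 1) with hKdef
  set g : ℂ → ℂ := fun z => 1 / (1 - z) ^ (a : ℂ) with hgdef
  set B : ℂ := Complex.betaIntegral b ((c - b : ℝ) : ℂ) with hB
  have hbre : 0 < (b : ℂ).re := by simpa using hb
  have hcre : 0 < ((c - b : ℝ) : ℂ).re := by simpa using hbc
  have hK : IntegrableOn K (Ioc 0 1) :=
    (intervalIntegrable_iff_integrableOn_Ioc_of_le zero_le_one).1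
      (Complex.betaIntegral_convergent hbre hcre)
  have hB0 : B ≠ 0 := by
    rw [hB, Complex.betaIntegral_eq_Gamma_mul_div _ _ hbre hcre]
    refine div_ne_zero (mul_ne_zero ?_ ?_) ?_ <;> apply Complex.Gamma_ne_zero_of_re_pos
    · exact hbre
    · exact hcre
    · simpa using hb.trans hbc
  have hO : IsOpen {z : ℂ | z.re < 1} := isOpen_lt Complex.continuous_re continuous_const
  have hg : DifferentiableOn ℂ g {z | z.re < 1} := by
    intro z hz
    have hz' : (1 - z) ∈ Complex.slitPlane := Or.inl (by simpa using hz)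
    refine DifferentiableAt.differentiableWithinAt ?_
    refine (differentiableAt_const _).div ?_ ?_
    · exact ((differentiableAt_const _).sub differentiableAt_id).cpow_const hz'
    · rw [Ne, Complex.cpow_eq_zero_iff]
      exact fun h => Complex.slitPlane_ne_zero hz' h.1
  have hG := eulerAux_differentiable K hK g hg
  have hreal : ∀ x : ℝ, x < 1 → (∫ t in Ioo (0 : ℝ) 1, t ^ (b - 1) * (1 - t) ^ (c - b - 1))⁻¹ *
      ∫ t in Ioo (0 : ℝ) 1, t ^ (b - 1) * (1 - t) ^ (c - b - 1) * (1 - t * x) ^ (-a) =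
      (B⁻¹ * ∫ t in Ioc (0 : ℝ) 1, K t * g (t * (x : ℂ))).re := by
    intro x hx
    have hKr : ∀ t ∈ Ioo (0 : ℝ) 1, K t = ((t ^ (b - 1) * (1 - t) ^ (c - b - 1) : ℝ) : ℂ) := by
      intro t ht
      rw [hKdef, Complex.ofReal_mul, Complex.ofReal_cpow ht.1.le,
        Complex.ofReal_cpow (sub_nonneg.2 ht.2.le)]
      push_cast
      rfl
    have hgr : ∀ t ∈ Ioo (0 : ℝ) 1, g (t * (x : ℂ)) = (((1 - t * x) ^ (-a) : ℝ) : ℂ) := by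
      intro t ht
      have h0 : 0 ≤ 1 - t * x := by
        rcases le_total x 0 with h | h <;> nlinarith [ht.1, ht.2]
      rw [hgdef, Real.rpow_neg h0, Complex.ofReal_inv, Complex.ofReal_cpow h0]
      push_cast
      rw [one_div]
    have hBr : B = ((∫ t in Ioo (0 : ℝ) 1, t ^ (b - 1) * (1 - t) ^ (c - b - 1) : ℝ) : ℂ) := by
      rw [hB, Complex.betaIntegral, intervalIntegral.integral_of_le zero_le_one,
        integral_Ioc_eq_integral_Ioo, ← integral_complex_ofReal]
      exact setIntegral_congr_fun measurableSet_Ioo hKr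
    have hIr : ∫ t in Ioc (0 : ℝ) 1, K t * g (t * (x : ℂ)) =
        ((∫ t in Ioo (0 : ℝ) 1, t ^ (b - 1) * (1 - t) ^ (c - b - 1) * (1 - t * x) ^ (-a) : ℝ) : ℂ) := by
      rw [integral_Ioc_eq_integral_Ioo, ← integral_complex_ofReal]
      refine setIntegral_congr_fun measurableSet_Ioo fun t ht => ?_
      rw [hKr t ht, hgr t ht, ← Complex.ofReal_mul]
    rw [hBr, hIr, ← Complex.ofReal_inv, ← Complex.ofReal_mul, Complex.ofReal_re]
  suffices H : IsGaussContinuation a b c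
      fun x => (B⁻¹ * ∫ t in Ioc (0 : ℝ) 1, K t * g (t * (x : ℂ))).re by
    rw [hreal z hz]
    exact (gaussF_spec a hb hbc).eqOn H hz
  refine ⟨?_, ?_⟩
  · intro x hx
    have h1 := (hG.const_mul B⁻¹).analyticAt (hO.mem_nhds (show ((x : ℂ)).re < 1 by simpa using hx))
    exact h1.re_ofReal
  · intro x hx
    set p : ℕ → ℂ := fun n => Ring.choose ((a : ℂ) + n - 1) n with hp
    have hps := Complex.one_div_one_sub_cpow_hasFPowerSeriesOnBall_zero (a : ℂ)
    have hxn : ‖(x : ℂ)‖ < 1 := by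
      rw [Complex.norm_real, Real.norm_eq_abs, abs_lt]; exact hx
    have hser : ∀ w : ℂ, ‖w‖ < 1 → HasSum (fun n => p n * w ^ n) (g w) := by
      intro w hw
      have := hps.hasSum (y := w) (by simpa [← ofReal_norm, ENNReal.ofReal_lt_one] using hw)
      simpa [FormalMultilinearSeries.ofScalars_apply_eq, hp, hgdef, mul_comm] using this
    have hsum : Summable fun n => ‖p n * (x : ℂ) ^ n‖ := (hser x hxn).summable.norm
    have hterm : ∀ n : ℕ, ∀ t ∈ Ioc (0 : ℝ) 1, K t * (p n * (t * (x : ℂ)) ^ n) =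
        (p n * (x : ℂ) ^ n) * ((t : ℂ) ^ ((b : ℂ) + n - 1) *
          (1 - (t : ℂ)) ^ (((c - b : ℝ) : ℂ) - 1)) := by
      intro n t ht
      have ht0 : (t : ℂ) ≠ 0 := by exact_mod_cast ht.1.ne'
      rw [hKdef, show (b : ℂ) + n - 1 = (b - 1) + n by ring, Complex.cpow_add _ _ ht0,
        Complex.cpow_natCast]
      simp only [mul_pow]
      ring
    have hint : ∀ n : ℕ, ∫ t in Ioc (0 : ℝ) 1, K t * (p n * (t * (x : ℂ)) ^ n) =
        (p n * (x : ℂ) ^ n) * Complex.betaIntegral ((b : ℂ) + n) ((c - b : ℝ) : ℂ) := by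
      intro n
      rw [setIntegral_congr_fun measurableSet_Ioc (hterm n), integral_const_mul,
        Complex.betaIntegral, intervalIntegral.integral_of_le zero_le_one]
    have htn : ∀ t ∈ Ioc (0 : ℝ) 1, ∀ n : ℕ, ‖(t : ℂ) ^ n‖ ≤ 1 := by
      intro t ht n
      rw [norm_pow, Complex.norm_real, Real.norm_of_nonneg ht.1.le]
      exact pow_le_one₀ ht.1.le ht.2
    have hI : ∀ n : ℕ, IntegrableOn (fun t : ℝ => K t * (p n * (t * (x : ℂ)) ^ n)) (Ioc 0 1) := by
      intro n
      refine hK.mul_bdd (c := ‖p n * (x : ℂ) ^ n‖)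
        (Continuous.aestronglyMeasurable (by fun_prop)) ?_
      filter_upwards [ae_restrict_mem measurableSet_Ioc] with t ht
      rw [mul_pow, mul_left_comm, norm_mul]
      exact mul_le_of_le_one_left (norm_nonneg _) (htn t ht n)
    have hS : Summable fun n => ∫ t in Ioc (0 : ℝ) 1, ‖K t * (p n * (t * (x : ℂ)) ^ n)‖ := by
      refine Summable.of_nonneg_of_le (fun n => integral_nonneg fun _ => norm_nonneg _) (fun n => ?_)
        (hsum.mul_left (∫ t in Ioc (0 : ℝ) 1, ‖K t‖))
      rw [← integral_mul_const]
      refine setIntegral_mono_on (hI n).norm (hK.norm.mul_const _) measurableSet_Ioc ?_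
      intro t ht
      rw [norm_mul, mul_pow, mul_left_comm, norm_mul ((t : ℂ) ^ n)]
      gcongr
      exact mul_le_of_le_one_left (norm_nonneg _) (htn t ht n)
    have hmain := hasSum_integral_of_summable_integral_norm hI hS
    have hval : ∫ t in Ioc (0 : ℝ) 1, ∑' n, K t * (p n * (t * (x : ℂ)) ^ n) =
        ∫ t in Ioc (0 : ℝ) 1, K t * g (t * (x : ℂ)) := by
      refine setIntegral_congr_fun measurableSet_Ioc fun t ht => ?_
      refine ((hser _ ?_).mul_left (K t)).tsum_eq
      rw [norm_mul]
      have := htn t ht 1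
      rw [pow_one] at this
      exact (mul_le_of_le_one_left (norm_nonneg _) this).trans_lt hxn
    rw [hval] at hmain
    simp_rw [hint] at hmain
    have hpn : ∀ n : ℕ, p n = (((n.factorial : ℝ)⁻¹ * (ascPochhammer ℝ n).eval a : ℝ) : ℂ) := by
      intro n
      have h1 := Ring.factorial_nsmul_multichoose_eq_ascPochhammer (a : ℂ) n
      have h2 : (((ascPochhammer ℝ n).eval a : ℝ) : ℂ) = (ascPochhammer ℂ n).eval (a : ℂ) := by
        rw [← ascPochhammer_map (algebraMap ℝ ℂ), Polynomial.eval_map_algebraMap,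
          ← Complex.coe_algebraMap, Polynomial.aeval_algebraMap_apply_eq_algebraMap_eval]
      rw [Ring.multichoose_eq, Polynomial.ascPochhammer_smeval_eq_eval, nsmul_eq_mul, ← h2] at h1
      have h3 : (n.factorial : ℂ) ≠ 0 := by exact_mod_cast n.factorial_ne_zero
      push_cast
      rw [← h1, hp]
      field_simp
    have hfin := (hmain.mul_left B⁻¹)
    have hcoef : ∀ n : ℕ, B⁻¹ * (p n * (x : ℂ) ^ n *
        Complex.betaIntegral ((b : ℂ) + n) ((c - b : ℝ) : ℂ)) =
        ((((n.factorial : ℝ)⁻¹ * (ascPochhammer ℝ n).eval a * (ascPochhammer ℝ n).eval b *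
          ((ascPochhammer ℝ n).eval c)⁻¹) • x ^ n : ℝ) : ℂ) := by
      intro n
      rw [eulerAux_coeff hb hbc, hpn, ← hB]
      push_cast [smul_eq_mul]
      field_simp
    simp_rw [hcoef] at hfin
    rw [ordinaryHypergeometric_eq_tsum]
    have h3 := (Complex.hasSum_re hfin).tsum_eq
    simp only [Complex.ofReal_re] at h3
    exact h3.symm

/-! ### The fundamental solution as an integral -/

/-- The weight of Euler's integral for `F(α + 1/2, α; 2α; ·)`. -/
noncomputable def eulerWeight (α t : ℝ) : ℝ := t ^ (α - 1) * (1 - t) ^ (α - 1)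

theorem integrableOn_betaIntegrand {a b : ℝ} (ha : 0 < a) (hb : 0 < b) :
    IntegrableOn (fun t : ℝ => t ^ (a - 1) * (1 - t) ^ (b - 1)) (Ioo 0 1) := by
  have h := Complex.betaIntegral_convergent (u := a) (v := b) (by simpa) (by simpa)
  rw [intervalIntegrable_iff_integrableOn_Ioo_of_le zero_le_one] at h
  refine h.re.congr ?_
  filter_upwards [ae_restrict_mem measurableSet_Ioo] with t ht
  have : (t : ℂ) ^ ((a : ℂ) - 1) * (1 - (t : ℂ)) ^ ((b : ℂ) - 1) =
      ((t ^ (a - 1) * (1 - t) ^ (b - 1) : ℝ) : ℂ) := by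
    rw [Complex.ofReal_mul, Complex.ofReal_cpow ht.1.le, Complex.ofReal_cpow (sub_nonneg.2 ht.2.le)]
    push_cast
    rfl
  rw [this]
  exact Complex.ofReal_re _

theorem integral_betaIntegrand {a b : ℝ} (ha : 0 < a) (hb : 0 < b) :
    ∫ t in Ioo (0 : ℝ) 1, t ^ (a - 1) * (1 - t) ^ (b - 1) =
      Real.Gamma a * Real.Gamma b / Real.Gamma (a + b) := by
  have h := ProbabilityTheory.beta_eq_betaIntegralReal a b ha hb
  rw [ProbabilityTheory.beta] at h
  rw [h, Complex.betaIntegral, intervalIntegral.integral_of_le zero_le_one,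
    integral_Ioc_eq_integral_Ioo]
  have : ∫ t in Ioo (0 : ℝ) 1, (t : ℂ) ^ ((a : ℂ) - 1) * (1 - (t : ℂ)) ^ ((b : ℂ) - 1) =
      ((∫ t in Ioo (0 : ℝ) 1, t ^ (a - 1) * (1 - t) ^ (b - 1) : ℝ) : ℂ) := by
    rw [← integral_complex_ofReal]
    refine setIntegral_congr_fun measurableSet_Ioo fun t ht => ?_
    rw [Complex.ofReal_mul, Complex.ofReal_cpow ht.1.le, Complex.ofReal_cpow (sub_nonneg.2 ht.2.le)]
    push_cast
    rfl
  rw [this, Complex.ofReal_re]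

theorem integrableOn_eulerWeight {α : ℝ} (hα : 0 < α) : IntegrableOn (eulerWeight α) (Ioo 0 1) :=
  integrableOn_betaIntegrand hα hα

theorem eulerWeight_nonneg (α : ℝ) {t : ℝ} (ht : t ∈ Ioo (0 : ℝ) 1) : 0 ≤ eulerWeight α t :=
  mul_nonneg (Real.rpow_nonneg ht.1.le _) (Real.rpow_nonneg (sub_nonneg.2 ht.2.le) _)

theorem measurable_eulerWeight (α : ℝ) : Measurable (eulerWeight α) := by
  unfold eulerWeight; fun_prop

theorem distSq_eq (M P : E3) : distSq M P = ‖M - P‖ ^ 2 := by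
  rw [EuclideanSpace.norm_sq_eq, Fin.sum_univ_three]
  simp [distSq]

theorem distSqRefl_eq (M P : E3) : distSqRefl M P = distSq M P + 4 * M 0 * P 0 := by
  unfold distSqRefl distSq; ring

/-- `(1 - t) r² + t r₁²`, the quantity whose powers are superposed in Euler's integral. -/
def interDistSq (P M : E3) (t : ℝ) : ℝ := distSq M P + 4 * M 0 * P 0 * t

theorem distSq_pos {M P : E3} (h : M ≠ P) : 0 < distSq M P := by
  rw [distSq_eq]
  have := norm_pos_iff.2 (sub_ne_zero.2 h)
  positivity

theorem distSq_le_interDistSq {P M : E3} (hP : 0 ≤ P 0) (hM : 0 ≤ M 0) {t : ℝ} (ht : 0 ≤ t) :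
    distSq M P ≤ interDistSq P M t := by
  unfold interDistSq
  have := mul_nonneg (mul_nonneg (mul_nonneg zero_le_four hM) hP) ht
  linarith

/-- The `j`-th moment of the power `-s` of `interDistSq` with respect to the Euler weight. -/
noncomputable def eulerMoment (α : ℝ) (j : ℕ) (s : ℝ) (P M : E3) : ℝ :=
  ∫ t in Ioo (0 : ℝ) 1, eulerWeight α t * t ^ j * interDistSq P M t ^ (-s)

theorem eulerMoment_integrand_le {α : ℝ} (j : ℕ) {s : ℝ} (hs : 0 ≤ s) {P M : E3} (hP : 0 ≤ P 0)
    (hM : 0 ≤ M 0) {d : ℝ} (hd : 0 < d) (hdM : d ≤ distSq M P) {t : ℝ} (ht : t ∈ Ioo (0 : ℝ) 1) :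
    ‖eulerWeight α t * t ^ j * interDistSq P M t ^ (-s)‖ ≤ eulerWeight α t * d ^ (-s) := by
  have h1 := eulerWeight_nonneg α ht
  have h2 := hdM.trans (distSq_le_interDistSq hP hM ht.1.le)
  have h3 : interDistSq P M t ^ (-s) ≤ d ^ (-s) :=
    Real.rpow_le_rpow_of_nonpos hd h2 (by linarith)
  have h4 : t ^ j ≤ 1 := pow_le_one₀ ht.1.le ht.2.le
  have h5 : 0 ≤ t ^ j := pow_nonneg ht.1.le j
  have h6 : 0 ≤ interDistSq P M t ^ (-s) := Real.rpow_nonneg (hd.le.trans h2) _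
  rw [Real.norm_of_nonneg (by positivity)]
  calc _ ≤ eulerWeight α t * 1 * d ^ (-s) := by gcongr
    _ = _ := by ring

theorem measurable_eulerMoment_integrand (α : ℝ) (j : ℕ) (s : ℝ) (P M : E3) :
    Measurable fun t => eulerWeight α t * t ^ j * interDistSq P M t ^ (-s) := by
  have := measurable_eulerWeight α
  unfold interDistSq
  fun_prop

theorem integrableOn_eulerMoment {α : ℝ} (hα : 0 < α) (j : ℕ) {s : ℝ} (hs : 0 ≤ s) {P M : E3}
    (hP : 0 ≤ P 0) (hM : 0 ≤ M 0) (hne : M ≠ P) :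
    IntegrableOn (fun t => eulerWeight α t * t ^ j * interDistSq P M t ^ (-s)) (Ioo 0 1) := by
  refine ((integrableOn_eulerWeight hα).mul_const (distSq M P ^ (-s))).mono'
    (measurable_eulerMoment_integrand α j s P M).aestronglyMeasurable ?_
  filter_upwards [ae_restrict_mem measurableSet_Ioo] with t ht
  exact eulerMoment_integrand_le j hs hP hM (distSq_pos hne) le_rfl ht

theorem hasFDerivAt_interDistSq (P M : E3) (t : ℝ) :
    HasFDerivAt (fun N => interDistSq P N t)
      ((2 : ℝ) • innerSL ℝ (M - P) + (4 * P 0 * t) • (EuclideanSpace.proj 0 : E3 →L[ℝ] ℝ)) M := by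
  have h1 : HasFDerivAt (fun N : E3 => ‖N - P‖ ^ 2) ((2 : ℝ) • innerSL ℝ (M - P)) M := by
    have h0 := ((hasFDerivAt_id M).sub_const P).norm_sq
    convert! h0 using 1
    ext v
    simp
  have h2 : HasFDerivAt (fun N : E3 => N 0) (EuclideanSpace.proj 0 : E3 →L[ℝ] ℝ) M :=
    (EuclideanSpace.proj 0 : E3 →L[ℝ] ℝ).hasFDerivAt
  have h3 := h1.add (h2.const_mul (4 * P 0 * t))
  refine h3.congr_of_eventuallyEq (.of_forall fun N => ?_)
  simp only [interDistSq, distSq_eq, Pi.add_apply]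
  ring

theorem hasFDerivAt_eulerMoment {α : ℝ} (hα : 0 < α) (j : ℕ) {s : ℝ} (hs : 0 < s) {P M : E3}
    (hP : 0 ≤ P 0) (hM : 0 < M 0) (hne : M ≠ P) :
    HasFDerivAt (eulerMoment α j s P)
      ((-2 * s * eulerMoment α j (s + 1) P M) • innerSL ℝ (M - P) +
        (-4 * s * P 0 * eulerMoment α (j + 1) (s + 1) P M) •
          (EuclideanSpace.proj 0 : E3 →L[ℝ] ℝ)) M := by
  set d := distSq M P / 2 with hd
  have hd0 : 0 < d := half_pos (distSq_pos hne)
  set U : Set E3 := {N | 0 < N 0 ∧ d < distSq N P ∧ ‖N - P‖ < ‖M - P‖ + 1}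
  have hU : U ∈ 𝓝 M := by
    have hc : Continuous fun N : E3 => distSq N P := by unfold distSq; fun_prop
    refine IsOpen.mem_nhds ?_ ⟨hM, half_lt_self (distSq_pos hne), lt_add_one _⟩
    exact (isOpen_lt continuous_const (by fun_prop : Continuous fun N : E3 => N 0)).inter
      ((isOpen_lt continuous_const hc).inter
        (isOpen_lt (by fun_prop : Continuous fun N : E3 => ‖N - P‖) continuous_const))
  set L0 : E3 →L[ℝ] ℝ := EuclideanSpace.proj 0
  set F' : E3 → ℝ → E3 →L[ℝ] ℝ := fun N t =>
    (-2 * s * (eulerWeight α t * t ^ j * interDistSq P N t ^ (-(s + 1)))) • innerSL ℝ (N - P) +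
      (-4 * s * P 0 * (eulerWeight α t * t ^ (j + 1) * interDistSq P N t ^ (-(s + 1)))) • L0
  have hi1 := (integrableOn_eulerMoment hα j (by linarith : 0 ≤ s + 1) hP hM.le hne).const_mul
    (-2 * s)
  have hi2 := (integrableOn_eulerMoment hα (j + 1) (by linarith : 0 ≤ s + 1) hP hM.le hne).const_mul
    (-4 * s * P 0)
  have key := hasFDerivAt_integral_of_dominated_of_fderiv_le (𝕜 := ℝ)
    (μ := volume.restrict (Ioo (0 : ℝ) 1))
    (F := fun N t => eulerWeight α t * t ^ j * interDistSq P N t ^ (-s)) (F' := F') (x₀ := M)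
    (s := U) (bound := fun t => eulerWeight α t *
      (d ^ (-(s + 1)) * (2 * s * (‖M - P‖ + 1) + 4 * s * P 0 * ‖L0‖))) hU ?_ ?_ ?_ ?_ ?_ ?_
  · convert! key using 1
    simp only [F']
    rw [integral_add (hi1.smul_const _) (hi2.smul_const _), integral_smul_const,
      integral_smul_const, integral_const_mul, integral_const_mul]
    rfl
  · exact .of_forall fun N => (measurable_eulerMoment_integrand α j s P N).aestronglyMeasurable
  · exact integrableOn_eulerMoment hα j hs.le hP hM.le hne
  · exact (hi1.aestronglyMeasurable.smul_const _).add (hi2.aestronglyMeasurable.smul_const _)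
  · filter_upwards [ae_restrict_mem measurableSet_Ioo] with t ht N hN
    have b1 := eulerMoment_integrand_le (α := α) j (by linarith : 0 ≤ s + 1) hP hN.1.le hd0
      hN.2.1.le ht
    have b2 := eulerMoment_integrand_le (α := α) (j + 1) (by linarith : 0 ≤ s + 1) hP hN.1.le hd0
      hN.2.1.le ht
    have hw := eulerWeight_nonneg α ht
    have hd1 : 0 ≤ d ^ (-(s + 1)) := Real.rpow_nonneg hd0.le _
    refine (norm_add_le _ _).trans ?_
    rw [norm_smul, norm_smul, norm_mul (-2 * s), norm_mul (-4 * s * P 0), innerSL_apply_norm]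
    have e1 : ‖-2 * s‖ = 2 * s := by rw [norm_mul, Real.norm_of_nonneg hs.le]; norm_num
    have e2 : ‖-4 * s * P 0‖ = 4 * s * P 0 := by
      rw [norm_mul, norm_mul, Real.norm_of_nonneg hs.le, Real.norm_of_nonneg hP]; norm_num
    rw [e1, e2]
    calc _ ≤ 2 * s * (eulerWeight α t * d ^ (-(s + 1))) * (‖M - P‖ + 1) +
          4 * s * P 0 * (eulerWeight α t * d ^ (-(s + 1))) * ‖L0‖ := by
          have := hN.2.2.le
          gcongr
      _ = _ := by ring
  · exact (integrableOn_eulerWeight hα).mul_const _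
  · filter_upwards [ae_restrict_mem measurableSet_Ioo] with t ht N hN
    have hR : 0 < interDistSq P N t :=
      (hd0.trans hN.2.1).trans_le (distSq_le_interDistSq hP hN.1.le ht.1.le)
    have h1 := ((hasFDerivAt_interDistSq P N t).rpow_const (p := -s) (Or.inl hR.ne')).const_mul
      (eulerWeight α t * t ^ j)
    convert! h1 using 1
    simp only [F', L0]
    rw [show -s - 1 = -(s + 1) by ring]
    module

/-- The part of the half-space where the fundamental solution with pole `P` is regular. -/
def regularSet (P : E3) : Set E3 := {N | 0 < N 0 ∧ N ≠ P}

theorem isOpen_regularSet (P : E3) : IsOpen (regularSet P) :=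
  isOpen_halfSpace.inter isOpen_ne

theorem contDiffOn_eulerMoment {α : ℝ} (hα : 0 < α) (j : ℕ) {s : ℝ} (hs : 0 < s) {P : E3}
    (hP : 0 ≤ P 0) : ContDiffOn ℝ 1 (eulerMoment α j s P) (regularSet P) := by
  have hcont : ∀ (j : ℕ) {s : ℝ}, 0 < s → ContinuousOn (eulerMoment α j s P) (regularSet P) :=
    fun j s hs N hN =>
      (hasFDerivAt_eulerMoment hα j hs hP hN.1 hN.2).continuousAt.continuousWithinAt
  have h1 := contDiffOn_succ_iff_fderiv_of_isOpen (𝕜 := ℝ) (n := 0) (f := eulerMoment α j s P)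
    (isOpen_regularSet P)
  rw [zero_add] at h1
  refine h1.2 ⟨fun N hN => (hasFDerivAt_eulerMoment hα j hs hP hN.1
    hN.2).differentiableAt.differentiableWithinAt, by simp, ?_⟩
  rw [contDiffOn_zero]
  refine ContinuousOn.congr (f := fun N => (-2 * s * eulerMoment α j (s + 1) P N) • innerSL ℝ (N - P)
    + (-4 * s * P 0 * eulerMoment α (j + 1) (s + 1) P N) • (EuclideanSpace.proj 0 : E3 →L[ℝ] ℝ)) ?_
    fun N hN => (hasFDerivAt_eulerMoment hα j hs hP hN.1 hN.2).fderiv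
  have c1 := hcont j (by linarith : 0 < s + 1)
  have c2 := hcont (j + 1) (by linarith : 0 < s + 1)
  have c3 : ContinuousOn (fun N : E3 => innerSL ℝ (N - P)) (regularSet P) :=
    Continuous.continuousOn (by fun_prop)
  exact ((continuousOn_const.mul c1).smul c3).add ((continuousOn_const.mul c2).smul
    continuousOn_const)

theorem eulerWeight_integral_pos {α : ℝ} (hα : 0 < α) : 0 < ∫ t in Ioo (0 : ℝ) 1, eulerWeight α t := by
  have h : ∫ t in Ioo (0 : ℝ) 1, eulerWeight α t = _ := integral_betaIntegrand hα hα
  rw [h]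
  have := Real.Gamma_pos_of_pos hα
  have := Real.Gamma_pos_of_pos (add_pos hα hα)
  positivity

/-- The constant in front of Euler's integral for the fundamental solution. -/
noncomputable def eulerConst (α : ℝ) : ℝ := (2 * Real.pi * ∫ t in Ioo (0 : ℝ) 1, eulerWeight α t)⁻¹

theorem q1_eq_eulerMoment {α : ℝ} (hα : 0 < α) {P M : E3} (hP : 0 ≤ P 0) (hM : M ∈ regularSet P) :
    q1 α M P = eulerConst α * eulerMoment α 0 (α + 1 / 2) P M := by
  have hd := distSq_pos hM.2
  have hd1 : 0 < distSqRefl M P := by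
    rw [distSqRefl_eq]
    have := mul_nonneg (mul_nonneg zero_le_four hM.1.le) hP
    linarith
  rw [q1, gaussF_eq_integral _ hα (by linarith : α < 2 * α)
    (by linarith [div_pos hd1 hd] : 1 - distSqRefl M P / distSq M P < 1)]
  have e1 : √(distSq M P) ^ (-2 * α - 1) = distSq M P ^ (-(α + 1 / 2)) := by
    rw [Real.sqrt_eq_rpow, ← Real.rpow_mul hd.le]; congr 1; ring
  have e2 : 2 * α - α - 1 = α - 1 := by ring
  have e3 : distSq M P ^ (-(α + 1 / 2)) * ∫ t in Ioo (0 : ℝ) 1, t ^ (α - 1) * (1 - t) ^ (α - 1) *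
      (1 - t * (1 - distSqRefl M P / distSq M P)) ^ (-(α + 1 / 2)) =
      eulerMoment α 0 (α + 1 / 2) P M := by
    rw [← integral_const_mul, eulerMoment]
    refine setIntegral_congr_fun measurableSet_Ioo fun t ht => ?_
    have hR : 1 - t * (1 - distSqRefl M P / distSq M P) = interDistSq P M t / distSq M P := by
      rw [distSqRefl_eq, interDistSq]; field_simp; ring
    have hR0 : 0 ≤ interDistSq P M t := hd.le.trans (distSq_le_interDistSq hP hM.1.le ht.1.le)
    simp only [hR, pow_zero, mul_one, eulerWeight]
    rw [Real.div_rpow hR0 hd.le]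
    have := (Real.rpow_pos_of_pos hd (-(α + 1 / 2))).ne'
    field_simp
  have e4 : ∫ t in Ioo (0 : ℝ) 1, t ^ (α - 1) * (1 - t) ^ (α - 1) =
      ∫ t in Ioo (0 : ℝ) 1, eulerWeight α t := rfl
  rw [e1, e2, ← e3, e4, eulerConst, mul_inv]
  ring

/-! ### The flux field of the fundamental solution -/

/-- The field `ξ ^ (2α) ∇ q₁(·; P)`, written with the moments of Euler's integral. -/
noncomputable def fluxField (α : ℝ) (P M : E3) : E3 :=
  (-(2 * α + 1) * eulerConst α * M 0 ^ (2 * α)) •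
    (eulerMoment α 0 (α + 3 / 2) P M • (M - P) +
      (2 * P 0 * eulerMoment α 1 (α + 3 / 2) P M) • EuclideanSpace.single 0 1)

theorem fluxField_apply (α : ℝ) (P M : E3) (i : Fin 3) :
    fluxField α P M i = (-(2 * α + 1) * eulerConst α * M 0 ^ (2 * α)) *
      (eulerMoment α 0 (α + 3 / 2) P M * (M i - P i) +
        2 * P 0 * eulerMoment α 1 (α + 3 / 2) P M * (EuclideanSpace.single (0 : Fin 3) (1 : ℝ)) i) := by
  simp only [fluxField, PiLp.smul_apply, PiLp.add_apply, PiLp.sub_apply, smul_eq_mul]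

/-- The conormal derivative of the fundamental solution is the normal component of the flux field. -/
theorem doubleLayerKernel_eq {α : ℝ} (hα : 0 < α) (ν : E3 → E3) {P M : E3} (hP : 0 ≤ P 0)
    (hM : M ∈ regularSet P) : doubleLayerKernel α ν P M = inner ℝ (fluxField α P M) (ν M) := by
  have h1 : HasFDerivAt (fun N => q1 α N P) _ M :=
    ((hasFDerivAt_eulerMoment hα 0 (by linarith : 0 < α + 1 / 2) hP hM.1 hM.2).const_mul
      (eulerConst α)).congr_of_eventuallyEq (by
        filter_upwards [(isOpen_regularSet P).mem_nhds hM] with N hN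
        exact q1_eq_eulerMoment hα hP hN)
  have h2 : ν M = ∑ i : Fin 3, ν M i • EuclideanSpace.single i (1 : ℝ) := by
    ext j; fin_cases j <;> simp [Fin.sum_univ_three]
  have h3 : ∑ i : Fin 3, ν M i * fderiv ℝ (fun N => q1 α N P) M (EuclideanSpace.single i 1) =
      fderiv ℝ (fun N => q1 α N P) M (ν M) := by
    conv_rhs => rw [h2]
    simp [map_sum]
  rw [doubleLayerKernel, conormalDeriv, h3, h1.fderiv, fluxField, real_inner_smul_left,
    inner_add_left, real_inner_smul_left, real_inner_smul_left, EuclideanSpace.inner_single_left]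
  rw [show α + 1 / 2 + 1 = α + 3 / 2 by ring]
  have hpr : (EuclideanSpace.proj 0 : E3 →L[ℝ] ℝ) (ν M) = ν M 0 := rfl
  simp only [map_one, one_mul, smul_apply, add_apply, innerSL_apply_apply, smul_eq_mul, hpr,
    zero_add]
  ring

theorem contDiffOn_fluxField {α : ℝ} (hα : 0 < α) {P : E3} (hP : 0 ≤ P 0) (i : Fin 3) :
    ContDiffOn ℝ 1 (fun M => fluxField α P M i) (regularSet P) := by
  have h0 := contDiffOn_eulerMoment hα 0 (by linarith : 0 < α + 3 / 2) hP
  have h1 := contDiffOn_eulerMoment hα 1 (by linarith : 0 < α + 3 / 2) hP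
  have h2 : ContDiffOn ℝ 1 (fun M : E3 => M 0 ^ (2 * α)) (regularSet P) :=
    ContDiffOn.rpow_const_of_ne (ContDiff.contDiffOn (by fun_prop)) fun M hM => hM.1.ne'
  have h3 : ContDiffOn ℝ 1 (fun M : E3 => M i - P i) (regularSet P) :=
    ContDiff.contDiffOn (by fun_prop)
  refine ContDiffOn.congr (f := fun M : E3 => (-(2 * α + 1) * eulerConst α * M 0 ^ (2 * α)) *
      (eulerMoment α 0 (α + 3 / 2) P M * (M i - P i) + 2 * P 0 * eulerMoment α 1 (α + 3 / 2) P M *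
        (EuclideanSpace.single (0 : Fin 3) (1 : ℝ)) i)) ?_ fun M _ => fluxField_apply α P M i
  exact (contDiffOn_const.mul h2).mul ((h0.mul h3).add ((contDiffOn_const.mul h1).mul
    contDiffOn_const))

/-- Raising the power by one, from `R = r² + 4 ξ x t`. -/
theorem eulerMoment_recursion {α : ℝ} (hα : 0 < α) (j : ℕ) {s : ℝ} (hs : 0 ≤ s) {P M : E3}
    (hP : 0 ≤ P 0) (hM : M ∈ regularSet P) :
    distSq M P * eulerMoment α j (s + 1) P M + 4 * M 0 * P 0 * eulerMoment α (j + 1) (s + 1) P M =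
      eulerMoment α j s P M := by
  have hs' : 0 ≤ s + 1 := by linarith
  simp only [eulerMoment]
  rw [← integral_const_mul, ← integral_const_mul, ← integral_add
    ((integrableOn_eulerMoment hα j hs' hP hM.1.le hM.2).const_mul _)
    ((integrableOn_eulerMoment hα (j + 1) hs' hP hM.1.le hM.2).const_mul _)]
  refine setIntegral_congr_fun measurableSet_Ioo fun t ht => ?_
  have hR : 0 < interDistSq P M t :=
    (distSq_pos hM.2).trans_le (distSq_le_interDistSq hP hM.1.le ht.1.le)
  have h1 : interDistSq P M t ^ (-s) = interDistSq P M t ^ (-(s + 1)) * interDistSq P M t := by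
    rw [show -s = -(s + 1) + 1 by ring, Real.rpow_add_one hR.ne']
  simp only [h1]
  conv_rhs => rw [mul_comm (interDistSq P M t ^ (-(s + 1))), interDistSq]
  simp only [interDistSq]
  ring

/-- The integral of the derivative of `t ^ α (1 - t) ^ α R ^ (-s)` over the unit interval vanishes. -/
theorem eulerMoment_relation {α : ℝ} (hα : 0 < α) {s : ℝ} (hs : 0 ≤ s) {P M : E3}
    (hP : 0 ≤ P 0) (hM : M ∈ regularSet P) :
    α * (eulerMoment α 0 s P M - 2 * eulerMoment α 1 s P M) =
      4 * s * M 0 * P 0 * (eulerMoment α 1 (s + 1) P M - eulerMoment α 2 (s + 1) P M) := by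
  have hs' : 0 ≤ s + 1 := by linarith
  have hpos : ∀ t : ℝ, 0 ≤ t → 0 < interDistSq P M t := fun t ht =>
    (distSq_pos hM.2).trans_le (distSq_le_interDistSq hP hM.1.le ht)
  set g : ℝ → ℝ := fun t => t ^ α * (1 - t) ^ α * interDistSq P M t ^ (-s)
  set g' : ℝ → ℝ := fun t => (α * (eulerWeight α t * t ^ 0 * interDistSq P M t ^ (-s)) -
    2 * α * (eulerWeight α t * t ^ 1 * interDistSq P M t ^ (-s))) -
    (4 * s * M 0 * P 0 * (eulerWeight α t * t ^ 1 * interDistSq P M t ^ (-(s + 1))) -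
    4 * s * M 0 * P 0 * (eulerWeight α t * t ^ 2 * interDistSq P M t ^ (-(s + 1))))
  have i0 := (integrableOn_eulerMoment hα 0 hs hP hM.1.le hM.2).const_mul α
  have i1 := (integrableOn_eulerMoment hα 1 hs hP hM.1.le hM.2).const_mul (2 * α)
  have i2 := (integrableOn_eulerMoment hα 1 hs' hP hM.1.le hM.2).const_mul (4 * s * M 0 * P 0)
  have i3 := (integrableOn_eulerMoment hα 2 hs' hP hM.1.le hM.2).const_mul (4 * s * M 0 * P 0)
  have hint : IntervalIntegrable g' volume 0 1 := by
    rw [intervalIntegrable_iff_integrableOn_Ioo_of_le zero_le_one]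
    exact (i0.sub i1).sub (i2.sub i3)
  have hcR : Continuous fun t => interDistSq P M t := by unfold interDistSq; fun_prop
  have hcont : ContinuousOn g (Icc 0 1) := by
    refine ((continuousOn_id.rpow_const fun _ _ => Or.inr hα.le).mul
      ((continuousOn_const.sub continuousOn_id).rpow_const fun _ _ => Or.inr hα.le)).mul
      (hcR.continuousOn.rpow_const fun t ht => Or.inl (hpos t ht.1).ne')
  have hderiv : ∀ t ∈ Ioo (0 : ℝ) 1, HasDerivAt g (g' t) t := by
    intro t ht
    have ht1 : 0 < 1 - t := sub_pos.2 ht.2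
    have hR := hpos t ht.1.le
    have d1 : HasDerivAt (fun t : ℝ => t ^ α) (α * t ^ (α - 1)) t :=
      Real.hasDerivAt_rpow_const (Or.inl ht.1.ne')
    have d2 : HasDerivAt (fun t : ℝ => (1 - t) ^ α) (-1 * α * (1 - t) ^ (α - 1)) t :=
      ((hasDerivAt_id t).const_sub 1).rpow_const (Or.inl ht1.ne')
    have d3 : HasDerivAt (fun t : ℝ => interDistSq P M t) (4 * M 0 * P 0) t := by
      simpa [interDistSq] using! ((hasDerivAt_id t).const_mul (4 * M 0 * P 0)).const_add
        (distSq M P)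
    have d4 := d3.rpow_const (p := -s) (Or.inl hR.ne')
    convert! (d1.mul d2).mul d4 using 1
    simp only [g', eulerWeight]
    have e1 : t ^ α = t ^ (α - 1) * t := by
      rw [← Real.rpow_add_one ht.1.ne', sub_add_cancel]
    have e2 : (1 - t) ^ α = (1 - t) ^ (α - 1) * (1 - t) := by
      rw [← Real.rpow_add_one ht1.ne', sub_add_cancel]
    simp only [Pi.mul_apply]
    rw [e1, e2, show -s - 1 = -(s + 1) by ring]
    ring
  have h := intervalIntegral.integral_eq_sub_of_hasDerivAt_of_le zero_le_one hcont hderiv hint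
  have hg0 : g 0 = 0 := by simp [g, Real.zero_rpow hα.ne']
  have hg1 : g 1 = 0 := by simp [g, Real.zero_rpow hα.ne']
  rw [hg0, hg1, sub_zero, intervalIntegral.integral_of_le zero_le_one,
    integral_Ioc_eq_integral_Ioo] at h
  have hI := integral_sub (i0.sub i1) (i2.sub i3)
  rw [integral_sub' i0 i1, integral_sub' i2 i3] at hI
  have h' := hI.symm.trans h
  simp only [integral_const_mul] at h'
  simp only [eulerMoment]
  linarith

/-- The field `ξ ^ (2α) ∇ q₁` is divergence-free: the fundamental solution solves the singular
elliptic equation. -/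
theorem divergence_fluxField {α : ℝ} (hα : 0 < α) {P M : E3} (hP : 0 ≤ P 0)
    (hM : M ∈ regularSet P) :
    ∑ i : Fin 3, fderiv ℝ (fun N => fluxField α P N i) M (EuclideanSpace.single i 1) = 0 := by
  have hs : 0 < α + 3 / 2 := by linarith
  have hM0 : 0 < M 0 := hM.1
  have h0 := hasFDerivAt_eulerMoment hα 0 hs hP hM.1 hM.2
  have h1 := hasFDerivAt_eulerMoment hα 1 hs hP hM.1 hM.2
  have hproj : ∀ i : Fin 3, HasFDerivAt (fun N : E3 => N i) (EuclideanSpace.proj i : E3 →L[ℝ] ℝ) M :=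
    fun i => (EuclideanSpace.proj i : E3 →L[ℝ] ℝ).hasFDerivAt
  have h2 := (hproj 0).rpow_const (p := 2 * α) (Or.inl hM0.ne')
  have hcomp := fun i : Fin 3 =>
    (((h2.const_mul (-(2 * α + 1) * eulerConst α)).mul ((h0.mul ((hproj i).sub_const (P i))).add
      ((h1.const_mul (2 * P 0)).mul_const ((EuclideanSpace.single (0 : Fin 3) (1 : ℝ)) i)))
      ).congr_of_eventuallyEq (f₁ := fun N => fluxField α P N i)
        (.of_forall fun N => fluxField_apply α P N i)).fderiv
  have r1 := eulerMoment_recursion hα 0 hs.le hP hM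
  have r2 := eulerMoment_relation hα hs.le hP hM
  have e1 : M 0 ^ (2 * α) = M 0 ^ (2 * α - 1) * M 0 := by
    rw [← Real.rpow_add_one hM0.ne', sub_add_cancel]
  have hd : distSq M P = (M 0 - P 0) ^ 2 + (M 1 - P 1) ^ 2 + (M 2 - P 2) ^ 2 := rfl
  rw [Fin.sum_univ_three, hcomp 0, hcomp 1, hcomp 2]
  have hpr : ∀ i j : Fin 3, (EuclideanSpace.proj i : E3 →L[ℝ] ℝ) (EuclideanSpace.single j 1) =
      if i = j then 1 else 0 := fun i j => by simp
  simp only [smul_apply, add_apply, innerSL_apply_apply, smul_eq_mul, hpr,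
    EuclideanSpace.inner_single_right, zero_add, PiLp.sub_apply, Pi.add_apply, Pi.mul_apply,
    PiLp.single_apply, conj_trivial]
  rw [hd] at r1
  have f1 : (0 : Fin 3) ≠ 1 := by decide
  have f2 : (0 : Fin 3) ≠ 2 := by decide
  simp only [if_true, if_false, f1, f2, f1.symm, f2.symm]
  rw [e1]
  linear_combination (-(2 * α + 1) * eulerConst α * M 0 ^ (2 * α - 1)) *
    (-2 * (α + 3 / 2) * M 0 * r1 - 2 * P 0 * r2)

/-! ### Size and blow-up of the flux field -/

/-- The denominator of the Möbius substitution that exchanges the roles of `r²` and `r₁²` in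
Euler's integral. -/
def mobiusDenom (p m u : ℝ) : ℝ := m * (1 - u) + p * u

theorem mobiusDenom_pos {p m u : ℝ} (hp : 0 < p) (hm : 0 < m) (hu : u ∈ Icc (0 : ℝ) 1) :
    0 < mobiusDenom p m u := by
  unfold mobiusDenom
  rcases hu.2.eq_or_lt with rfl | h
  · simpa using hp
  · have := mul_pos hm (sub_pos.2 h)
    have := mul_nonneg hp.le hu.1
    linarith

/-- The moments of the powers of `mobiusDenom`. -/
noncomputable def mobiusMoment (α : ℝ) (j : ℕ) (e p m : ℝ) : ℝ :=
  ∫ u in Ioo (0 : ℝ) 1, eulerWeight α u * u ^ j * mobiusDenom p m u ^ e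

/-- The substitution `t = r² u / (r₁² (1 - u) + r² u)` in a moment of Euler's integral, which
extracts its singularity at the pole. -/
theorem eulerMoment_eq_mobiusMoment {α : ℝ} (j : ℕ) (s : ℝ) {P M : E3} (hP : 0 ≤ P 0)
    (hM : M ∈ regularSet P) :
    eulerMoment α j s P M = distSq M P ^ (α + j - s) * distSqRefl M P ^ (α - s) *
      mobiusMoment α j (s - 2 * α - j) (distSq M P) (distSqRefl M P) := by
  have hp := distSq_pos hM.2
  have hm : 0 < distSqRefl M P := by
    rw [distSqRefl_eq]
    have := mul_nonneg (mul_nonneg zero_le_four hM.1.le) hP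
    linarith
  have hR : ∀ t, interDistSq P M t = distSq M P + (distSqRefl M P - distSq M P) * t := fun t => by
    rw [distSqRefl_eq, interDistSq]; ring
  unfold eulerMoment mobiusMoment
  simp only [hR]
  generalize distSq M P = p at hp ⊢
  generalize distSqRefl M P = m at hm ⊢
  set f : ℝ → ℝ := fun u => p * u / mobiusDenom p m u with hf
  have hQ : ∀ u ∈ Ioo (0 : ℝ) 1, 0 < mobiusDenom p m u := fun u hu =>
    mobiusDenom_pos hp hm (Ioo_subset_Icc_self hu)
  have himage : f '' Ioo 0 1 = Ioo 0 1 := by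
    refine Subset.antisymm ?_ fun t ht => ?_
    · rintro _ ⟨u, hu, rfl⟩
      have := hQ u hu
      refine ⟨div_pos (mul_pos hp hu.1) this, (div_lt_one this).2 ?_⟩
      unfold mobiusDenom
      have := mul_pos hm (sub_pos.2 hu.2)
      linarith
    · have hR0 : 0 < p * (1 - t) + m * t :=
        add_pos (mul_pos hp (sub_pos.2 ht.2)) (mul_pos hm ht.1)
      refine ⟨m * t / (p * (1 - t) + m * t), ⟨div_pos (mul_pos hm ht.1) hR0,
        (div_lt_one hR0).2 ?_⟩, ?_⟩
      · have := mul_pos hp (sub_pos.2 ht.2)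
        linarith
      · have hQ1 : mobiusDenom p m (m * t / (p * (1 - t) + m * t)) =
            p * m / (p * (1 - t) + m * t) := by
          unfold mobiusDenom; field_simp; ring
        simp only [hf, hQ1]
        field_simp
  have hinj : InjOn f (Ioo 0 1) := by
    intro u hu v hv huv
    simp only [hf] at huv
    rw [div_eq_div_iff (hQ u hu).ne' (hQ v hv).ne'] at huv
    unfold mobiusDenom at huv
    have : p * m * (u - v) = 0 := by linear_combination huv
    have h2 := (mul_eq_zero.1 this).resolve_left (mul_pos hp hm).ne'
    linarith
  have hder : ∀ u ∈ Ioo (0 : ℝ) 1, HasDerivWithinAt f (p * m / mobiusDenom p m u ^ 2) (Ioo 0 1) u := by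
    intro u hu
    have d1 : HasDerivAt (fun u : ℝ => p * u) p u := by
      simpa using (hasDerivAt_id u).const_mul p
    have d2 : HasDerivAt (mobiusDenom p m) (m * (-1) + p * 1) u :=
      (((hasDerivAt_id u).const_sub 1).const_mul m).add ((hasDerivAt_id u).const_mul p)
    have d3 := d1.div d2 (hQ u hu).ne'
    refine (d3.congr_deriv ?_).hasDerivWithinAt
    congr 1
    unfold mobiusDenom; ring
  have key := integral_image_eq_integral_abs_deriv_smul measurableSet_Ioo hder hinj
    (fun t => eulerWeight α t * t ^ j * (p + (m - p) * t) ^ (-s))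
  rw [himage] at key
  rw [key, ← integral_const_mul]
  refine setIntegral_congr_fun measurableSet_Ioo fun u hu => ?_
  have hq := hQ u hu
  have hu1 := sub_pos.2 hu.2
  have e1 : p + (m - p) * f u = p * m / mobiusDenom p m u := by
    simp only [hf]
    rw [eq_div_iff hq.ne', add_mul, mul_assoc (m - p), div_mul_cancel₀ _ hq.ne']
    unfold mobiusDenom; ring
  have e2 : 1 - f u = m * (1 - u) / mobiusDenom p m u := by
    simp only [hf]
    rw [eq_div_iff hq.ne', sub_mul, div_mul_cancel₀ _ hq.ne']
    unfold mobiusDenom; ring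
  simp only [e1]
  rw [abs_of_pos (by positivity)]
  unfold eulerWeight
  rw [e2]
  simp only [hf, smul_eq_mul]
  have hu0 := hu.1
  rw [← Real.rpow_natCast (_ / _) j, ← Real.rpow_natCast u j]
  generalize mobiusDenom p m u = Q at hq ⊢
  generalize 1 - u = v at hu1 ⊢
  -- both sides are products of powers of positive numbers
  rw [← Real.exp_log hp, ← Real.exp_log hm, ← Real.exp_log hq, ← Real.exp_log hu0,
    ← Real.exp_log hu1]
  simp only [← Real.exp_add, ← Real.exp_sub, ← Real.exp_mul, ← Real.exp_nat_mul]
  congr 1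
  push_cast
  ring

theorem mobiusMoment_integrand_bound {α : ℝ} (j : ℕ) {e p m : ℝ} (he : 0 ≤ e) (hp : 0 < p)
    (hpm : p ≤ m) {u : ℝ} (hu : u ∈ Ioo (0 : ℝ) 1) :
    0 ≤ eulerWeight α u * u ^ j * mobiusDenom p m u ^ e ∧
      eulerWeight α u * u ^ j * mobiusDenom p m u ^ e ≤ eulerWeight α u * m ^ e := by
  have hm := hp.trans_le hpm
  have h1 := eulerWeight_nonneg α hu
  have hQ := mobiusDenom_pos hp hm (Ioo_subset_Icc_self hu)
  have h2 : u ^ j ≤ 1 := pow_le_one₀ hu.1.le hu.2.le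
  have h3 : 0 ≤ u ^ j := pow_nonneg hu.1.le j
  have h4 : mobiusDenom p m u ≤ m := by
    unfold mobiusDenom
    nlinarith [mul_le_mul_of_nonneg_right hpm hu.1.le]
  have h5 : mobiusDenom p m u ^ e ≤ m ^ e := Real.rpow_le_rpow hQ.le h4 he
  have h6 : 0 ≤ mobiusDenom p m u ^ e := Real.rpow_nonneg hQ.le _
  refine ⟨by positivity, ?_⟩
  calc _ ≤ eulerWeight α u * 1 * m ^ e := by gcongr
    _ = _ := by ring

theorem measurable_mobiusMoment_integrand (α : ℝ) (j : ℕ) (e p m : ℝ) :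
    Measurable fun u => eulerWeight α u * u ^ j * mobiusDenom p m u ^ e := by
  have := measurable_eulerWeight α
  unfold mobiusDenom
  fun_prop

theorem mobiusMoment_bound {α : ℝ} (hα : 0 < α) (j : ℕ) {e p m : ℝ} (he : 0 ≤ e) (hp : 0 < p)
    (hpm : p ≤ m) : 0 ≤ mobiusMoment α j e p m ∧
      mobiusMoment α j e p m ≤ (∫ t in Ioo (0 : ℝ) 1, eulerWeight α t) * m ^ e := by
  refine ⟨setIntegral_nonneg measurableSet_Ioo fun u hu =>
    (mobiusMoment_integrand_bound j he hp hpm hu).1, ?_⟩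
  rw [← integral_mul_const, mobiusMoment]
  have hi := (integrableOn_eulerWeight hα).mul_const (m ^ e)
  refine setIntegral_mono_on (hi.mono' (measurable_mobiusMoment_integrand α j e p m).aestronglyMeasurable
    ?_) hi measurableSet_Ioo fun u hu => (mobiusMoment_integrand_bound j he hp hpm hu).2
  filter_upwards [ae_restrict_mem measurableSet_Ioo] with u hu
  have := mobiusMoment_integrand_bound (α := α) j he hp hpm hu
  rw [Real.norm_of_nonneg this.1]
  exact this.2

/-- At the pole, where `r² → 0`, the moment tends to a beta integral. -/
theorem tendsto_mobiusMoment {α : ℝ} (hα : 0 < α) {e : ℝ} (he : 0 ≤ e) {ι : Type*} {F : Filter ι}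
    [F.IsCountablyGenerated] {p m : ι → ℝ} {m₀ : ℝ} (hm₀ : 0 < m₀) (hp : ∀ᶠ i in F, 0 < p i)
    (hpm : ∀ᶠ i in F, p i ≤ m i) (hp0 : Tendsto p F (𝓝 0)) (hm0 : Tendsto m F (𝓝 m₀)) :
    Tendsto (fun i => mobiusMoment α 0 e (p i) (m i)) F
      (𝓝 (m₀ ^ e * (Real.Gamma α * Real.Gamma (α + e) / Real.Gamma (α + (α + e))))) := by
  have hlim : m₀ ^ e * (Real.Gamma α * Real.Gamma (α + e) / Real.Gamma (α + (α + e))) =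
      ∫ u in Ioo (0 : ℝ) 1, eulerWeight α u * u ^ 0 * mobiusDenom 0 m₀ u ^ e := by
    rw [← integral_betaIntegrand hα (by linarith), ← integral_const_mul]
    refine setIntegral_congr_fun measurableSet_Ioo fun u hu => ?_
    have := sub_pos.2 hu.2
    simp only [mobiusDenom, eulerWeight, zero_mul, add_zero, pow_zero, mul_one]
    rw [Real.mul_rpow hm₀.le this.le, show α + e - 1 = (α - 1) + e by ring, Real.rpow_add this]
    ring
  rw [hlim]
  refine tendsto_integral_filter_of_dominated_convergence
    (fun u => eulerWeight α u * (m₀ + 1) ^ e)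
    (.of_forall fun i => (measurable_mobiusMoment_integrand α 0 e _ _).aestronglyMeasurable) ?_
    ((integrableOn_eulerWeight hα).mul_const _) ?_
  · filter_upwards [hp, hpm, hm0.eventually_le_const (lt_add_one m₀)] with i h1 h2 h3
    filter_upwards [ae_restrict_mem measurableSet_Ioo] with u hu
    have := mobiusMoment_integrand_bound (α := α) 0 he h1 h2 hu
    rw [Real.norm_of_nonneg this.1]
    have hw := eulerWeight_nonneg α hu
    refine this.2.trans ?_
    gcongr
    exact (h1.trans_le h2).le
  · filter_upwards [ae_restrict_mem measurableSet_Ioo] with u hu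
    refine Tendsto.const_mul _ (Tendsto.rpow_const ?_ (Or.inr he))
    unfold mobiusDenom
    exact (hm0.mul_const _).add (hp0.mul_const _)

theorem fluxField_eq_smul (α : ℝ) (P M : E3) : fluxField α P M =
    (-(2 * α + 1) * eulerConst α * M 0 ^ (2 * α) * eulerMoment α 0 (α + 3 / 2) P M) • (M - P) +
      (-(2 * α + 1) * eulerConst α * M 0 ^ (2 * α) * (2 * P 0 * eulerMoment α 1 (α + 3 / 2) P M)) •
        EuclideanSpace.single 0 1 := by
  rw [fluxField, smul_add, smul_smul, smul_smul]

/-- The first moment in the flux field, in terms of a quantity that stays bounded at the pole. -/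
theorem eulerMoment_zero_eq {α : ℝ} {P M : E3} (hP : 0 ≤ P 0) (hM : M ∈ regularSet P) :
    eulerMoment α 0 (α + 3 / 2) P M = (‖M - P‖ ^ 3)⁻¹ * distSqRefl M P ^ (-(3 / 2 : ℝ)) *
      mobiusMoment α 0 (3 / 2 - α) (distSq M P) (distSqRefl M P) := by
  rw [eulerMoment_eq_mobiusMoment 0 _ hP hM]
  have h1 : distSq M P ^ (α + (0 : ℕ) - (α + 3 / 2)) = (‖M - P‖ ^ 3)⁻¹ := by
    rw [distSq_eq, ← Real.rpow_natCast _ 2, ← Real.rpow_mul (norm_nonneg _), ← Real.rpow_natCast _ 3,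
      ← Real.rpow_neg (norm_nonneg _)]
    congr 1
    push_cast
    ring
  rw [h1, show α - (α + 3 / 2) = -(3 / 2 : ℝ) by ring,
    show α + 3 / 2 - 2 * α - ((0 : ℕ) : ℝ) = 3 / 2 - α by push_cast; ring]

theorem distSq_le_distSqRefl {P M : E3} (hP : 0 ≤ P 0) (hM : 0 ≤ M 0) :
    distSq M P ≤ distSqRefl M P := by
  rw [distSqRefl_eq]
  have := mul_nonneg (mul_nonneg zero_le_four hM) hP
  linarith

/-- The two moments in the flux field are bounded by powers of `r` and `r₁`. -/
theorem eulerMoment_bounds {α : ℝ} (hα0 : 0 < α) (hα1 : 2 * α < 1) {P M : E3} (hP : 0 ≤ P 0)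
    (hM : M ∈ regularSet P) :
    (0 ≤ eulerMoment α 0 (α + 3 / 2) P M ∧ eulerMoment α 0 (α + 3 / 2) P M ≤
      (∫ t in Ioo (0 : ℝ) 1, eulerWeight α t) * distSqRefl M P ^ (-α) * (‖M - P‖ ^ 3)⁻¹) ∧
    (0 ≤ eulerMoment α 1 (α + 3 / 2) P M ∧ eulerMoment α 1 (α + 3 / 2) P M ≤
      (∫ t in Ioo (0 : ℝ) 1, eulerWeight α t) * distSqRefl M P ^ (-α) *
        (‖M - P‖⁻¹ * (distSqRefl M P)⁻¹)) := by
  have hp := distSq_pos hM.2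
  have hpm := distSq_le_distSqRefl hP hM.1.le
  have hm := hp.trans_le hpm
  have hr : 0 < ‖M - P‖ := norm_pos_iff.2 (sub_ne_zero.2 hM.2)
  constructor
  · rw [eulerMoment_zero_eq hP hM]
    have hb := mobiusMoment_bound hα0 0 (by linarith : 0 ≤ 3 / 2 - α) hp hpm
    have h2 : distSqRefl M P ^ (-α) = distSqRefl M P ^ (-(3 / 2 : ℝ)) *
        distSqRefl M P ^ (3 / 2 - α) := by
      rw [← Real.rpow_add hm]; congr 1; ring
    have h3 := Real.rpow_pos_of_pos hm (-(3 / 2 : ℝ))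
    refine ⟨by have := hb.1; positivity, ?_⟩
    calc _ ≤ (‖M - P‖ ^ 3)⁻¹ * distSqRefl M P ^ (-(3 / 2 : ℝ)) *
          ((∫ t in Ioo (0 : ℝ) 1, eulerWeight α t) * distSqRefl M P ^ (3 / 2 - α)) := by
          gcongr; exact hb.2
      _ = _ := by rw [h2]; ring
  · rw [eulerMoment_eq_mobiusMoment 1 _ hP hM,
      show α - (α + 3 / 2) = -(3 / 2 : ℝ) by ring,
      show α + 3 / 2 - 2 * α - ((1 : ℕ) : ℝ) = 1 / 2 - α by push_cast; ring]
    have h1 : distSq M P ^ (α + (1 : ℕ) - (α + 3 / 2)) = ‖M - P‖⁻¹ := by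
      rw [distSq_eq, ← Real.rpow_natCast _ 2, ← Real.rpow_mul (norm_nonneg _), ← Real.rpow_neg_one]
      congr 1
      push_cast
      ring
    have hb := mobiusMoment_bound hα0 1 (by linarith : 0 ≤ 1 / 2 - α) hp hpm
    have h2 : distSqRefl M P ^ (-α) * (distSqRefl M P)⁻¹ = distSqRefl M P ^ (-(3 / 2 : ℝ)) *
        distSqRefl M P ^ (1 / 2 - α) := by
      rw [← Real.rpow_add hm, ← Real.rpow_neg_one (distSqRefl M P), ← Real.rpow_add hm]
      congr 1; ring
    have h3 := Real.rpow_pos_of_pos hm (-(3 / 2 : ℝ))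
    rw [h1]
    refine ⟨by have := hb.1; positivity, ?_⟩
    calc _ ≤ ‖M - P‖⁻¹ * distSqRefl M P ^ (-(3 / 2 : ℝ)) *
          ((∫ t in Ioo (0 : ℝ) 1, eulerWeight α t) * distSqRefl M P ^ (1 / 2 - α)) := by
          gcongr; exact hb.2
      _ = (∫ t in Ioo (0 : ℝ) 1, eulerWeight α t) * (distSqRefl M P ^ (-(3 / 2 : ℝ)) *
        distSqRefl M P ^ (1 / 2 - α)) * ‖M - P‖⁻¹ := by ring
      _ = _ := by rw [← h2]; ring

theorem eulerConst_mul {α : ℝ} (hα : 0 < α) :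
    eulerConst α * ∫ t in Ioo (0 : ℝ) 1, eulerWeight α t = 1 / (2 * Real.pi) := by
  have := (eulerWeight_integral_pos hα).ne'
  rw [eulerConst]
  field_simp

theorem eulerConst_pos {α : ℝ} (hα : 0 < α) : 0 < eulerConst α := by
  have := eulerWeight_integral_pos hα
  unfold eulerConst
  positivity

/-- A linear functional of the flux field is controlled by its values on `M - P` and on the first
basis vector. -/
theorem abs_inner_fluxField_le {α : ℝ} (hα0 : 0 < α) (hα1 : 2 * α < 1) {P M : E3} (hP : 0 ≤ P 0)
    (hM : M ∈ regularSet P) {v : E3} (hv : ‖v‖ ≤ 1) :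
    |inner ℝ (fluxField α P M) v| ≤ (2 * α + 1) / (2 * Real.pi) * (M 0 ^ (2 * α) *
      distSqRefl M P ^ (-α)) * (|inner ℝ (M - P) v| * (‖M - P‖ ^ 3)⁻¹ +
        2 * (P 0 * (distSqRefl M P)⁻¹) * ‖M - P‖⁻¹) := by
  obtain ⟨⟨a0, a1⟩, b0, b1⟩ := eulerMoment_bounds hα0 hα1 hP hM
  have hB := eulerWeight_integral_pos hα0
  have hc := eulerConst_pos hα0
  have hx : 0 ≤ M 0 ^ (2 * α) := Real.rpow_nonneg hM.1.le _
  have he : |v 0| ≤ 1 := (PiLp.norm_apply_le v 0).trans hv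
  rw [fluxField_eq_smul, inner_add_left, real_inner_smul_left, real_inner_smul_left,
    EuclideanSpace.inner_single_left]
  simp only [map_one, one_mul]
  have hm : 0 < distSqRefl M P := (distSq_pos hM.2).trans_le (distSq_le_distSqRefl hP hM.1.le)
  have hcc : 0 ≤ (2 * α + 1) * eulerConst α * M 0 ^ (2 * α) := by positivity
  calc _ ≤ (2 * α + 1) * eulerConst α * M 0 ^ (2 * α) * eulerMoment α 0 (α + 3 / 2) P M *
        |inner ℝ (M - P) v| + (2 * α + 1) * eulerConst α * M 0 ^ (2 * α) *
          (2 * P 0 * eulerMoment α 1 (α + 3 / 2) P M) * |v 0| := by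
        refine (abs_add_le _ _).trans_eq ?_
        rw [abs_mul _ (inner ℝ (M - P) v), abs_mul _ (v 0)]
        have e : -(2 * α + 1) * eulerConst α * M 0 ^ (2 * α) =
          -((2 * α + 1) * eulerConst α * M 0 ^ (2 * α)) := by ring
        rw [e, neg_mul, neg_mul, abs_neg, abs_neg, abs_of_nonneg (mul_nonneg hcc a0),
          abs_of_nonneg (mul_nonneg hcc (mul_nonneg (mul_nonneg zero_le_two hP) b0))]
    _ ≤ (2 * α + 1) * eulerConst α * M 0 ^ (2 * α) * ((∫ t in Ioo (0 : ℝ) 1, eulerWeight α t) *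
          distSqRefl M P ^ (-α) * (‖M - P‖ ^ 3)⁻¹) * |inner ℝ (M - P) v| +
        (2 * α + 1) * eulerConst α * M 0 ^ (2 * α) * (2 * P 0 *
          ((∫ t in Ioo (0 : ℝ) 1, eulerWeight α t) * distSqRefl M P ^ (-α) *
            (‖M - P‖⁻¹ * (distSqRefl M P)⁻¹))) * 1 := by gcongr
    _ = (2 * α + 1) * (eulerConst α * ∫ t in Ioo (0 : ℝ) 1, eulerWeight α t) * (M 0 ^ (2 * α) *
          distSqRefl M P ^ (-α)) * (|inner ℝ (M - P) v| * (‖M - P‖ ^ 3)⁻¹ +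
        2 * (P 0 * (distSqRefl M P)⁻¹) * ‖M - P‖⁻¹) := by ring
    _ = _ := by rw [eulerConst_mul hα0]; ring

theorem sq_le_distSqRefl {P M : E3} (hP : 0 ≤ P 0) (hM : 0 ≤ M 0) :
    M 0 ^ 2 ≤ distSqRefl M P ∧ P 0 ^ 2 ≤ distSqRefl M P := by
  unfold distSqRefl
  have := mul_nonneg hP hM
  constructor <;> nlinarith [sq_nonneg (M 1 - P 1), sq_nonneg (M 2 - P 2), sq_nonneg (M 0),
    sq_nonneg (P 0)]

theorem rpow_mul_distSqRefl_le {α : ℝ} (hα : 0 < α) {P M : E3} (hP : 0 ≤ P 0)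
    (hM : M ∈ regularSet P) : M 0 ^ (2 * α) * distSqRefl M P ^ (-α) ≤ 1 := by
  have hM0 : 0 < M 0 := hM.1
  have h1 := (sq_le_distSqRefl hP hM.1.le).1
  have h2 : M 0 ^ (2 * α) = (M 0 ^ 2) ^ α := by
    rw [← Real.rpow_natCast, ← Real.rpow_mul hM0.le]; norm_num
  have h3 : 0 < M 0 ^ 2 := by positivity
  rw [h2, Real.rpow_neg (h3.trans_le h1).le, ← div_eq_mul_inv]
  exact div_le_one_of_le₀ (Real.rpow_le_rpow h3.le h1 hα.le) (Real.rpow_nonneg (h3.trans_le h1).le _)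

/-- The normal component of the flux field is no more singular than that of the Newtonian field. -/
theorem abs_inner_fluxField_le_of_norm {α : ℝ} (hα0 : 0 < α) (hα1 : 2 * α < 1) {P M : E3}
    (hP : 0 ≤ P 0) (hM : M ∈ regularSet P) {v : E3} (hv : ‖v‖ ≤ 1) :
    |inner ℝ (fluxField α P M) v| ≤ (2 * α + 1) / (2 * Real.pi) *
      (|inner ℝ (M - P) v| * (‖M - P‖ ^ 3)⁻¹ + 2 * (P 0)⁻¹ * ‖M - P‖⁻¹) := by
  refine (abs_inner_fluxField_le hα0 hα1 hP hM hv).trans ?_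
  have hm : 0 < distSqRefl M P := (distSq_pos hM.2).trans_le (distSq_le_distSqRefl hP hM.1.le)
  have h1 := rpow_mul_distSqRefl_le hα0 hP hM
  have h2 : P 0 * (distSqRefl M P)⁻¹ ≤ (P 0)⁻¹ := by
    rcases hP.eq_or_lt with h | h
    · rw [← h]; simp
    · have h3 := (sq_le_distSqRefl hP hM.1.le).2
      calc _ ≤ P 0 * (P 0 ^ 2)⁻¹ := by gcongr
        _ = _ := by field_simp
  calc _ ≤ (2 * α + 1) / (2 * Real.pi) * 1 * (|inner ℝ (M - P) v| * (‖M - P‖ ^ 3)⁻¹ +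
        2 * (P 0)⁻¹ * ‖M - P‖⁻¹) := by gcongr
    _ = _ := by ring

theorem norm_fluxField_le_mul_rpow {α : ℝ} (hα0 : 0 < α) (hα1 : 2 * α < 1) {P M : E3} (hP : 0 ≤ P 0)
    (hM : M ∈ regularSet P) : ‖fluxField α P M‖ ≤ 3 * ((2 * α + 1) / (2 * Real.pi)) *
      (M 0 ^ (2 * α) * distSqRefl M P ^ (-α)) * (‖M - P‖ ^ 2)⁻¹ := by
  have hr : 0 < ‖M - P‖ := norm_pos_iff.2 (sub_ne_zero.2 hM.2)
  have hm : 0 < distSqRefl M P := (distSq_pos hM.2).trans_le (distSq_le_distSqRefl hP hM.1.le)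
  have hpm := distSq_le_distSqRefl hP hM.1.le
  rw [distSq_eq] at hpm
  have h2 : P 0 * (distSqRefl M P)⁻¹ ≤ ‖M - P‖⁻¹ := by
    rw [← div_eq_mul_inv, div_le_iff₀ hm, inv_mul_eq_div, le_div_iff₀ hr]
    have h3 := (sq_le_distSqRefl hP hM.1.le).2
    nlinarith [sq_nonneg (P 0 - ‖M - P‖)]
  have h4 := Real.rpow_nonneg hm.le (-α)
  have h5 : 0 ≤ M 0 ^ (2 * α) := Real.rpow_nonneg hM.1.le _
  have h6 := eq_or_ne (fluxField α P M) 0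
  rcases h6 with h6 | h6
  · rw [h6, norm_zero]; positivity
  have h7 : 0 < ‖fluxField α P M‖ := norm_pos_iff.2 h6
  have h8 : ‖‖fluxField α P M‖⁻¹ • fluxField α P M‖ = 1 := by
    rw [norm_smul, norm_inv, norm_norm, inv_mul_cancel₀ h7.ne']
  have h9 := abs_inner_fluxField_le hα0 hα1 hP hM h8.le
  rw [real_inner_smul_right, real_inner_self_eq_norm_sq, sq, inv_mul_cancel_left₀ h7.ne',
    abs_of_pos h7] at h9
  refine h9.trans ?_
  have h10 : |inner ℝ (M - P) (‖fluxField α P M‖⁻¹ • fluxField α P M)| ≤ ‖M - P‖ := by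
    refine (abs_real_inner_le_norm _ _).trans_eq ?_
    rw [h8, mul_one]
  calc _ ≤ (2 * α + 1) / (2 * Real.pi) * (M 0 ^ (2 * α) * distSqRefl M P ^ (-α)) *
        (‖M - P‖ * (‖M - P‖ ^ 3)⁻¹ + 2 * ‖M - P‖⁻¹ * ‖M - P‖⁻¹) := by gcongr
    _ = _ := by field_simp; ring

theorem norm_fluxField_le {α : ℝ} (hα0 : 0 < α) (hα1 : 2 * α < 1) {P M : E3} (hP : 0 ≤ P 0)
    (hM : M ∈ regularSet P) :
    ‖fluxField α P M‖ ≤ 3 * ((2 * α + 1) / (2 * Real.pi)) * (‖M - P‖ ^ 2)⁻¹ := by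
  refine (norm_fluxField_le_mul_rpow hα0 hα1 hP hM).trans ?_
  have := rpow_mul_distSqRefl_le hα0 hP hM
  calc _ ≤ 3 * ((2 * α + 1) / (2 * Real.pi)) * 1 * (‖M - P‖ ^ 2)⁻¹ := by gcongr
    _ = _ := by ring

/-- The flux field vanishes on the plane `x = 0`, away from the pole. -/
theorem norm_fluxField_le_rpow {α : ℝ} (hα0 : 0 < α) (hα1 : 2 * α < 1) {P M : E3} (hP : 0 ≤ P 0)
    (hM : M ∈ regularSet P) : ‖fluxField α P M‖ ≤ 3 * ((2 * α + 1) / (2 * Real.pi)) *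
      ‖M - P‖ ^ (-(2 * α + 2)) * M 0 ^ (2 * α) := by
  refine (norm_fluxField_le_mul_rpow hα0 hα1 hP hM).trans ?_
  have hr : 0 < ‖M - P‖ := norm_pos_iff.2 (sub_ne_zero.2 hM.2)
  have hpm := distSq_le_distSqRefl hP hM.1.le
  rw [distSq_eq] at hpm
  have h1 : distSqRefl M P ^ (-α) ≤ (‖M - P‖ ^ 2) ^ (-α) :=
    Real.rpow_le_rpow_of_nonpos (by positivity) hpm (by linarith)
  have h2 : ‖M - P‖ ^ (-(2 * α + 2)) = (‖M - P‖ ^ 2) ^ (-α) * (‖M - P‖ ^ 2)⁻¹ := by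
    rw [← Real.rpow_neg_one (‖M - P‖ ^ 2), ← Real.rpow_add (by positivity), ← Real.rpow_natCast _ 2,
      ← Real.rpow_mul hr.le]
    congr 1; push_cast; ring
  have h5 : 0 ≤ M 0 ^ (2 * α) := Real.rpow_nonneg hM.1.le _
  rw [h2]
  calc _ ≤ 3 * ((2 * α + 1) / (2 * Real.pi)) * (M 0 ^ (2 * α) * (‖M - P‖ ^ 2) ^ (-α)) *
        (‖M - P‖ ^ 2)⁻¹ := by gcongr
    _ = _ := by ring

/-- The ratio of the two beta integrals at the pole, by Legendre's duplication formula. -/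
theorem beta_ratio {α : ℝ} (hα : 0 < α) :
    (2 * α + 1) * eulerConst α * (Real.Gamma α * Real.Gamma (α + (3 / 2 - α)) /
      Real.Gamma (α + (α + (3 / 2 - α)))) = 4 ^ α / (4 * Real.pi) := by
  have h : ∫ t in Ioo (0 : ℝ) 1, eulerWeight α t = _ := integral_betaIntegrand hα hα
  have hd := Real.Gamma_mul_Gamma_add_half α
  have g1 := Real.Gamma_pos_of_pos hα
  have g2 := Real.Gamma_pos_of_pos (by linarith : 0 < 2 * α)
  have g3 := Real.Gamma_pos_of_pos (by linarith : 0 < α + 1 / 2)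
  have e1 : Real.Gamma (α + (3 / 2 - α)) = √Real.pi / 2 := by
    rw [show α + (3 / 2 - α) = 1 / 2 + 1 by ring, Real.Gamma_add_one (by norm_num),
      Real.Gamma_one_half_eq]
    ring
  have e2 : Real.Gamma (α + (α + (3 / 2 - α))) = (α + 1 / 2) * Real.Gamma (α + 1 / 2) := by
    rw [show α + (α + (3 / 2 - α)) = (α + 1 / 2) + 1 by ring, Real.Gamma_add_one (by linarith)]
  have e3 : (2 : ℝ) ^ (1 - 2 * α) = 2 * (4 ^ α)⁻¹ := by
    rw [Real.rpow_sub two_pos, Real.rpow_one, Real.rpow_mul two_pos.le]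
    norm_num
    ring
  have h4 : (0 : ℝ) < 4 ^ α := by positivity
  have hpi := Real.pi_pos
  have hs := Real.sqrt_pos.2 hpi
  rw [e3] at hd
  rw [eulerConst, h, e1, e2, ← two_mul]
  generalize Real.Gamma α = G at *
  generalize Real.Gamma (2 * α) = G₂ at *
  generalize Real.Gamma (α + 1 / 2) = G₃ at *
  field_simp
  field_simp at hd
  linear_combination (-2 : ℝ) * hd

/-- With the pole on the plane `x = 0` the flux field is homogeneous. -/
theorem sq_smul_fluxField_of_eq_zero {α : ℝ} (hα : 0 < α) {P y : E3} (hP : P 0 = 0) (hy : 0 < y 0)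
    {δ : ℝ} (hδ : 0 < δ) : δ ^ 2 • fluxField α P (P + δ • y) =
      (-((2 * α + 1) / (2 * Real.pi)) * y 0 ^ (2 * α) * ‖y‖ ^ (-(2 * α + 3))) • y := by
  have hy0 : y ≠ 0 := by rintro rfl; simp at hy
  have hyn := norm_pos_iff.2 hy0
  have hd : distSq (P + δ • y) P = (δ * ‖y‖) ^ 2 := by
    rw [distSq_eq, add_sub_cancel_left, norm_smul, Real.norm_of_nonneg hδ.le]
  have hJ : eulerMoment α 0 (α + 3 / 2) P (P + δ • y) =
      (∫ t in Ioo (0 : ℝ) 1, eulerWeight α t) * (δ * ‖y‖) ^ (-(2 * α + 3)) := by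
    rw [eulerMoment, ← integral_mul_const]
    congr 1
    ext t
    rw [interDistSq, hP, hd, mul_zero, zero_mul, add_zero, pow_zero, mul_one,
      ← Real.rpow_natCast _ 2, ← Real.rpow_mul (by positivity)]
    congr 2
    push_cast; ring
  rw [fluxField_eq_smul, hJ, hP, add_sub_cancel_left]
  simp only [mul_zero, zero_mul, zero_smul, add_zero, PiLp.add_apply, PiLp.smul_apply, smul_eq_mul,
    hP, zero_add]
  rw [smul_smul, smul_smul, Real.mul_rpow hδ.le hy.le, Real.mul_rpow hδ.le hyn.le]
  congr 1
  have h1 : δ ^ (-(2 * α + 3)) * δ ^ (2 * α) * δ ^ 3 = 1 := by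
    rw [← Real.rpow_natCast _ 3, ← Real.rpow_add hδ, ← Real.rpow_add hδ]
    convert Real.rpow_zero δ using 2
    push_cast; ring
  calc _ = -(2 * α + 1) * (eulerConst α * ∫ t in Ioo (0 : ℝ) 1, eulerWeight α t) * y 0 ^ (2 * α) *
        ‖y‖ ^ (-(2 * α + 3)) * (δ ^ (-(2 * α + 3)) * δ ^ (2 * α) * δ ^ 3) := by ring
    _ = _ := by rw [h1, eulerConst_mul hα]; ring

/-- Near a pole off the plane `x = 0` the flux field is asymptotic to the Newtonian field of a
unit mass. -/
theorem tendsto_sq_smul_fluxField {α : ℝ} (hα0 : 0 < α) (hα1 : 2 * α < 1) {P y : E3} (hP : 0 < P 0)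
    (hy : y ≠ 0) : Tendsto (fun δ : ℝ => δ ^ 2 • fluxField α P (P + δ • y)) (𝓝[>] 0)
      (𝓝 ((-(1 / (4 * Real.pi)) * (‖y‖ ^ 3)⁻¹) • y)) := by
  have hyn := norm_pos_iff.2 hy
  have hline : Tendsto (fun δ : ℝ => P + δ • y) (𝓝[>] 0) (𝓝 P) := by
    have : Continuous fun δ : ℝ => P + δ • y := by fun_prop
    simpa using (this.tendsto 0).mono_left nhdsWithin_le_nhds
  have hreg : ∀ᶠ δ : ℝ in 𝓝[>] 0, P + δ • y ∈ regularSet P := by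
    filter_upwards [hline.eventually (isOpen_halfSpace.mem_nhds hP), self_mem_nhdsWithin]
      with δ h1 (h2 : 0 < δ)
    exact ⟨h1, by simp [h2.ne', hy]⟩
  set p : ℝ → ℝ := fun δ => distSq (P + δ • y) P
  set m : ℝ → ℝ := fun δ => distSqRefl (P + δ • y) P
  have hx : Tendsto (fun δ : ℝ => (P + δ • y) 0) (𝓝[>] 0) (𝓝 (P 0)) := by
    have : Continuous fun N : E3 => N 0 := by fun_prop
    exact (this.tendsto P).comp hline
  have hp0 : Tendsto p (𝓝[>] 0) (𝓝 0) := by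
    have hc : Continuous fun N : E3 => distSq N P := by unfold distSq; fun_prop
    have := (hc.tendsto P).comp hline
    rwa [show distSq P P = 0 by simp [distSq_eq]] at this
  have hm0 : Tendsto m (𝓝[>] 0) (𝓝 (4 * P 0 ^ 2)) := by
    have hc : Continuous fun N : E3 => distSqRefl N P := by unfold distSqRefl; fun_prop
    have := (hc.tendsto P).comp hline
    convert! this using 2
    rw [distSqRefl_eq, distSq_eq]; simp; ring
  have hp : ∀ᶠ δ in 𝓝[>] 0, 0 < p δ := hreg.mono fun δ h => distSq_pos h.2
  have hpm : ∀ᶠ δ in 𝓝[>] 0, p δ ≤ m δ := hreg.mono fun δ h => distSq_le_distSqRefl hP.le h.1.le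
  have hm₀ : 0 < 4 * P 0 ^ 2 := by positivity
  have hK := tendsto_mobiusMoment hα0 (by linarith : 0 ≤ 3 / 2 - α) hm₀ hp hpm hp0 hm0
  have hxα : Tendsto (fun δ : ℝ => ((P + δ • y) 0) ^ (2 * α)) (𝓝[>] 0) (𝓝 (P 0 ^ (2 * α))) :=
    hx.rpow_const (Or.inl hP.ne')
  have hmα : Tendsto (fun δ => m δ ^ (-(3 / 2 : ℝ))) (𝓝[>] 0) (𝓝 ((4 * P 0 ^ 2) ^ (-(3 / 2 : ℝ)))) :=
    hm0.rpow_const (Or.inl hm₀.ne')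
  -- the radial part
  have h1 : Tendsto (fun δ : ℝ => δ ^ 2 * (-(2 * α + 1) * eulerConst α * ((P + δ • y) 0) ^ (2 * α) *
      eulerMoment α 0 (α + 3 / 2) P (P + δ • y)) * δ) (𝓝[>] 0)
      (𝓝 (-(1 / (4 * Real.pi)) * (‖y‖ ^ 3)⁻¹)) := by
    have h := ((hxα.mul hmα).mul hK).const_mul (-(2 * α + 1) * eulerConst α * (‖y‖ ^ 3)⁻¹)
    have e : -(2 * α + 1) * eulerConst α * (‖y‖ ^ 3)⁻¹ * (P 0 ^ (2 * α) *
        (4 * P 0 ^ 2) ^ (-(3 / 2 : ℝ)) * ((4 * P 0 ^ 2) ^ (3 / 2 - α) * (Real.Gamma α *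
          Real.Gamma (α + (3 / 2 - α)) / Real.Gamma (α + (α + (3 / 2 - α)))))) =
        -(1 / (4 * Real.pi)) * (‖y‖ ^ 3)⁻¹ := by
      have e1 : P 0 ^ (2 * α) * (4 * P 0 ^ 2) ^ (-(3 / 2 : ℝ)) * (4 * P 0 ^ 2) ^ (3 / 2 - α) *
          4 ^ α = 1 := by
        rw [mul_assoc (P 0 ^ (2 * α)), ← Real.rpow_add hm₀, show -(3 / 2 : ℝ) + (3 / 2 - α) = -α by ring,
          Real.mul_rpow (by norm_num) (by positivity), ← Real.rpow_natCast (P 0) 2,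
          ← Real.rpow_mul hP.le]
        have h4 : (4 : ℝ) ^ (-α) * 4 ^ α = 1 := by
          rw [← Real.rpow_add (by norm_num), neg_add_cancel, Real.rpow_zero]
        have h5 : P 0 ^ (2 * α) * P 0 ^ (((2 : ℕ) : ℝ) * -α) = 1 := by
          rw [← Real.rpow_add hP]
          convert Real.rpow_zero (P 0) using 2
          push_cast; ring
        linear_combination P 0 ^ (2 * α) * P 0 ^ (((2 : ℕ) : ℝ) * -α) * h4 + h5
      have e2 := beta_ratio hα0
      calc _ = -(P 0 ^ (2 * α) * (4 * P 0 ^ 2) ^ (-(3 / 2 : ℝ)) * (4 * P 0 ^ 2) ^ (3 / 2 - α)) *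
            (‖y‖ ^ 3)⁻¹ * ((2 * α + 1) * eulerConst α * (Real.Gamma α *
          Real.Gamma (α + (3 / 2 - α)) / Real.Gamma (α + (α + (3 / 2 - α))))) := by ring
        _ = -(P 0 ^ (2 * α) * (4 * P 0 ^ 2) ^ (-(3 / 2 : ℝ)) * (4 * P 0 ^ 2) ^ (3 / 2 - α) * 4 ^ α) *
            (‖y‖ ^ 3)⁻¹ / (4 * Real.pi) := by rw [e2]; ring
        _ = _ := by rw [e1]; ring
    rw [e] at h
    refine h.congr' ?_
    filter_upwards [hreg, self_mem_nhdsWithin] with δ h1 (h2 : 0 < δ)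
    rw [eulerMoment_zero_eq hP.le h1, add_sub_cancel_left, norm_smul, Real.norm_of_nonneg h2.le]
    simp only [p, m]
    field_simp
  -- the part along the first axis
  have h2 : Tendsto (fun δ : ℝ => δ ^ 2 * (-(2 * α + 1) * eulerConst α * ((P + δ • y) 0) ^ (2 * α) *
      (2 * P 0 * eulerMoment α 1 (α + 3 / 2) P (P + δ • y)))) (𝓝[>] 0) (𝓝 0) := by
    have hmb : Tendsto (fun δ => (∫ t in Ioo (0 : ℝ) 1, eulerWeight α t) * m δ ^ (-α) *
        (‖y‖⁻¹ * (m δ)⁻¹) * δ) (𝓝[>] 0) (𝓝 0) := by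
      have hδ : Tendsto (fun δ : ℝ => δ) (𝓝[>] 0) (𝓝 0) := nhdsWithin_le_nhds
      have := (((hm0.rpow_const (p := -α) (Or.inl hm₀.ne')).const_mul
        (∫ t in Ioo (0 : ℝ) 1, eulerWeight α t)).mul ((hm0.inv₀ hm₀.ne').const_mul ‖y‖⁻¹)).mul hδ
      simpa using this
    have hsq : Tendsto (fun δ : ℝ => δ ^ 2 * eulerMoment α 1 (α + 3 / 2) P (P + δ • y)) (𝓝[>] 0)
        (𝓝 0) := by
      refine squeeze_zero' ?_ ?_ hmb
      · filter_upwards [hreg] with δ h1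
        have := (eulerMoment_bounds hα0 hα1 hP.le h1).2.1
        positivity
      · filter_upwards [hreg, self_mem_nhdsWithin] with δ h1 (h2 : 0 < δ)
        have := (eulerMoment_bounds hα0 hα1 hP.le h1).2.2
        rw [add_sub_cancel_left, norm_smul, Real.norm_of_nonneg h2.le] at this
        refine (mul_le_mul_of_nonneg_left this (sq_nonneg δ)).trans_eq ?_
        simp only [m]
        field_simp
    have := ((hxα.const_mul (-(2 * α + 1) * eulerConst α)).mul (hsq.const_mul (2 * P 0)))
    simp only [mul_zero] at this
    exact this.congr fun δ => by ring
  have h3 := (h1.smul_const y).add (h2.smul_const (EuclideanSpace.single (0 : Fin 3) (1 : ℝ)))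
  rw [zero_smul, add_zero] at h3
  refine h3.congr fun δ => ?_
  rw [fluxField_eq_smul, smul_add, smul_smul, smul_smul, add_sub_cancel_left, smul_smul]

/-! ### The flux through the surface -/

theorem continuousOn_fluxField {α : ℝ} (hα : 0 < α) {P : E3} (hP : 0 ≤ P 0) :
    ContinuousOn (fluxField α P) (regularSet P) := by
  have c : ContinuousOn (fun M => WithLp.ofLp (fluxField α P M)) (regularSet P) :=
    continuousOn_pi.2 fun i => (contDiffOn_fluxField hα hP i).continuousOn
  exact (PiLp.continuous_toLp 2 _).comp_continuousOn c

namespace HasHolderBoundary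

variable {D Γ : Set E3} {ν : E3 → E3} {A l : ℝ}

theorem ae_mem_regularSet (h : HasHolderBoundary D Γ ν A l) (P : E3) :
    ∀ᵐ M ∂surfaceMeasure Γ, M ∈ Γ ∧ M ∈ regularSet P := by
  have h1 : ∀ᵐ M ∂surfaceMeasure Γ, M ∈ Γ := ae_restrict_mem h.measurableSet
  have h2 : ∀ᵐ M ∂surfaceMeasure Γ, M ≠ P := by
    rw [ae_iff]; simpa using measure_singleton_surface P
  filter_upwards [h1, h2] with M hM hMP
  exact ⟨hM, h.subset_halfSpace hM, hMP⟩

/-- The surface is, to order `1 + l`, a cone with apex `P`; for `P` away from the closure of the surface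
this only says that the distance to `P` is bounded below. -/
theorem exists_abs_inner_le (h : HasHolderBoundary D Γ ν A l) (P : E3) :
    ∃ C, ∀ q ∈ Γ, |inner ℝ (q - P) (ν q)| ≤ C * ‖q - P‖ ^ (1 + l) := by
  by_cases hP : P ∈ closure Γ
  · exact ⟨_, fun q hq => h.abs_inner_le_of_mem_closure hP hq⟩
  rw [Metric.mem_closure_iff] at hP
  push Not at hP
  obtain ⟨δ, δ0, hδ⟩ := hP
  refine ⟨(δ ^ l)⁻¹, fun q hq => ?_⟩
  have h1 : δ ≤ ‖q - P‖ := by rw [← dist_eq_norm, dist_comm]; exact hδ q hq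
  have hr : 0 < ‖q - P‖ := δ0.trans_le h1
  have h2 := (abs_real_inner_le_norm (q - P) (ν q))
  rw [h.unit q hq, mul_one] at h2
  have h3 : δ ^ l ≤ ‖q - P‖ ^ l := Real.rpow_le_rpow δ0.le h1 h.exp_pos.le
  rw [Real.rpow_one_add' hr.le (by linarith [h.exp_pos]), inv_mul_eq_div, le_div_iff₀ (by positivity)]
  gcongr

/-- The kernel has a singularity of order `l - 2 > -2` on the surface, so it is absolutely
integrable. -/
theorem integrable_fluxField (h : HasHolderBoundary D Γ ν A l) {α : ℝ} (hα0 : 0 < α)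
    (hα1 : 2 * α < 1) {P : E3} (hP : 0 ≤ P 0) :
    Integrable (fun M => inner ℝ (fluxField α P M) (ν M)) (surfaceMeasure Γ) := by
  have hmem := h.ae_mem_regularSet P
  obtain ⟨C, hC⟩ := h.exists_abs_inner_le P
  have i1 := h.integrable_norm_sub_rpow (by linarith [h.exp_pos] : -2 < l - 2)
    (by linarith [h.exp_le]) P
  have i2 := h.integrable_norm_sub_rpow (by norm_num : (-2 : ℝ) < -1) (by norm_num) P
  refine (((i1.const_mul C).add (i2.const_mul (2 * (P 0)⁻¹))).const_mul
    ((2 * α + 1) / (2 * Real.pi))).mono' ?_ ?_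
  · have hc : ContinuousOn (fun M => inner ℝ (fluxField α P M) (ν M)) (Γ ∩ regularSet P) := by
      exact ((continuousOn_fluxField hα0 hP).mono inter_subset_right).inner (h.continuousOn_normal.mono inter_subset_left)
    have := hc.aestronglyMeasurable (μ := surfaceMeasure Γ)
      (h.measurableSet.inter (isOpen_regularSet P).measurableSet)
    rwa [Measure.restrict_eq_self_of_ae_mem (s := Γ ∩ regularSet P) hmem] at this
  · filter_upwards [hmem] with M hM
    have hr : 0 < ‖M - P‖ := norm_pos_iff.2 (sub_ne_zero.2 hM.2.2)
    refine (abs_inner_fluxField_le_of_norm hα0 hα1 hP hM.2 (h.unit M hM.1).le).trans ?_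
    have h1 : |inner ℝ (M - P) (ν M)| * (‖M - P‖ ^ 3)⁻¹ ≤ C * ‖M - P‖ ^ (l - 2) := by
      calc _ ≤ C * ‖M - P‖ ^ (1 + l) * (‖M - P‖ ^ 3)⁻¹ := by gcongr; exact hC M hM.1
        _ = _ := by
          rw [mul_assoc, ← Real.rpow_natCast _ 3, ← Real.rpow_neg hr.le, ← Real.rpow_add hr]
          congr 2; push_cast; ring
    simp only [Pi.add_apply]
    rw [Real.rpow_neg_one]
    gcongr

/-- The flux of a compactly supported truncation of the divergence-free field. -/
theorem integral_fderiv_fluxField_of_tsupport (h : HasHolderBoundary D Γ ν A l) {α : ℝ}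
    (hα : 0 < α) {P : E3} (hP : 0 ≤ P 0) {φ : E3 → ℝ} (hφ : ContDiff ℝ 1 φ)
    (hc : HasCompactSupport φ) (hs : tsupport φ ⊆ regularSet P) :
    ∫ M in D, fderiv ℝ φ M (fluxField α P M) =
      ∫ M, φ M * inner ℝ (fluxField α P M) (ν M) ∂surfaceMeasure Γ := by
  set f : Fin 3 → E3 → ℝ := fun i M => φ M * fluxField α P M i
  have hsub : ∀ i, tsupport (f i) ⊆ tsupport φ := fun i => tsupport_mul_subset_left
  have hfat : ∀ i, ∀ M ∈ regularSet P, ContDiffAt ℝ 1 (fun M => fluxField α P M i) M :=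
    fun i M hM => (contDiffOn_fluxField hα hP i).contDiffAt ((isOpen_regularSet P).mem_nhds hM)
  have hf : ∀ i, ContDiff ℝ 1 (f i) := by
    intro i
    rw [contDiff_iff_contDiffAt]
    intro M
    by_cases hM : M ∈ tsupport φ
    · exact hφ.contDiffAt.mul (hfat i M (hs hM))
    · have h0 := notMem_tsupport_iff_eventuallyEq.1 hM
      have : f i =ᶠ[𝓝 M] fun _ => 0 := by
        filter_upwards [h0] with N hN
        simp only [f, hN, Pi.zero_apply, zero_mul]
      exact contDiffAt_const.congr_of_eventuallyEq this
  have hfc : ∀ i, HasCompactSupport (f i) := fun i => hc.mul_right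
  have hgg := fun i : Fin 3 => h.gauss_green (hf i) (hfc i)
    ((hsub i).trans (hs.trans fun _ hM => hM.1)) (EuclideanSpace.single i (1 : ℝ))
  have hsingle : ∀ v : E3, ∑ i : Fin 3, v i • EuclideanSpace.single i (1 : ℝ) = v := by
    intro v; ext j; fin_cases j <;> simp [Fin.sum_univ_three]
  have hL : ∫ M in D, fderiv ℝ φ M (fluxField α P M) =
      ∑ i : Fin 3, ∫ M in D, fderiv ℝ (f i) M (EuclideanSpace.single i (1 : ℝ)) := by
    rw [← integral_finsetSum]
    · congr 1
      ext M
      by_cases hM : M ∈ tsupport φ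
      · have hd : ∀ i, fderiv ℝ (f i) M (EuclideanSpace.single i (1 : ℝ)) =
            φ M * fderiv ℝ (fun N => fluxField α P N i) M (EuclideanSpace.single i 1) +
              fluxField α P M i * fderiv ℝ φ M (EuclideanSpace.single i 1) := by
          intro i
          have := ((hφ.differentiable one_ne_zero M).hasFDerivAt.mul
            ((hfat i M (hs hM)).differentiableAt one_ne_zero).hasFDerivAt).fderiv
          have e : f i = φ * fun N => fluxField α P N i := rfl
          rw [e, this]
          simp
        simp only [hd]
        rw [Finset.sum_add_distrib, ← Finset.mul_sum, divergence_fluxField hα hP (hs hM), mul_zero,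
          zero_add]
        conv_lhs => rw [← hsingle (fluxField α P M)]
        simp [map_sum]
      · rw [fderiv_of_notMem_tsupport ℝ hM]
        simp only [zero_apply]
        symm
        refine Finset.sum_eq_zero fun i _ => ?_
        rw [fderiv_of_notMem_tsupport ℝ fun h' => hM (hsub i h')]
        simp
    · intro i _
      exact (((hf i).continuous_fderiv one_ne_zero).clm_apply
        continuous_const).integrable_of_hasCompactSupport
          ((hfc i).fderiv_apply ℝ _) |>.integrableOn
  rw [hL, Finset.sum_congr rfl fun i _ => hgg i, ← integral_finsetSum]
  · congr 1
    ext M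
    rw [PiLp.inner_apply, Finset.mul_sum]
    refine Finset.sum_congr rfl fun i _ => ?_
    rw [EuclideanSpace.inner_single_right]
    simp [f]
    ring
  · exact fun i _ => h.integrable_surface_mul_inner (hf i).continuous (hfc i) _

end HasHolderBoundary

/-- A bounded set has little volume near the plane `x = 0`. -/
theorem exists_volume_slab_le {D : Set E3} (hb : Bornology.IsBounded D) (hD : D ⊆ halfSpace) :
    ∃ C, ∀ t : ℝ, 0 ≤ t → volume.real (D ∩ {M | M 0 < t}) ≤ C * t := by
  obtain ⟨R, hR⟩ := hb.subset_ball (0 : E3)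
  set R' := max R 0
  refine ⟨(2 * R') ^ 2, fun t ht => ?_⟩
  set B : Set (Fin 3 → ℝ) := Set.pi univ ![Ioo 0 t, Ioo (-R') R', Ioo (-R') R']
  have hR0 : 0 ≤ R' := le_max_right _ _
  have hvol : volume B = ENNReal.ofReal ((2 * R') ^ 2 * t) := by
    simp only [B]
    rw [volume_pi_pi, Fin.prod_univ_three]
    simp only [Matrix.cons_val_zero, Matrix.cons_val_one, Matrix.cons_val, Real.volume_Ioo]
    rw [← ENNReal.ofReal_mul (by linarith), ← ENNReal.ofReal_mul (mul_nonneg (by linarith) (by linarith))]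
    congr 1
    ring
  have hsub : D ∩ {M | M 0 < t} ⊆ WithLp.ofLp ⁻¹' B := by
    rintro M ⟨hM, hMt⟩
    have hM0 : 0 < M 0 := hD hM
    have hn : ∀ i, |M i| < R' := fun i =>
      ((PiLp.norm_apply_le M i).trans_lt (mem_ball_zero_iff.1 (hR hM))).trans_le (le_max_left _ _)
    simp only [mem_preimage, B, mem_univ_pi]
    intro i
    fin_cases i
    · exact ⟨hM0, hMt⟩
    · exact abs_lt.1 (hn 1)
    · exact abs_lt.1 (hn 2)
  have hpre : volume (WithLp.ofLp ⁻¹' B : Set E3) = volume B :=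
    (PiLp.volume_preserving_ofLp (Fin 3)).measure_preimage
      (MeasurableSet.univ_pi fun i => by fin_cases i <;> exact measurableSet_Ioo).nullMeasurableSet
  rw [measureReal_def]
  refine ENNReal.toReal_le_of_le_ofReal (by positivity) ?_
  rw [← hvol, ← hpre]
  exact measure_mono hsub

theorem deriv_smoothTransition_eq_zero {x : ℝ} (hx : x ∉ Icc (0 : ℝ) 1) :
    deriv Real.smoothTransition x = 0 := by
  rw [mem_Icc, not_and_or, not_le, not_le] at hx
  rcases hx with hx | hx
  · have : Real.smoothTransition =ᶠ[𝓝 x] fun _ => 0 := by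
      filter_upwards [Iio_mem_nhds hx] with y hy
      exact Real.smoothTransition.zero_of_nonpos (le_of_lt hy)
    rw [this.deriv_eq, deriv_const]
  · have : Real.smoothTransition =ᶠ[𝓝 x] fun _ => 1 := by
      filter_upwards [Ioi_mem_nhds hx] with y hy
      exact Real.smoothTransition.one_of_one_le (le_of_lt hy)
    rw [this.deriv_eq, deriv_const]

theorem continuous_deriv_smoothTransition : Continuous (deriv Real.smoothTransition) :=
  (Real.smoothTransition.contDiff (n := 1)).continuous_deriv le_rfl

theorem exists_abs_deriv_smoothTransition_le :
    ∃ C, 0 < C ∧ ∀ x, |deriv Real.smoothTransition x| ≤ C := by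
  obtain ⟨C, hC⟩ := isCompact_Icc.exists_bound_of_continuousOn (s := Icc (0 : ℝ) 1)
    continuous_deriv_smoothTransition.continuousOn
  refine ⟨max C 1, by positivity, fun x => ?_⟩
  by_cases hx : x ∈ Icc (0 : ℝ) 1
  · exact (hC x hx).trans (le_max_left _ _)
  · rw [deriv_smoothTransition_eq_zero hx, abs_zero]
    positivity

namespace HasHolderBoundary

variable {D Γ : Set E3} {ν : E3 → E3} {A l : ℝ}

/-- The flux of the truncated field when the truncation only removes the pole: the plane `x = 0`
carries no flux, because the field is `O(ξ ^ (2α))` there and a slab of width `ε` has volume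
`O(ε)`. -/
theorem integral_fderiv_fluxField (h : HasHolderBoundary D Γ ν A l) {α : ℝ} (hα0 : 0 < α)
    (hα1 : 2 * α < 1) {P : E3} (hP : 0 ≤ P 0) {ψ : E3 → ℝ} (hψ : ContDiff ℝ 1 ψ) {r : ℝ}
    (hr : 0 < r) (h0 : ∀ M ∈ Metric.ball P r, ψ M = 0) :
    ∫ M in D, fderiv ℝ ψ M (fluxField α P M) =
      ∫ M, ψ M * inner ℝ (fluxField α P M) (ν M) ∂surfaceMeasure Γ := by
  obtain ⟨R, hR0, hR⟩ := h.isBounded.subset_ball_lt 0 (0 : E3)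
  -- `θ` only makes supports compact; it is `1` on the domain and on the surface
  set θ : ContDiffBump (0 : E3) := ⟨R, R + 1, hR0, lt_add_one R⟩
  have hclD : closure D ⊆ Metric.closedBall 0 R :=
    closure_minimal (hR.trans Metric.ball_subset_closedBall) Metric.isClosed_closedBall
  have hθ1 : ∀ M ∈ closure D, θ M = 1 := fun M hM => θ.one_of_mem_closedBall (hclD hM)
  set S := Real.smoothTransition
  have hS : ContDiff ℝ 1 S := Real.smoothTransition.contDiff (n := 1)
  obtain ⟨CS, CS0, hCS⟩ := exists_abs_deriv_smoothTransition_le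
  -- `χ ε` vanishes for `ξ ≤ ε` and is `1` for `ξ ≥ 2 ε`
  set χ : ℝ → E3 → ℝ := fun ε M => S (M 0 / ε - 1)
  have hχ : ∀ ε, ContDiff ℝ 1 (χ ε) := fun ε =>
    hS.comp (by fun_prop : ContDiff ℝ 1 fun M : E3 => M 0 / ε - 1)
  have hχ01 : ∀ ε M, ‖χ ε M‖ ≤ 1 := fun ε M => by
    rw [Real.norm_of_nonneg (Real.smoothTransition.nonneg _)]
    exact Real.smoothTransition.le_one _
  have hχlim : ∀ M : E3, 0 < M 0 → Tendsto (fun ε => χ ε M) (𝓝[>] 0) (𝓝 1) := by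
    intro M hM
    refine tendsto_const_nhds.congr' ?_
    filter_upwards [Ioo_mem_nhdsGT (half_pos hM)] with ε hε
    refine (Real.smoothTransition.one_of_one_le ?_).symm
    have : 2 ≤ M 0 / ε := by
      rw [le_div_iff₀ hε.1]; linarith [hε.2]
    linarith
  have hχd : ∀ ε M v, fderiv ℝ (χ ε) M v = deriv S (M 0 / ε - 1) * (v 0 / ε) := by
    intro ε M v
    have d1 : HasFDerivAt (fun M : E3 => M 0) (EuclideanSpace.proj 0 : E3 →L[ℝ] ℝ) M :=
      (EuclideanSpace.proj 0 : E3 →L[ℝ] ℝ).hasFDerivAt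
    have d2 := (d1.mul_const ε⁻¹).sub_const 1
    have d3 := ((hS.differentiable one_ne_zero (M 0 * ε⁻¹ - 1)).hasDerivAt).comp_hasFDerivAt M d2
    have e : χ ε = S ∘ fun M : E3 => M 0 * ε⁻¹ - 1 := by
      ext N; simp [χ, div_eq_mul_inv]
    rw [e, d3.fderiv]
    simp only [smul_apply, smul_eq_mul, div_eq_mul_inv]
    rw [show (EuclideanSpace.proj 0 : E3 →L[ℝ] ℝ) v = v 0 from rfl]
    ring
  -- bounds on the bounded domain
  have hcomp : IsCompact (closure D) := h.isBounded.isCompact_closure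
  obtain ⟨Cψ, hCψ⟩ := hcomp.exists_bound_of_continuousOn hψ.continuous.continuousOn
  obtain ⟨Cd, hCd⟩ := hcomp.exists_bound_of_continuousOn
    (hψ.continuous_fderiv one_ne_zero).continuousOn
  have hzero : ∀ M ∈ Metric.ball P r, fderiv ℝ ψ M = 0 := by
    intro M hM
    have : ψ =ᶠ[𝓝 M] fun _ => 0 := by
      filter_upwards [Metric.isOpen_ball.mem_nhds hM] with N hN using h0 N hN
    rw [this.fderiv_eq, fderiv_fun_const]; rfl
  have hfar : ∀ M, M ∉ Metric.ball P r → r ≤ ‖M - P‖ := fun M hM => by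
    rw [Metric.mem_ball, not_lt, dist_eq_norm] at hM; exact hM
  have hreg : ∀ M ∈ halfSpace, M ∉ Metric.ball P r → M ∈ regularSet P := fun M hM hMP =>
    ⟨hM, by rintro rfl; exact hMP (Metric.mem_ball_self hr)⟩
  have hVae : ContinuousOn (fluxField α P) (D \ {P}) :=
    (continuousOn_fluxField hα0 hP).mono fun M hM => ⟨h.subset hM.1, hM.2⟩
  have hVm : AEStronglyMeasurable (fluxField α P) (volume.restrict D) := by
    have := hVae.aestronglyMeasurable (μ := volume) (h.isOpen.measurableSet.diff (measurableSet_singleton P))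
    rwa [Measure.restrict_congr_set (sdiff_null_ae_eq_self (measure_singleton P))] at this
  have hfin : volume D ≠ ⊤ := h.isBounded.measure_lt_top.ne
  have : IsFiniteMeasure (volume.restrict D) := ⟨by simpa using h.isBounded.measure_lt_top⟩
  set K := 3 * ((2 * α + 1) / (2 * Real.pi))
  have hK0 : 0 ≤ K := by positivity
  have hb1 : ∀ M ∈ D, ‖fderiv ℝ ψ M (fluxField α P M)‖ ≤ Cd * (K * (r ^ 2)⁻¹) := by
    intro M hM
    have hc0 : 0 ≤ Cd := (norm_nonneg _).trans (hCd M (_root_.subset_closure hM))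
    by_cases hMP : M ∈ Metric.ball P r
    · rw [hzero M hMP]
      simp only [zero_apply, norm_zero]
      positivity
    · have h1 := norm_fluxField_le hα0 hα1 hP (hreg M (h.subset hM) hMP)
      have h2 := hfar M hMP
      calc _ ≤ ‖fderiv ℝ ψ M‖ * ‖fluxField α P M‖ := ContinuousLinearMap.le_opNorm _ _
        _ ≤ Cd * (K * (‖M - P‖ ^ 2)⁻¹) := by gcongr; exact hCd M (_root_.subset_closure hM)
        _ ≤ _ := by gcongr
  have hb2 : ∀ M ∈ D, ‖ψ M * fluxField α P M 0‖ ≤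
      Cψ * (K * r ^ (-(2 * α + 2))) * M 0 ^ (2 * α) := by
    intro M hM
    have hc0 : 0 ≤ Cψ := (norm_nonneg _).trans (hCψ M (_root_.subset_closure hM))
    have hM0 : 0 < M 0 := h.subset hM
    by_cases hMP : M ∈ Metric.ball P r
    · rw [h0 M hMP, zero_mul, norm_zero]
      positivity
    · have h1 := norm_fluxField_le_rpow hα0 hα1 hP (hreg M (h.subset hM) hMP)
      have h2 := Real.rpow_le_rpow_of_nonpos hr (hfar M hMP) (by linarith : -(2 * α + 2) ≤ 0)
      have h3 := PiLp.norm_apply_le (fluxField α P M) 0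
      rw [norm_mul]
      calc _ ≤ Cψ * (K * ‖M - P‖ ^ (-(2 * α + 2)) * M 0 ^ (2 * α)) := by
            gcongr
            · exact hCψ M (_root_.subset_closure hM)
            · exact h3.trans h1
        _ ≤ Cψ * (K * r ^ (-(2 * α + 2)) * M 0 ^ (2 * α)) := by gcongr
        _ = _ := by ring
  have hdm : AEStronglyMeasurable (fun M => fderiv ℝ ψ M (fluxField α P M)) (volume.restrict D) :=
    (ContinuousLinearMap.aestronglyMeasurable_comp₂ (ContinuousLinearMap.id ℝ (E3 →L[ℝ] ℝ))
      (hψ.continuous_fderiv one_ne_zero).aestronglyMeasurable hVm)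
  have h0m : AEStronglyMeasurable (fun M => fluxField α P M 0) (volume.restrict D) :=
    (by fun_prop : Continuous fun v : E3 => v 0).comp_aestronglyMeasurable hVm
  -- the identity for the doubly truncated field
  have hflux : ∀ ε > 0, ∫ M in D, (χ ε M * fderiv ℝ ψ M (fluxField α P M) +
      deriv S (M 0 / ε - 1) / ε * (ψ M * fluxField α P M 0)) =
      ∫ M, χ ε M * (ψ M * inner ℝ (fluxField α P M) (ν M)) ∂surfaceMeasure Γ := by
    intro ε ε0
    set φ : E3 → ℝ := fun M => θ M * (χ ε M * ψ M)
    have hφ : ContDiff ℝ 1 φ := θ.contDiff.mul ((hχ ε).mul hψ)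
    have hφc : HasCompactSupport φ := θ.hasCompactSupport.mul_right
    have hφs : tsupport φ ⊆ regularSet P := by
      have hcl : IsClosed ({M : E3 | ε ≤ M 0} ∩ (Metric.ball P r)ᶜ) :=
        (isClosed_le continuous_const (by fun_prop)).inter Metric.isOpen_ball.isClosed_compl
      have hsupp : Function.support φ ⊆ {M : E3 | ε ≤ M 0} ∩ (Metric.ball P r)ᶜ := by
        refine fun M hM => ⟨?_, fun hMP => hM ?_⟩
        rotate_left
        · simp only [φ, h0 M hMP, mul_zero]
        by_contra hlt
        rw [mem_ofPred_eq, not_le] at hlt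
        refine hM ?_
        have : χ ε M = 0 := Real.smoothTransition.zero_of_nonpos (by
          have := (div_lt_one ε0).2 hlt
          linarith)
        simp only [φ, this, zero_mul, mul_zero]
      exact (closure_minimal hsupp hcl).trans fun M hM => hreg M (ε0.trans_le hM.1) hM.2
    have key := h.integral_fderiv_fluxField_of_tsupport hα0 hP hφ hφc hφs
    have e1 : ∫ M in D, fderiv ℝ φ M (fluxField α P M) = ∫ M in D, (χ ε M * fderiv ℝ ψ M
        (fluxField α P M) + deriv S (M 0 / ε - 1) / ε * (ψ M * fluxField α P M 0)) := by
      refine setIntegral_congr_fun h.isOpen.measurableSet fun M hM => ?_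
      have : φ =ᶠ[𝓝 M] fun M => χ ε M * ψ M := by
        filter_upwards [h.isOpen.mem_nhds hM] with N hN
        simp only [φ, hθ1 N (_root_.subset_closure hN), one_mul]
      have hd := (((hχ ε).differentiable one_ne_zero M).hasFDerivAt.mul
        (hψ.differentiable one_ne_zero M).hasFDerivAt).fderiv
      have e : (fun M => χ ε M * ψ M) = χ ε * ψ := rfl
      simp only
      rw [this.fderiv_eq, e, hd]
      simp only [add_apply, smul_apply, smul_eq_mul, hχd]
      ring
    rw [← e1, key]
    refine integral_congr_ae ?_
    filter_upwards [h.ae_mem_regularSet P] with M hM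
    simp only [φ, hθ1 M (h.subset_closure hM.1), one_mul]
    ring
  have hint1 : ∀ ε, IntegrableOn (fun M => χ ε M * fderiv ℝ ψ M (fluxField α P M)) D := by
    intro ε
    refine (integrable_const (Cd * (K * (r ^ 2)⁻¹))).mono'
      ((hχ ε).continuous.aestronglyMeasurable.mul hdm) ?_
    filter_upwards [ae_restrict_mem h.isOpen.measurableSet] with M hM
    rw [norm_mul]
    exact (mul_le_of_le_one_left (norm_nonneg _) (hχ01 ε M)).trans (hb1 M hM)
  have hSm : ∀ ε : ℝ, Continuous fun M : E3 => deriv S (M 0 / ε - 1) / ε := fun ε =>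
    ((hS.continuous_deriv le_rfl).comp (by fun_prop)).div_const ε
  obtain ⟨CD, hCD⟩ := exists_volume_slab_le h.isBounded h.subset
  -- the contribution of the slab near the plane
  have hslab : ∀ ε > 0, ∀ M ∈ D, ‖deriv S (M 0 / ε - 1) / ε * (ψ M * fluxField α P M 0)‖ ≤
      CS / ε * (Cψ * (K * r ^ (-(2 * α + 2))) * (2 * ε) ^ (2 * α)) ∧
      (2 * ε ≤ M 0 → deriv S (M 0 / ε - 1) = 0) := by
    intro ε ε0 M hM
    have hc0 : 0 ≤ Cψ := (norm_nonneg _).trans (hCψ M (_root_.subset_closure hM))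
    have hM0 : 0 < M 0 := h.subset hM
    have hvan : 2 * ε ≤ M 0 → deriv S (M 0 / ε - 1) = 0 := by
      intro hle
      have h1 : 1 ≤ M 0 / ε - 1 := by
        have := (le_div_iff₀ ε0).2 hle
        linarith
      exact IsLocalMax.deriv_eq_zero (.of_forall fun x => by
        rw [show S (M 0 / ε - 1) = 1 from Real.smoothTransition.one_of_one_le h1]
        exact Real.smoothTransition.le_one x)
    refine ⟨?_, hvan⟩
    by_cases hle : 2 * ε ≤ M 0
    · rw [hvan hle, zero_div, zero_mul, norm_zero]; positivity
    · push Not at hle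
      rw [norm_mul, norm_div, Real.norm_of_nonneg ε0.le]
      have h1 : M 0 ^ (2 * α) ≤ (2 * ε) ^ (2 * α) := Real.rpow_le_rpow hM0.le hle.le (by linarith)
      have h2 := hCS (M 0 / ε - 1)
      have h3 := hb2 M hM
      rw [← Real.norm_eq_abs] at h2
      calc _ ≤ CS / ε * (Cψ * (K * r ^ (-(2 * α + 2))) * M 0 ^ (2 * α)) := by gcongr
        _ ≤ _ := by gcongr
  have hint2 : ∀ ε > 0, IntegrableOn
      (fun M => deriv S (M 0 / ε - 1) / ε * (ψ M * fluxField α P M 0)) D := by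
    intro ε ε0
    refine (integrable_const (CS / ε * (Cψ * (K * r ^ (-(2 * α + 2))) * (2 * ε) ^ (2 * α)))).mono'
      ((hSm ε).aestronglyMeasurable.mul (hψ.continuous.aestronglyMeasurable.mul h0m)) ?_
    filter_upwards [ae_restrict_mem h.isOpen.measurableSet] with M hM
    exact (hslab ε ε0 M hM).1
  have hlim2 : Tendsto (fun ε : ℝ => ∫ M in D, deriv S (M 0 / ε - 1) / ε *
      (ψ M * fluxField α P M 0)) (𝓝[>] 0) (𝓝 0) := by
    have hb : ∀ᶠ ε : ℝ in 𝓝[>] 0, ‖∫ M in D, deriv S (M 0 / ε - 1) / ε *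
        (ψ M * fluxField α P M 0)‖ ≤ 2 * |CS * CD * (Cψ * (K * r ^ (-(2 * α + 2))))| *
          (2 * ε) ^ (2 * α) := by
      filter_upwards [self_mem_nhdsWithin] with ε (ε0 : 0 < ε)
      have hs : MeasurableSet (D ∩ {M : E3 | M 0 < 2 * ε}) :=
        h.isOpen.measurableSet.inter (isOpen_lt (by fun_prop) continuous_const).measurableSet
      rw [setIntegral_eq_of_subset_of_forall_sdiff_eq_zero h.isOpen.measurableSet
        (inter_subset_left (t := {M : E3 | M 0 < 2 * ε}))]
      · refine (norm_setIntegral_le_of_norm_le_const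
          ((measure_mono inter_subset_left).trans_lt hfin.lt_top)
          fun M hM => (hslab ε ε0 M hM.1).1).trans ?_
        have h1 := hCD (2 * ε) (by positivity)
        have h2 := le_abs_self (CS * CD * (Cψ * (K * r ^ (-(2 * α + 2)))))
        by_cases hne : D.Nonempty
        · obtain ⟨M, hM⟩ := hne
          have hc0 : 0 ≤ Cψ := (norm_nonneg _).trans (hCψ M (_root_.subset_closure hM))
          calc _ ≤ CS / ε * (Cψ * (K * r ^ (-(2 * α + 2))) * (2 * ε) ^ (2 * α)) * (CD * (2 * ε)) := by
                gcongr
            _ = 2 * (CS * CD * (Cψ * (K * r ^ (-(2 * α + 2))))) * (2 * ε) ^ (2 * α) := by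
                field_simp
            _ ≤ _ := by gcongr
        · rw [not_nonempty_iff_eq_empty] at hne
          rw [hne, empty_inter]
          simp only [measureReal_empty, mul_zero]
          positivity
      · intro M hM
        have : 2 * ε ≤ M 0 := by
          by_contra hlt
          exact hM.2 ⟨hM.1, not_le.1 hlt⟩
        rw [(hslab ε ε0 M hM.1).2 this, zero_div, zero_mul]
    refine squeeze_zero_norm' hb ?_
    have hc : Continuous fun ε : ℝ => 2 * |CS * CD * (Cψ * (K * r ^ (-(2 * α + 2))))| *
        (2 * ε) ^ (2 * α) :=
      continuous_const.mul ((continuous_const.mul continuous_id).rpow_const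
        fun _ => Or.inr (by linarith))
    have := (hc.tendsto 0).mono_left (nhdsWithin_le_nhds (s := Ioi 0))
    simpa [Real.zero_rpow (by linarith : 2 * α ≠ 0)] using! this
  have hlim1 : Tendsto (fun ε : ℝ => ∫ M in D, χ ε M * fderiv ℝ ψ M (fluxField α P M)) (𝓝[>] 0)
      (𝓝 (∫ M in D, fderiv ℝ ψ M (fluxField α P M))) := by
    refine tendsto_integral_filter_of_dominated_convergence (fun _ => Cd * (K * (r ^ 2)⁻¹))
      (.of_forall fun ε => (hint1 ε).aestronglyMeasurable) (.of_forall fun ε => ?_)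
      (integrable_const _) ?_
    · filter_upwards [ae_restrict_mem h.isOpen.measurableSet] with M hM
      rw [norm_mul]
      exact (mul_le_of_le_one_left (norm_nonneg _) (hχ01 ε M)).trans (hb1 M hM)
    · filter_upwards [ae_restrict_mem h.isOpen.measurableSet] with M hM
      simpa using (hχlim M (h.subset hM)).mul_const (fderiv ℝ ψ M (fluxField α P M))
  have hsurf := h.integrable_fluxField hα0 hα1 hP
  have hlim3 : Tendsto (fun ε : ℝ => ∫ M, χ ε M * (ψ M * inner ℝ (fluxField α P M) (ν M))
      ∂surfaceMeasure Γ) (𝓝[>] 0)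
      (𝓝 (∫ M, ψ M * inner ℝ (fluxField α P M) (ν M) ∂surfaceMeasure Γ)) := by
    have hm := (hψ.continuous.aestronglyMeasurable (μ := surfaceMeasure Γ)).mul
      hsurf.aestronglyMeasurable
    refine tendsto_integral_filter_of_dominated_convergence
      (fun M => Cψ * ‖inner ℝ (fluxField α P M) (ν M)‖)
      (.of_forall fun ε => (hχ ε).continuous.aestronglyMeasurable.mul hm) (.of_forall fun ε => ?_)
      (hsurf.norm.const_mul _) ?_
    · filter_upwards [h.ae_mem_regularSet P] with M hM
      rw [norm_mul, norm_mul]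
      refine (mul_le_of_le_one_left (by positivity) (hχ01 ε M)).trans ?_
      gcongr
      exact hCψ M (h.subset_closure hM.1)
    · filter_upwards [h.ae_mem_regularSet P] with M hM
      simpa using (hχlim M hM.2.1).mul_const (ψ M * inner ℝ (fluxField α P M) (ν M))
  have hlim12 := hlim1.add hlim2
  rw [add_zero] at hlim12
  refine tendsto_nhds_unique (hlim12.congr' ?_) hlim3
  filter_upwards [self_mem_nhdsWithin] with ε (ε0 : 0 < ε)
  rw [← hflux ε ε0, integral_add (hint1 ε) (hint2 ε ε0)]

end HasHolderBoundary

/-! ### Integrals over spherical shells -/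

/-- Integration in polar coordinates of a radial function times a power of the first coordinate. -/
theorem integral_norm_mul_abs_rpow (g : ℝ → ℝ) (β : ℝ) :
    ∫ y : E3, g ‖y‖ * |y 0| ^ β =
      (∫ ω, |(ω : E3) 0| ^ β ∂(volume : Measure E3).toSphere) *
        ∫ r in Ioi (0 : ℝ), r ^ 2 * (r ^ β * g r) := by
  have hdim : Module.finrank ℝ E3 - 1 = 2 := by simp
  calc ∫ y : E3, g ‖y‖ * |y 0| ^ β
      = ∫ y : ({(0 : E3)}ᶜ : Set E3), g ‖(y : E3)‖ * |(y : E3) 0| ^ β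
          ∂((volume : Measure E3).comap (↑)) := by
        rw [integral_subtype_comap (measurableSet_singleton _).compl
          fun y : E3 => g ‖y‖ * |y 0| ^ β, restrict_compl_singleton]
    _ = ∫ z : Metric.sphere (0 : E3) 1 × Ioi (0 : ℝ), |(z.1 : E3) 0| ^ β * ((z.2 : ℝ) ^ β * g z.2)
          ∂((volume : Measure E3).toSphere.prod (.volumeIoiPow (Module.finrank ℝ E3 - 1))) := by
        rw [← (volume : Measure E3).measurePreserving_homeomorphUnitSphereProd.integral_comp
          (Homeomorph.measurableEmbedding _)]
        congr 1
        ext y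
        have hy : 0 < ‖(y : E3)‖ := norm_pos_iff.2 y.2
        simp only [homeomorphUnitSphereProd_apply_snd_coe, homeomorphUnitSphereProd_apply_fst_coe,
          PiLp.smul_apply, smul_eq_mul, abs_mul, abs_inv, abs_norm]
        rw [Real.mul_rpow (by positivity) (abs_nonneg _), Real.inv_rpow hy.le]
        have := (Real.rpow_pos_of_pos hy β).ne'
        field_simp
    _ = _ := by
        rw [integral_prod_mul (fun ω : Metric.sphere (0 : E3) 1 => |(ω : E3) 0| ^ β)
          (fun r : Ioi (0 : ℝ) => (r : ℝ) ^ β * g r), hdim]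
        congr 1
        simp only [Measure.volumeIoiPow, ENNReal.ofReal]
        rw [integral_withDensity_eq_integral_smul,
          integral_subtype_comap measurableSet_Ioi
            fun a : ℝ => Real.toNNReal (a ^ 2) • (a ^ β * g a),
          setIntegral_congr_fun measurableSet_Ioi fun x hx => ?_]
        · rw [NNReal.smul_def, Real.coe_toNNReal _ (sq_nonneg _), smul_eq_mul]
        · exact (measurable_subtype_coe.pow_const _).real_toNNReal

/-- The `β`-th absolute moment of a coordinate on the unit sphere, computed from Gaussian
integrals. -/
theorem integral_sphere_abs_rpow {β : ℝ} (hβ : 0 ≤ β) :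
    ∫ ω, |(ω : E3) 0| ^ β ∂(volume : Measure E3).toSphere = 4 * Real.pi / (β + 1) := by
  -- the Gaussian integral factors in Cartesian coordinates and in polar coordinates
  have h := integral_norm_mul_abs_rpow (fun r => Real.exp (-r ^ 2)) β
  have hhalf : ∫ t in Ioi (0 : ℝ), t ^ β * Real.exp (-t ^ 2) =
      1 / 2 * Real.Gamma ((β + 1) / 2) := by
    have := integral_rpow_mul_exp_neg_rpow (p := 2) (q := β) two_pos (by linarith)
    simpa only [Real.rpow_two] using this
  have hrad : ∫ r in Ioi (0 : ℝ), r ^ 2 * (r ^ β * Real.exp (-r ^ 2)) =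
      1 / 2 * ((β + 1) / 2 * Real.Gamma ((β + 1) / 2)) := by
    have := integral_rpow_mul_exp_neg_rpow (p := 2) (q := β + 2) two_pos (by linarith)
    rw [show (β + 2 + 1) / 2 = (β + 1) / 2 + 1 by ring, Real.Gamma_add_one (by positivity)] at this
    rw [← this]
    refine setIntegral_congr_fun measurableSet_Ioi fun r hr => ?_
    simp only [Real.rpow_two]
    rw [Real.rpow_add hr, Real.rpow_two]
    ring
  have hgauss : ∫ t : ℝ, Real.exp (-t ^ 2) = √Real.pi := by
    have := integral_gaussian 1
    simpa using this
  have hfirst : ∫ t : ℝ, |t| ^ β * Real.exp (-t ^ 2) = Real.Gamma ((β + 1) / 2) := by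
    have := integral_comp_abs (f := fun t => t ^ β * Real.exp (-t ^ 2))
    simp only [sq_abs] at this
    rw [this, hhalf]
    ring
  have hL : ∫ y : E3, Real.exp (-‖y‖ ^ 2) * |y 0| ^ β = Real.Gamma ((β + 1) / 2) * Real.pi := by
    set f : Fin 3 → ℝ → ℝ := ![fun t => |t| ^ β * Real.exp (-t ^ 2), fun t => Real.exp (-t ^ 2),
      fun t => Real.exp (-t ^ 2)]
    have e1 : ∫ y : E3, Real.exp (-‖y‖ ^ 2) * |y 0| ^ β =
        ∫ y : E3, (fun v : Fin 3 → ℝ => ∏ i, f i (v i)) (WithLp.ofLp y) := by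
      congr 1
      ext y
      rw [EuclideanSpace.norm_sq_eq]
      simp only [Fin.prod_univ_three, Fin.sum_univ_three, f, Matrix.cons_val_zero,
        Matrix.cons_val_one, Matrix.cons_val, Real.norm_eq_abs, sq_abs, neg_add, Real.exp_add]
      ring
    have e2 := (PiLp.volume_preserving_ofLp (Fin 3)).integral_comp
      (MeasurableEquiv.toLp 2 (Fin 3 → ℝ)).symm.measurableEmbedding
      (fun v : Fin 3 → ℝ => ∏ i, f i (v i))
    refine (e1.trans e2).trans ?_
    rw [integral_fintype_prod_volume_eq_prod, Fin.prod_univ_three]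
    simp only [f, Matrix.cons_val_zero, Matrix.cons_val_one, Matrix.cons_val]
    rw [hfirst, hgauss, mul_assoc, Real.mul_self_sqrt Real.pi_pos.le]
  rw [hL, hrad] at h
  have hG := (Real.Gamma_pos_of_pos (by positivity : 0 < (β + 1) / 2)).ne'
  have h1 : β + 1 ≠ 0 := by positivity
  field_simp at h ⊢
  linear_combination -h

/-- The radial derivative of the cut-off `S(|y|² - 1)`, weighted by a homogeneous function of degree
`-1`. -/
noncomputable def shellDensity (β : ℝ) (y : E3) : ℝ :=
  2 * deriv Real.smoothTransition (‖y‖ ^ 2 - 1) * ‖y‖ ^ (-(β + 1)) * |y 0| ^ β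

theorem integral_shellDensity {β : ℝ} (hβ : 0 ≤ β) :
    ∫ y, shellDensity β y = 4 * Real.pi / (β + 1) := by
  have h := integral_norm_mul_abs_rpow
    (fun r => 2 * deriv Real.smoothTransition (r ^ 2 - 1) * r ^ (-(β + 1))) β
  have hrad : ∫ r in Ioi (0 : ℝ), r ^ 2 * (r ^ β * (2 * deriv Real.smoothTransition (r ^ 2 - 1) *
      r ^ (-(β + 1)))) = 1 := by
    have e : ∫ r in Ioi (0 : ℝ), r ^ 2 * (r ^ β * (2 * deriv Real.smoothTransition (r ^ 2 - 1) *
        r ^ (-(β + 1)))) = ∫ r in Ioi (0 : ℝ), deriv Real.smoothTransition (r ^ 2 - 1) * (2 * r) := by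
      refine setIntegral_congr_fun measurableSet_Ioi fun r (hr : 0 < r) => ?_
      have h1 : r ^ β * r ^ (-(β + 1)) = r⁻¹ := by
        rw [← Real.rpow_add hr, ← Real.rpow_neg_one]; congr 1; ring
      calc _ = 2 * r ^ 2 * deriv Real.smoothTransition (r ^ 2 - 1) * (r ^ β * r ^ (-(β + 1))) := by
            ring
        _ = _ := by rw [h1]; field_simp
    rw [e]
    have hd : ∀ r ∈ Ici (0 : ℝ), HasDerivAt (fun r => Real.smoothTransition (r ^ 2 - 1))
        (deriv Real.smoothTransition (r ^ 2 - 1) * (2 * r)) r := by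
      intro r _
      have d1 : HasDerivAt (fun r : ℝ => r ^ 2 - 1) (2 * r) r := by
        simpa using ((hasDerivAt_id r).pow 2).sub_const 1
      exact (((Real.smoothTransition.contDiff (n := 1)).differentiable one_ne_zero
        _).hasDerivAt).comp r d1
    have hcont : Continuous fun r : ℝ => deriv Real.smoothTransition (r ^ 2 - 1) * (2 * r) :=
      (continuous_deriv_smoothTransition.comp (by fun_prop)).mul (by fun_prop)
    have hsupp : HasCompactSupport fun r : ℝ => deriv Real.smoothTransition (r ^ 2 - 1) * (2 * r) := by
      refine HasCompactSupport.intro (isCompact_Icc (a := (-2 : ℝ)) (b := 2)) fun r hr => ?_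
      rw [deriv_smoothTransition_eq_zero, zero_mul]
      intro hr'
      exact hr (abs_le.1 (abs_le_of_sq_le_sq (by linarith [hr'.2]) two_pos.le))
    have htend : Tendsto (fun r : ℝ => Real.smoothTransition (r ^ 2 - 1)) atTop (𝓝 1) := by
      refine tendsto_const_nhds.congr' ?_
      filter_upwards [eventually_ge_atTop 2] with r hr
      exact (Real.smoothTransition.one_of_one_le (by nlinarith)).symm
    rw [integral_Ioi_of_hasDerivAt_of_tendsto' hd
      (hcont.integrable_of_hasCompactSupport hsupp).integrableOn htend]
    rw [Real.smoothTransition.zero_of_nonpos (by norm_num), sub_zero]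
  rw [hrad, mul_one, integral_sphere_abs_rpow hβ] at h
  exact h

theorem norm_mem_of_deriv_smoothTransition_ne_zero {y : E3}
    (h : deriv Real.smoothTransition (‖y‖ ^ 2 - 1) ≠ 0) : 1 ≤ ‖y‖ ∧ ‖y‖ ≤ 2 := by
  have h1 : ‖y‖ ^ 2 - 1 ∈ Icc (0 : ℝ) 1 := by
    by_contra h'
    exact h (deriv_smoothTransition_eq_zero h')
  have h0 := norm_nonneg y
  constructor <;> nlinarith [h1.1, h1.2]

theorem integrable_shellDensity {β : ℝ} (hβ : 0 ≤ β) : Integrable (shellDensity β) := by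
  obtain ⟨C, C0, hC⟩ := exists_abs_deriv_smoothTransition_le
  have hm : Measurable (shellDensity β) := by
    have := continuous_deriv_smoothTransition.measurable
    unfold shellDensity
    fun_prop
  have hi : Integrable ((Metric.closedBall (0 : E3) 2).indicator fun _ => 2 * C) :=
    (integrable_indicator_iff Metric.isClosed_closedBall.measurableSet).2
      (integrableOn_const (isCompact_closedBall _ _).measure_lt_top.ne)
  refine hi.mono' hm.aestronglyMeasurable (.of_forall fun y => ?_)
  by_cases h : deriv Real.smoothTransition (‖y‖ ^ 2 - 1) = 0
  · rw [shellDensity, h]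
    simp only [mul_zero, zero_mul, norm_zero]
    exact indicator_nonneg (fun _ _ => by positivity) _
  · obtain ⟨h1, h2⟩ := norm_mem_of_deriv_smoothTransition_ne_zero h
    rw [indicator_of_mem (by simpa using h2), shellDensity, norm_mul, norm_mul, norm_mul,
      Real.norm_of_nonneg (Real.rpow_nonneg (norm_nonneg y) _),
      Real.norm_of_nonneg (Real.rpow_nonneg (abs_nonneg (y 0)) _), Real.norm_two]
    have h3 : ‖y‖ ^ (-(β + 1)) * |y 0| ^ β ≤ 1 := by
      have h4 : |y 0| ^ β ≤ ‖y‖ ^ β :=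
        Real.rpow_le_rpow (abs_nonneg _) (PiLp.norm_apply_le y 0) hβ
      calc _ ≤ ‖y‖ ^ (-(β + 1)) * ‖y‖ ^ β := by gcongr
        _ = ‖y‖ ^ (-1 : ℝ) := by rw [← Real.rpow_add (by linarith)]; congr 1; ring
        _ ≤ 1 := Real.rpow_le_one_of_one_le_of_nonpos h1 (by norm_num)
    have h5 := hC (‖y‖ ^ 2 - 1)
    rw [← Real.norm_eq_abs] at h5
    calc _ = 2 * ‖deriv Real.smoothTransition (‖y‖ ^ 2 - 1)‖ * (‖y‖ ^ (-(β + 1)) * |y 0| ^ β) := by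
          ring
      _ ≤ 2 * C * 1 := by gcongr
      _ = _ := mul_one _

theorem ae_inner_ne_zero {n : E3} (hn : n ≠ 0) : ∀ᵐ y : E3, inner ℝ n y ≠ 0 := by
  have h := Measure.addHaar_submodule (volume : Measure E3) (innerSL ℝ n).ker (fun h => by
    have : n ∈ (innerSL ℝ n).ker := h ▸ Submodule.mem_top
    rw [LinearMap.mem_ker] at this
    exact hn (inner_self_eq_zero.1 this))
  rw [ae_iff]
  simp only [ne_eq, not_not]
  exact h

/-- A set that is symmetric under an isometry exchanging the two sides of the plane `n⊥` is cut in
half by this plane. -/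
theorem setIntegral_inter_neg_side {w : E3 → ℝ} (hw : Integrable w) {n : E3} (hn : n ≠ 0)
    (ρ : E3 ≃ₗᵢ[ℝ] E3) (hwρ : ∀ y, w (ρ y) = w y) {B : Set E3} (hB : MeasurableSet B)
    (hBρ : ∀ y, ρ y ∈ B ↔ y ∈ B) (hnρ : ∀ y, inner ℝ n (ρ y) = -inner ℝ n y) :
    ∫ y in B ∩ {y | inner ℝ n y < 0}, w y = 1 / 2 * ∫ y in B, w y := by
  have hN : MeasurableSet {y : E3 | inner ℝ n y < 0} :=
    (isOpen_lt (by fun_prop) continuous_const).measurableSet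
  have hPos : MeasurableSet {y : E3 | 0 < inner ℝ n y} :=
    (isOpen_lt continuous_const (by fun_prop)).measurableSet
  have h1 : ∫ y in B ∩ {y | 0 < inner ℝ n y}, w y = ∫ y in B ∩ {y | inner ℝ n y < 0}, w y := by
    have := ρ.measurePreserving.setIntegral_preimage_emb ρ.toHomeomorph.measurableEmbedding w
      (B ∩ {y | inner ℝ n y < 0})
    rw [← this]
    have e : ρ ⁻¹' (B ∩ {y | inner ℝ n y < 0}) = B ∩ {y | 0 < inner ℝ n y} := by
      ext y
      simp [hBρ, hnρ]
    rw [e]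
    simp only [hwρ]
  have h2 : ∫ y in B, w y = ∫ y in (B ∩ {y | inner ℝ n y < 0}) ∪ (B ∩ {y | 0 < inner ℝ n y}), w y := by
    refine setIntegral_congr_set ?_
    filter_upwards [ae_inner_ne_zero hn] with y hy
    refine propext ⟨fun hyB => ?_, fun hyB => hyB.elim (fun h => h.1) fun h => h.1⟩
    exact (lt_or_gt_of_ne hy).elim (fun h => Or.inl ⟨hyB, h⟩) fun h => Or.inr ⟨hyB, h⟩
  have hdisj : Disjoint (B ∩ {y : E3 | inner ℝ n y < 0}) (B ∩ {y | 0 < inner ℝ n y}) := by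
    rw [Set.disjoint_left]
    rintro y ⟨-, h3⟩ ⟨-, h4⟩
    have h3' : inner ℝ n y < 0 := h3
    exact lt_asymm h3' h4
  rw [setIntegral_union hdisj (hB.inter hPos) hw.integrableOn hw.integrableOn, h1] at h2
  linarith

/-! ### The flux as a blow-up integral -/

/-- A smooth function that vanishes within distance `δ` of `P` and is `1` at distance `2δ` and
beyond. -/
noncomputable def poleCutoff (P : E3) (δ : ℝ) (M : E3) : ℝ :=
  Real.smoothTransition (‖M - P‖ ^ 2 / δ ^ 2 - 1)

theorem contDiff_poleCutoff (P : E3) (δ : ℝ) : ContDiff ℝ 1 (poleCutoff P δ) := by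
  have h : ContDiff ℝ 1 fun M : E3 => ‖M - P‖ ^ 2 / δ ^ 2 - 1 :=
    ((((contDiff_id (n := 1)).sub contDiff_const).norm_sq ℝ).div_const _).sub contDiff_const
  exact (Real.smoothTransition.contDiff (n := 1)).comp h

theorem poleCutoff_eq_zero {P M : E3} {δ : ℝ} (hδ : 0 < δ) (hM : M ∈ Metric.ball P δ) :
    poleCutoff P δ M = 0 := by
  refine Real.smoothTransition.zero_of_nonpos ?_
  rw [Metric.mem_ball, dist_eq_norm] at hM
  have : ‖M - P‖ ^ 2 / δ ^ 2 ≤ 1 := by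
    rw [div_le_one (by positivity)]
    gcongr
  linarith

theorem poleCutoff_eq_one {P M : E3} {δ : ℝ} (hδ : 0 < δ) (hM : 2 * δ ≤ ‖M - P‖) :
    poleCutoff P δ M = 1 := by
  refine Real.smoothTransition.one_of_one_le ?_
  have : 2 ≤ ‖M - P‖ ^ 2 / δ ^ 2 := by
    rw [le_div_iff₀ (by positivity)]
    nlinarith [norm_nonneg (M - P)]
  linarith

theorem norm_poleCutoff_le (P : E3) (δ : ℝ) (M : E3) : ‖poleCutoff P δ M‖ ≤ 1 := by
  rw [poleCutoff, Real.norm_of_nonneg (Real.smoothTransition.nonneg _)]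
  exact Real.smoothTransition.le_one _

theorem fderiv_poleCutoff (P : E3) (δ : ℝ) (M v : E3) : fderiv ℝ (poleCutoff P δ) M v =
    deriv Real.smoothTransition (‖M - P‖ ^ 2 / δ ^ 2 - 1) * (2 * inner ℝ (M - P) v / δ ^ 2) := by
  have d1 := ((((hasFDerivAt_id M).sub_const P).norm_sq).mul_const (δ ^ 2)⁻¹).sub_const 1
  have d2 := (((Real.smoothTransition.contDiff (n := 1)).differentiable one_ne_zero
    (‖M - P‖ ^ 2 * (δ ^ 2)⁻¹ - 1)).hasDerivAt).comp_hasFDerivAt M d1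
  have e : poleCutoff P δ = Real.smoothTransition ∘ fun N : E3 => ‖id N - P‖ ^ 2 * (δ ^ 2)⁻¹ - 1 := by
    ext N; simp [poleCutoff, div_eq_mul_inv]
  rw [e, d2.fderiv]
  simp only [smul_apply, ContinuousLinearMap.comp_apply, ContinuousLinearMap.id_apply, id_eq,
    innerSL_apply_apply, smul_eq_mul, nsmul_eq_mul, div_eq_mul_inv]
  push_cast
  ring

namespace HasHolderBoundary

variable {D Γ : Set E3} {ν : E3 → E3} {A l : ℝ}

/-- The flux through the whole surface is the limit of the fluxes of the fields truncated near the
pole. -/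
theorem tendsto_integral_poleCutoff (h : HasHolderBoundary D Γ ν A l) {α : ℝ} (hα0 : 0 < α)
    (hα1 : 2 * α < 1) {P : E3} (hP : 0 ≤ P 0) :
    Tendsto (fun δ : ℝ => ∫ M in D, fderiv ℝ (poleCutoff P δ) M (fluxField α P M)) (𝓝[>] 0)
      (𝓝 (∫ M, inner ℝ (fluxField α P M) (ν M) ∂surfaceMeasure Γ)) := by
  have hi := h.integrable_fluxField hα0 hα1 hP
  have h1 : Tendsto (fun δ : ℝ => ∫ M, poleCutoff P δ M * inner ℝ (fluxField α P M) (ν M)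
      ∂surfaceMeasure Γ) (𝓝[>] 0)
      (𝓝 (∫ M, inner ℝ (fluxField α P M) (ν M) ∂surfaceMeasure Γ)) := by
    refine tendsto_integral_filter_of_dominated_convergence
      (fun M => ‖inner ℝ (fluxField α P M) (ν M)‖)
      (.of_forall fun δ => (contDiff_poleCutoff P δ).continuous.aestronglyMeasurable.mul
        hi.aestronglyMeasurable) (.of_forall fun δ => .of_forall fun M => ?_) hi.norm ?_
    · rw [norm_mul]
      exact mul_le_of_le_one_left (norm_nonneg _) (norm_poleCutoff_le P δ M)
    · filter_upwards [h.ae_mem_regularSet P] with M hM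
      have hr : 0 < ‖M - P‖ := norm_pos_iff.2 (sub_ne_zero.2 hM.2.2)
      refine tendsto_const_nhds.congr' ?_
      filter_upwards [Ioo_mem_nhdsGT (half_pos hr)] with δ hδ
      rw [poleCutoff_eq_one hδ.1 (by linarith [hδ.2]), one_mul]
  refine h1.congr' ?_
  filter_upwards [self_mem_nhdsWithin] with δ (δ0 : 0 < δ)
  exact (h.integral_fderiv_fluxField hα0 hα1 hP (contDiff_poleCutoff P δ) δ0
    fun M hM => poleCutoff_eq_zero δ0 hM).symm

/-- There is no flux if the pole lies outside of the domain. -/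
theorem flux_eq_zero (h : HasHolderBoundary D Γ ν A l) {α : ℝ} (hα0 : 0 < α)
    (hα1 : 2 * α < 1) {P : E3} (hP : 0 ≤ P 0) (hPD : P ∉ closure D) :
    ∫ M, inner ℝ (fluxField α P M) (ν M) ∂surfaceMeasure Γ = 0 := by
  rw [Metric.mem_closure_iff] at hPD
  push Not at hPD
  obtain ⟨ε, ε0, hε⟩ := hPD
  refine tendsto_nhds_unique (h.tendsto_integral_poleCutoff hα0 hα1 hP)
    (tendsto_const_nhds.congr' ?_)
  filter_upwards [Ioo_mem_nhdsGT (half_pos ε0)] with δ hδ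
  rw [setIntegral_congr_fun h.isOpen.measurableSet (g := fun _ => (0 : ℝ)), integral_zero]
  intro M hM
  have : poleCutoff P δ =ᶠ[𝓝 M] fun _ => 1 := by
    filter_upwards [h.isOpen.mem_nhds hM] with N hN
    refine poleCutoff_eq_one hδ.1 ?_
    have := hε N hN
    rw [dist_comm, dist_eq_norm] at this
    linarith [hδ.2]
  simp only
  rw [this.fderiv_eq, fderiv_fun_const]
  rfl

/-- Scaling by `δ` about the pole turns the truncated flux into an integral over the blown-up
domain, and dominated convergence applies because the field is `O(r ^ (-2))`. -/
theorem flux_eq_of_blowup (h : HasHolderBoundary D Γ ν A l) {α : ℝ} (hα0 : 0 < α)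
    (hα1 : 2 * α < 1) {P : E3} (hP : 0 ≤ P 0) {G : E3 → ℝ}
    (hG : ∀ᵐ y : E3, Tendsto (fun δ : ℝ => {y : E3 | P + δ • y ∈ D}.indicator (fun y =>
      2 * deriv Real.smoothTransition (‖y‖ ^ 2 - 1) * inner ℝ y (δ ^ 2 • fluxField α P (P + δ • y))) y)
      (𝓝[>] 0) (𝓝 (G y))) :
    ∫ M, inner ℝ (fluxField α P M) (ν M) ∂surfaceMeasure Γ = ∫ y, G y := by
  set H : ℝ → E3 → ℝ := fun δ => {y : E3 | P + δ • y ∈ D}.indicator (fun y =>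
      2 * deriv Real.smoothTransition (‖y‖ ^ 2 - 1) * inner ℝ y (δ ^ 2 • fluxField α P (P + δ • y)))
  have hscale : ∀ δ > 0, ∫ M in D, fderiv ℝ (poleCutoff P δ) M (fluxField α P M) = ∫ y, H δ y := by
    intro δ δ0
    set f : E3 → ℝ := D.indicator fun M => fderiv ℝ (poleCutoff P δ) M (fluxField α P M)
    have e1 : H δ = fun y => δ ^ 3 * f (P + δ • y) := by
      ext y
      by_cases hy : P + δ • y ∈ D
      · simp only [H, f]
        rw [indicator_of_mem hy, indicator_of_mem (show y ∈ {y : E3 | P + δ • y ∈ D} from hy),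
          fderiv_poleCutoff, add_sub_cancel_left, norm_smul, Real.norm_of_nonneg δ0.le,
          real_inner_smul_left, real_inner_smul_right, mul_pow, mul_div_cancel_left₀ _ (by positivity)]
        field_simp
      · simp only [H, f]
        rw [indicator_of_notMem hy, indicator_of_notMem (show y ∉ {y : E3 | P + δ • y ∈ D} from hy),
          mul_zero]
    rw [← integral_indicator h.isOpen.measurableSet, e1, integral_const_mul,
      Measure.integral_comp_smul volume (fun y => f (P + y)) δ, integral_add_left_eq_self f P]
    simp only [finrank_euclideanSpace_fin, smul_eq_mul]
    rw [abs_of_pos (by positivity), mul_inv_cancel_left₀ (by positivity)]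
  refine tendsto_nhds_unique (h.tendsto_integral_poleCutoff hα0 hα1 hP) ?_
  refine Tendsto.congr' (f₁ := fun δ => ∫ y, H δ y) ?_ ?_
  · filter_upwards [self_mem_nhdsWithin] with δ (δ0 : 0 < δ) using (hscale δ δ0).symm
  obtain ⟨C, C0, hC⟩ := exists_abs_deriv_smoothTransition_le
  set K := 3 * ((2 * α + 1) / (2 * Real.pi))
  have hK0 : 0 ≤ K := by positivity
  have hi : Integrable ((Metric.closedBall (0 : E3) 2).indicator fun _ => 2 * C * K) :=
    (integrable_indicator_iff Metric.isClosed_closedBall.measurableSet).2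
      (integrableOn_const (isCompact_closedBall _ _).measure_lt_top.ne)
  refine tendsto_integral_filter_of_dominated_convergence _ ?_ ?_ hi hG
  · filter_upwards [self_mem_nhdsWithin] with δ (δ0 : 0 < δ)
    -- the value of the field at the pole is irrelevant
    classical
    have hW : Measurable ((D \ {P}).piecewise (fluxField α P) fun _ => 0) :=
      ContinuousOn.measurable_piecewise ((continuousOn_fluxField hα0 hP).mono
        fun M hM => ⟨h.subset hM.1, hM.2⟩) continuousOn_const
        (h.isOpen.measurableSet.diff (measurableSet_singleton P))
    have hline : Measurable fun y : E3 => P + δ • y := by fun_prop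
    have hm : Measurable fun y : E3 => 2 * deriv Real.smoothTransition (‖y‖ ^ 2 - 1) *
        inner ℝ y (δ ^ 2 • (D \ {P}).piecewise (fluxField α P) (fun _ => 0) (P + δ • y)) := by
      have h1 := continuous_deriv_smoothTransition.measurable
      have h2 := hW.comp hline
      simp only [Function.comp_def] at h2
      exact ((h1.comp (by fun_prop : Measurable fun y : E3 => ‖y‖ ^ 2 - 1)).const_mul 2).mul
        (measurable_id.inner (h2.const_smul (δ ^ 2)))
    refine Measurable.aestronglyMeasurable ?_
    convert! hm using 1
    ext y
    by_cases hy : P + δ • y ∈ D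
    · simp only [H]
      rw [indicator_of_mem (show y ∈ {y : E3 | P + δ • y ∈ D} from hy)]
      by_cases hy0 : y = 0
      · simp [hy0]
      · rw [piecewise_eq_of_mem]
        exact ⟨hy, by simp [hy0, δ0.ne']⟩
    · simp only [H]
      rw [indicator_of_notMem (show y ∉ {y : E3 | P + δ • y ∈ D} from hy), piecewise_eq_of_notMem]
      · simp
      · exact fun h' => hy h'.1
  · filter_upwards [self_mem_nhdsWithin] with δ (δ0 : 0 < δ)
    refine .of_forall fun y => ?_
    have hnn : 0 ≤ (Metric.closedBall (0 : E3) 2).indicator (fun _ => 2 * C * K) y :=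
      indicator_nonneg (fun _ _ => by positivity) _
    by_cases hy : P + δ • y ∈ D
    · simp only [H]
      rw [indicator_of_mem (show y ∈ {y : E3 | P + δ • y ∈ D} from hy)]
      by_cases hd : deriv Real.smoothTransition (‖y‖ ^ 2 - 1) = 0
      · rw [hd, mul_zero, zero_mul, norm_zero]
        exact hnn
      obtain ⟨h1, h2⟩ := norm_mem_of_deriv_smoothTransition_ne_zero hd
      have hy1 : 0 < ‖y‖ := by linarith
      have hy0 : y ≠ 0 := norm_pos_iff.1 hy1
      rw [indicator_of_mem (by simpa using h2), norm_mul, norm_mul, Real.norm_two]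
      have h3 := norm_fluxField_le hα0 hα1 hP (M := P + δ • y)
        ⟨h.subset hy, by simp [hy0, δ0.ne']⟩
      rw [add_sub_cancel_left, norm_smul, Real.norm_of_nonneg δ0.le] at h3
      have h4 : ‖inner ℝ y (δ ^ 2 • fluxField α P (P + δ • y))‖ ≤ K := by
        refine (norm_inner_le_norm y _).trans ?_
        rw [norm_smul, norm_pow, Real.norm_of_nonneg δ0.le]
        calc _ ≤ ‖y‖ * (δ ^ 2 * (K * ((δ * ‖y‖) ^ 2)⁻¹)) := by gcongr
          _ = K / ‖y‖ := by field_simp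
          _ ≤ K := div_le_self hK0 h1
      have h5 := hC (‖y‖ ^ 2 - 1)
      rw [← Real.norm_eq_abs] at h5
      gcongr
    · simp only [H]
      rw [indicator_of_notMem (show y ∉ {y : E3 | P + δ • y ∈ D} from hy), norm_zero]
      exact hnn

/-- The flux with a pole off the plane `x = 0`, when the blow-up of the domain is `B`. -/
theorem flux_eq_of_pos (h : HasHolderBoundary D Γ ν A l) {α : ℝ} (hα0 : 0 < α)
    (hα1 : 2 * α < 1) {P : E3} (hP : 0 < P 0) {B : Set E3} (hB : MeasurableSet B)
    (hmem : ∀ᵐ y : E3, ∀ᶠ δ : ℝ in 𝓝[>] 0, (P + δ • y ∈ D ↔ y ∈ B)) :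
    ∫ M, inner ℝ (fluxField α P M) (ν M) ∂surfaceMeasure Γ =
      -(1 / (4 * Real.pi)) * ∫ y in B, shellDensity 0 y := by
  rw [← integral_const_mul, ← integral_indicator hB]
  refine h.flux_eq_of_blowup hα0 hα1 hP.le ?_
  have hne : ∀ᵐ y : E3, y ≠ 0 := by
    rw [ae_iff]; simp
  filter_upwards [hmem, hne] with y hy hy0
  by_cases hyB : y ∈ B
  · have h1 := ((tendsto_const_nhds (x := y)).inner (𝕜 := ℝ)
      (tendsto_sq_smul_fluxField hα0 hα1 hP hy0)).const_mul
      (2 * deriv Real.smoothTransition (‖y‖ ^ 2 - 1))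
    rw [indicator_of_mem hyB]
    have e : 2 * deriv Real.smoothTransition (‖y‖ ^ 2 - 1) *
        inner ℝ y ((-(1 / (4 * Real.pi)) * (‖y‖ ^ 3)⁻¹) • y) =
        -(1 / (4 * Real.pi)) * shellDensity 0 y := by
      have hyn := norm_pos_iff.2 hy0
      rw [real_inner_smul_right, real_inner_self_eq_norm_sq, shellDensity, Real.rpow_zero, zero_add,
        Real.rpow_neg_one]
      field_simp
    rw [← e]
    refine h1.congr' ?_
    filter_upwards [hy] with δ hδ
    rw [indicator_of_mem (show y ∈ {y : E3 | P + δ • y ∈ D} from hδ.2 hyB)]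
  · rw [indicator_of_notMem hyB]
    refine tendsto_const_nhds.congr' ?_
    filter_upwards [hy] with δ hδ
    rw [indicator_of_notMem (show y ∉ {y : E3 | P + δ • y ∈ D} from fun h' => hyB (hδ.1 h'))]

/-- The flux with a pole on the plane `x = 0`, when the blow-up of the domain is `B`. -/
theorem flux_eq_of_eq_zero (h : HasHolderBoundary D Γ ν A l) {α : ℝ} (hα0 : 0 < α)
    (hα1 : 2 * α < 1) {P : E3} (hP : P 0 = 0) {B : Set E3} (hB : MeasurableSet B)
    (hBsub : B ⊆ halfSpace)
    (hmem : ∀ᵐ y : E3, ∀ᶠ δ : ℝ in 𝓝[>] 0, (P + δ • y ∈ D ↔ y ∈ B)) :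
    ∫ M, inner ℝ (fluxField α P M) (ν M) ∂surfaceMeasure Γ =
      -((2 * α + 1) / (2 * Real.pi)) * ∫ y in B, shellDensity (2 * α) y := by
  rw [← integral_const_mul, ← integral_indicator hB]
  refine h.flux_eq_of_blowup hα0 hα1 hP.ge ?_
  filter_upwards [hmem] with y hy
  refine tendsto_const_nhds.congr' ?_
  filter_upwards [hy, self_mem_nhdsWithin] with δ hδ (δ0 : 0 < δ)
  by_cases hyB : y ∈ B
  · have hy0 : 0 < y 0 := hBsub hyB
    have hyn : 0 < ‖y‖ := norm_pos_iff.2 (by rintro rfl; simp at hy0)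
    rw [indicator_of_mem hyB, indicator_of_mem (show y ∈ {y : E3 | P + δ • y ∈ D} from hδ.2 hyB),
      sq_smul_fluxField_of_eq_zero hα0 hP hy0 δ0, real_inner_smul_right, real_inner_self_eq_norm_sq,
      shellDensity, abs_of_pos hy0]
    have e : ‖y‖ ^ (-(2 * α + 1)) = ‖y‖ ^ (-(2 * α + 3)) * ‖y‖ ^ 2 := by
      rw [← Real.rpow_natCast _ 2, ← Real.rpow_add hyn]; congr 1; push_cast; ring
    rw [e]
    ring
  · rw [indicator_of_notMem hyB,
      indicator_of_notMem (show y ∉ {y : E3 | P + δ • y ∈ D} from fun h' => hyB (hδ.1 h'))]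

end HasHolderBoundary

/-! ### The Gauss formula -/

theorem shellDensity_congr {β : ℝ} {y z : E3} (hn : ‖y‖ = ‖z‖) (h0 : |y 0| = |z 0|) :
    shellDensity β y = shellDensity β z := by
  rw [shellDensity, shellDensity, hn, h0]

/-- Half of a spherical shell, cut by a plane through its centre. -/
theorem setIntegral_shellDensity_half {β : ℝ} (hβ : 0 ≤ β) {n : E3} (hn : n ≠ 0) :
    ∫ y in {y | inner ℝ n y < 0}, shellDensity β y = 2 * Real.pi / (β + 1) := by
  have h := setIntegral_inter_neg_side (integrable_shellDensity hβ) hn (LinearIsometryEquiv.neg ℝ)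
    (fun y => shellDensity_congr (by simp) (by simp)) MeasurableSet.univ (by simp) (by simp)
  rw [univ_inter, setIntegral_univ, integral_shellDensity hβ] at h
  rw [h]
  ring

theorem halfSpace_eq_inner : halfSpace = {y : E3 | inner ℝ (-EuclideanSpace.single 0 1 : E3) y < 0} := by
  ext y
  simp [halfSpace, EuclideanSpace.inner_single_left]

theorem setIntegral_shellDensity_halfSpace {β : ℝ} (hβ : 0 ≤ β) :
    ∫ y in halfSpace, shellDensity β y = 2 * Real.pi / (β + 1) := by
  rw [halfSpace_eq_inner]
  exact setIntegral_shellDensity_half hβ (by simp)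

/-- A quarter of a spherical shell, cut by the plane `x = 0` and a plane orthogonal to it. -/
theorem setIntegral_shellDensity_quarter {β : ℝ} (hβ : 0 ≤ β) {n : E3} (hn : n ≠ 0)
    (hn0 : n 0 = 0) :
    ∫ y in halfSpace ∩ {y | inner ℝ n y < 0}, shellDensity β y = Real.pi / (β + 1) := by
  set ρ : E3 ≃ₗᵢ[ℝ] E3 := (ℝ ∙ n)ᗮ.reflection
  have hsymm : ∀ v y : E3, inner ℝ v (ρ y) = inner ℝ (ρ v) y := fun v y => by
    rw [← ρ.inner_map_map v (ρ y)]
    simp only [ρ, Submodule.reflection_reflection]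
  have hρ0 : ∀ y : E3, (ρ y) 0 = y 0 := by
    intro y
    have h1 : ρ (EuclideanSpace.single 0 1) = EuclideanSpace.single 0 1 := by
      refine Submodule.reflection_mem_subspace_eq_self ?_
      rw [Submodule.mem_orthogonal_singleton_iff_inner_right, EuclideanSpace.inner_single_right]
      simp [hn0]
    have h2 := hsymm (EuclideanSpace.single 0 1) y
    rw [h1] at h2
    simpa [EuclideanSpace.inner_single_left] using h2
  rw [setIntegral_inter_neg_side (integrable_shellDensity hβ) hn ρ
    (fun y => shellDensity_congr (ρ.norm_map y) (by rw [hρ0])) isOpen_halfSpace.measurableSet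
    (fun y => by simp only [halfSpace, mem_ofPred_eq, hρ0]) (fun y => by
      rw [hsymm, show ρ n = -n from Submodule.reflection_orthogonalComplement_singleton_eq_neg n,
        inner_neg_left]), setIntegral_shellDensity_halfSpace hβ]
  ring

theorem tendsto_add_smul (P y : E3) : Tendsto (fun δ : ℝ => P + δ • y) (𝓝[>] 0) (𝓝 P) := by
  have : Continuous fun δ : ℝ => P + δ • y := by fun_prop
  simpa using (this.tendsto 0).mono_left nhdsWithin_le_nhds

namespace HasHolderBoundary

variable {D Γ : Set E3} {ν : E3 → E3} {A l : ℝ}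

theorem integrable_doubleLayerKernel (h : HasHolderBoundary D Γ ν A l) {α : ℝ} (hα0 : 0 < α)
    (hα1 : 2 * α < 1) {P : E3} (hP : 0 ≤ P 0) :
    Integrable (doubleLayerKernel α ν P) (surfaceMeasure Γ) := by
  refine (h.integrable_fluxField hα0 hα1 hP).congr ?_
  filter_upwards [h.ae_mem_regularSet P] with M hM
  exact (doubleLayerKernel_eq hα0 ν hP hM.2).symm

theorem integral_doubleLayerKernel (h : HasHolderBoundary D Γ ν A l) {α : ℝ} (hα0 : 0 < α)
    {P : E3} (hP : 0 ≤ P 0) : ∫ M, doubleLayerKernel α ν P M ∂surfaceMeasure Γ =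
      ∫ M, inner ℝ (fluxField α P M) (ν M) ∂surfaceMeasure Γ := by
  refine integral_congr_ae ?_
  filter_upwards [h.ae_mem_regularSet P] with M hM
  exact doubleLayerKernel_eq hα0 ν hP hM.2

/-- The blow-up at an interior point is the whole space. -/
theorem flux_of_mem (h : HasHolderBoundary D Γ ν A l) {α : ℝ} (hα0 : 0 < α) (hα1 : 2 * α < 1)
    {P : E3} (hP : P ∈ D) :
    ∫ M, inner ℝ (fluxField α P M) (ν M) ∂surfaceMeasure Γ = -1 := by
  rw [h.flux_eq_of_pos hα0 hα1 (h.subset hP) MeasurableSet.univ, setIntegral_univ,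
    integral_shellDensity le_rfl]
  · have := Real.pi_pos
    field_simp
    norm_num
  · refine .of_forall fun y => ?_
    filter_upwards [(tendsto_add_smul P y).eventually (h.isOpen.mem_nhds hP)] with δ hδ
    exact iff_of_true hδ (mem_univ y)

/-- The blow-up at a point of the surface is a half-space. -/
theorem flux_of_mem_surface (h : HasHolderBoundary D Γ ν A l) {α : ℝ} (hα0 : 0 < α)
    (hα1 : 2 * α < 1) {P : E3} (hP : P ∈ Γ) :
    ∫ M, inner ℝ (fluxField α P M) (ν M) ∂surfaceMeasure Γ = -(1 / 2) := by
  have hPc : P ∈ closure Γ := _root_.subset_closure hP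
  obtain ⟨n, hn1, hn⟩ := h.exists_limit_normal hPc
  have hn0 : n ≠ 0 := norm_pos_iff.1 (by rw [hn1]; exact one_pos)
  have hP0 := h.subset_halfSpace hP
  rw [h.flux_eq_of_pos hα0 hα1 hP0 (B := {y | inner ℝ n y < 0})
    (isOpen_lt (by fun_prop) continuous_const).measurableSet,
    setIntegral_shellDensity_half le_rfl hn0]
  · have := Real.pi_pos
    field_simp
    norm_num
  · filter_upwards [ae_inner_ne_zero hn0] with y hy
    have hH := (tendsto_add_smul P y).eventually (isOpen_halfSpace.mem_nhds hP0)
    rcases lt_or_gt_of_ne hy with hy | hy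
    · filter_upwards [hH, h.blowup_mem hPc hn1 hn hy] with δ h1 h2
      exact iff_of_true (h2 h1) hy
    · filter_upwards [hH, h.blowup_notMem hPc hn1 hn hy] with δ h1 h2
      exact iff_of_false (fun h' => h2 h1 (_root_.subset_closure h')) (not_lt.2 hy.le)

theorem add_smul_notMem (h : HasHolderBoundary D Γ ν A l) {P y : E3} (hP : P 0 = 0) (hy : y 0 ≤ 0)
    {δ : ℝ} (hδ : 0 < δ) : P + δ • y ∉ D := fun h' => by
  have h1 : 0 < (P + δ • y) 0 := h.subset h'
  simp only [PiLp.add_apply, PiLp.smul_apply, smul_eq_mul, hP, zero_add] at h1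
  exact absurd h1 (not_lt.2 (mul_nonpos_of_nonneg_of_nonpos hδ.le hy))

theorem add_smul_mem_halfSpace {P y : E3} (hP : P 0 = 0) (hy : 0 < y 0) {δ : ℝ} (hδ : 0 < δ) :
    P + δ • y ∈ halfSpace := by
  have := mul_pos hδ hy
  simpa [halfSpace, hP] using this

/-- The blow-up at a point of the plane part of the boundary is the half-space `x > 0`. -/
theorem flux_of_plane (h : HasHolderBoundary D Γ ν A l) {α : ℝ} (hα0 : 0 < α) (hα1 : 2 * α < 1)
    {P : E3} (hP : P 0 = 0) (hPD : P ∈ closure D) (hPΓ : P ∉ closure Γ) :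
    ∫ M, inner ℝ (fluxField α P M) (ν M) ∂surfaceMeasure Γ = -1 := by
  obtain ⟨r, r0, hr⟩ := h.exists_halfBall_subset hPD hPΓ
  rw [h.flux_eq_of_eq_zero hα0 hα1 hP isOpen_halfSpace.measurableSet subset_rfl,
    setIntegral_shellDensity_halfSpace (by linarith)]
  · have := Real.pi_pos
    field_simp
  · refine .of_forall fun y => ?_
    filter_upwards [(tendsto_add_smul P y).eventually (Metric.ball_mem_nhds P r0),
      self_mem_nhdsWithin] with δ h1 (δ0 : 0 < δ)
    by_cases hy : 0 < y 0
    · exact iff_of_true (hr ⟨add_smul_mem_halfSpace hP hy δ0, h1⟩) hy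
    · exact iff_of_false (h.add_smul_notMem hP (not_lt.1 hy) δ0) hy

/-- The blow-up at a point of the edge is the part of the half-space `x > 0` behind the limit tangent
plane, which is orthogonal to the plane `x = 0`. -/
theorem flux_of_edge (h : HasHolderBoundary D Γ ν A l) {α : ℝ} (hα0 : 0 < α) (hα1 : 2 * α < 1)
    {P : E3} (hP : P 0 = 0) (hPΓ : P ∈ closure Γ)
    (horth : Tendsto (fun q => ν q 0) (𝓝[Γ] P) (𝓝 0)) :
    ∫ M, inner ℝ (fluxField α P M) (ν M) ∂surfaceMeasure Γ = -(1 / 2) := by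
  obtain ⟨n, hn1, hn⟩ := h.exists_limit_normal hPΓ
  have hne : n ≠ 0 := norm_pos_iff.1 (by rw [hn1]; exact one_pos)
  have hn0 : n 0 = 0 := by
    have : (𝓝[Γ] P).NeBot := mem_closure_iff_nhdsWithin_neBot.1 hPΓ
    have hc : Continuous fun v : E3 => v 0 := by fun_prop
    exact tendsto_nhds_unique ((hc.tendsto n).comp (h.tendsto_normal hn)) horth
  rw [h.flux_eq_of_eq_zero hα0 hα1 hP (B := halfSpace ∩ {y | inner ℝ n y < 0})
    (isOpen_halfSpace.inter (isOpen_lt (by fun_prop) continuous_const)).measurableSet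
    inter_subset_left, setIntegral_shellDensity_quarter (by linarith) hne hn0]
  · have := Real.pi_pos
    field_simp
  · filter_upwards [ae_inner_ne_zero hne] with y hy
    by_cases hy0 : 0 < y 0
    · rcases lt_or_gt_of_ne hy with hy | hy
      · filter_upwards [self_mem_nhdsWithin, h.blowup_mem hPΓ hn1 hn hy] with δ (δ0 : 0 < δ) h2
        exact iff_of_true (h2 (add_smul_mem_halfSpace hP hy0 δ0)) ⟨hy0, hy⟩
      · filter_upwards [self_mem_nhdsWithin, h.blowup_notMem hPΓ hn1 hn hy] with δ (δ0 : 0 < δ) h2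
        exact iff_of_false
          (fun h' => h2 (add_smul_mem_halfSpace hP hy0 δ0) (_root_.subset_closure h'))
          fun h' => not_lt.2 hy.le h'.2
    · filter_upwards [self_mem_nhdsWithin] with δ (δ0 : 0 < δ)
      exact iff_of_false (h.add_smul_notMem hP (not_lt.1 hy0) δ0) fun h' => hy0 h'.1

end HasHolderBoundary

theorem lemma1 (α : ℝ) (hα0 : 0 < 2 * α) (hα1 : 2 * α < 1)
    (D X Γ γ : Set E3) (ν : E3 → E3)
    (hD : IsBoundedBy D X Γ γ) (hΓ : IsLyapunovSurface Γ ν) (hν : PointsOutward D Γ ν)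
    (hγ : MeetsPlaneOrthogonally Γ γ ν) :
    (∀ P : E3, 0 ≤ P 0 → Integrable (doubleLayerKernel α ν P) (surfaceMeasure Γ)) ∧
    (∀ P ∈ D ∪ X, ∫ M, doubleLayerKernel α ν P M ∂(surfaceMeasure Γ) = -1) ∧
    (∀ P ∈ Γ ∪ γ, ∫ M, doubleLayerKernel α ν P M ∂(surfaceMeasure Γ) = -(1 / 2)) ∧
    (∀ P : E3, 0 ≤ P 0 → P ∉ closure D →
      ∫ M, doubleLayerKernel α ν P M ∂(surfaceMeasure Γ) = 0) := by
  have hα : 0 < α := by linarith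
  obtain ⟨A, l, h⟩ := hD.hasHolderBoundary hΓ hν
  have hplane : IsClosed planeYZ := isClosed_eq (by fun_prop) continuous_const
  refine ⟨fun P hP => h.integrable_doubleLayerKernel hα hα1 hP, ?_, ?_, fun P hP hPD => ?_⟩
  · rintro P (hP | hP)
    · have hP0 : 0 < P 0 := h.subset hP
      rw [h.integral_doubleLayerKernel hα hP0.le, h.flux_of_mem hα hα1 hP]
    · have hP0 : P 0 = 0 := hD.plane_subset hP
      have hPΓ : P ∉ closure Γ := by
        intro hc
        have hPγ : P ∈ γ := by
          rw [hD.edge_surface]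
          exact ⟨hc, fun h' => (hD.surface_subset h').ne' hP0⟩
        rw [hD.edge_plane] at hPγ
        exact hPγ.2 hP
      have hPD : P ∈ closure D := frontier_subset_closure
        (hD.frontier_eq ▸ Or.inl (Or.inl hP))
      rw [h.integral_doubleLayerKernel hα hP0.ge, h.flux_of_plane hα hα1 hP0 hPD hPΓ]
  · rintro P (hP | hP)
    · have hP0 : 0 < P 0 := hD.surface_subset hP
      rw [h.integral_doubleLayerKernel hα hP0.le, h.flux_of_mem_surface hα hα1 hP]
    · have hP0 : P 0 = 0 := by
        have h1 : P ∈ closure X \ X := hD.edge_plane ▸ hP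
        exact closure_minimal hD.plane_subset hplane h1.1
      have hPΓ : P ∈ closure Γ := by
        have h1 : P ∈ closure Γ \ Γ := hD.edge_surface ▸ hP
        exact h1.1
      rw [h.integral_doubleLayerKernel hα hP0.ge, h.flux_of_edge hα hα1 hP0 hPΓ (hγ P hP)]
  · rw [h.integral_doubleLayerKernel hα hP, h.flux_eq_zero hα hα1 hP hPD]
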